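/- Let $\mathcal A$ be the mod 2 Steenrod algebra and $\mathcal U$ the category of unstable $\mathcal A$-modules (morphisms have degree $0$). For $k\ge 0$ let $J(k)$ be the Brown–Gitler module, i.e. the unstable module representing $M\mapsto (M^k)^*$: $\mathrm{Hom}_{\mathcal U}(M,J(k))\cong (M^k)^*$. Let $GL_m=GL_m(\mathbb F_2)$ act on $\mathbb F_2[x_1,\dots,x_m]=H^*(B(\mathbb Z/2)^m;\mathbb F_2)$ by $(\sigma\cdot f)(x_1,\dots,x_m)=f(\sum_j\sigma_{j,1}x_j,\dots,\sum_j\sigma_{j,m}x_j)$, and let $e_m=\bar B_m\bar\Sigma_m\in\mathbb F_2[GL_m]$ be the Steinberg idempotent, where $\bar B_m$ and $\bar\Sigma_m$ are the sums of all upper triangular invertible matrices and of all permutation matrices. Let $\omega_m$ be the product of all nonzero linear forms in $x_1,\dots,x_m$, and put $$M_m=e_m\cdot\mathbb F_2[x_1,\dots,x_m],\qquad L_m=\omega_mM_m,\qquad L'_m=\omega_mL_m .$$ In particular $L_1=(x)\subset\mathbb F_2[x]$ and $L'_1=(x^2)$. Identify $L_1^{\otimes m}$ with the ideal $(x_1\cdots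 x_m)\subset\mathbb F_2[x_1,\dots,x_m]$, so that $L_2\subset L_1^{\otimes 2}$. Let $n\ge 1$. For every $s\ge 0$ there is a unique nonzero morphism $\pi_s:L_1\to J(2^s)$ in $\mathcal U$, and there is a unique nonzero morphism $\mu:J(2^{n-1})\otimes J(2^{n-2})\otimes\cdots\otimes J(1)\to J(2^n-1)$ in $\mathcal U$. Let $$g_n:\ L_1^{\otimes n}\xrightarrow{\ \pi_{n-1}\otimes\cdots\otimes\pi_0\ }J(2^{n-1})\otimes\cdots\otimes J(1)\xrightarrow{\ \mu\ }J(2^n-1),$$ and let $MP(i)=L_1^{\otimes i-1}\otimes L_2\otimes L_1^{\otimes n-i-1}\subset L_1^{\otimes n}$ for $1\le i\le n-1$ and $MP(n)=L_1^{\otimes n-1}\otimes L'_1$. **Theorem.** The morphism $g_n$ is surjective, the subspace $MP(1)+\cdots+MP(n)$ is an unstable submodule of $L_1^{\otimes n}$, and $g_n$ induces an isomorphism of unstable modules $$\frac{L_1^{\otimes n}}{MP(1)+\cdots+MP(n)}\;\cong\;J(2^n-1).$$ -/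

import Mathlib

noncomputable section

/-! ## The mod 2 Steenrod algebra and unstable modules -/

/-- The defining relations of the mod 2 Steenrod algebra on the generators `Sq^i`:
`Sq^0 = 1` and the Adem relations. (For `c ≤ i / 2` and `i < 2 * j` all subtractions
below are genuine.) -/
inductive AdemRel : FreeAlgebra (ZMod 2) ℕ → FreeAlgebra (ZMod 2) ℕ → Prop
  | sq_zero : AdemRel (FreeAlgebra.ι (ZMod 2) 0) 1
  | adem (i j : ℕ) (hi : 0 < i) (hij : i < 2 * j) :
      AdemRel (FreeAlgebra.ι (ZMod 2) i * FreeAlgebra.ι (ZMod 2) j)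
        (∑ c ∈ Finset.range (i / 2 + 1),
          (((j - c - 1).choose (i - 2 * c) : ℕ) : ZMod 2) •
            (FreeAlgebra.ι (ZMod 2) (i + j - c) * FreeAlgebra.ι (ZMod 2) c))

/-- The mod 2 Steenrod algebra. -/
abbrev SteenrodAlgebra : Type := RingQuot AdemRel

namespace SteenrodAlgebra

/-- The Steenrod square `Sq^i` as an element of the Steenrod algebra. -/
def Sq (i : ℕ) : SteenrodAlgebra :=
  RingQuot.mkAlgHom (ZMod 2) AdemRel (FreeAlgebra.ι (ZMod 2) i)

/-- The part of degree `e`: the span of the `Sq^{i_1} ⋯ Sq^{i_r}` with `i_1 + ⋯ + i_r = e`. -/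
def deg (e : ℕ) : Submodule (ZMod 2) SteenrodAlgebra :=
  Submodule.span (ZMod 2) {a | ∃ l : List ℕ, l.sum = e ∧ a = (l.map Sq).prod}

end SteenrodAlgebra

universe u v w

/-- Underlying data of a graded module over the Steenrod algebra: an `𝔽₂`-vector space,
its homogeneous parts, and the operations `Sq^i`. The laws are in `SqMod.IsUnstable`. -/
structure SqMod where
  carrier : Type u
  [grp : AddCommGroup carrier]
  [mod : Module (ZMod 2) carrier]
  deg : ℕ → Submodule (ZMod 2) carrier
  sq : ℕ → carrier →ₗ[ZMod 2] carrier

attribute [instance] SqMod.grp SqMod.mod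

namespace SqMod

/-- The data form an unstable module over the mod 2 Steenrod algebra. -/
structure IsUnstable (M : SqMod.{u}) : Prop where
  isInternal : DirectSum.IsInternal M.deg
  sq_mem : ∀ (i d : ℕ) (x : M.carrier), x ∈ M.deg d → M.sq i x ∈ M.deg (d + i)
  rel : ∀ a b : FreeAlgebra (ZMod 2) ℕ, AdemRel a b →
    FreeAlgebra.lift (ZMod 2) (A := Module.End (ZMod 2) M.carrier) M.sq a =
      FreeAlgebra.lift (ZMod 2) (A := Module.End (ZMod 2) M.carrier) M.sq b
  unstable : ∀ (i d : ℕ) (x : M.carrier), x ∈ M.deg d → d < i → M.sq i x = 0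

/-- Morphisms: linear maps of degree zero that commute with all the `Sq^i`. -/
@[ext]
structure Hom (M : SqMod.{u}) (N : SqMod.{v}) where
  toLin : M.carrier →ₗ[ZMod 2] N.carrier
  map_deg : ∀ (d : ℕ) (x : M.carrier), x ∈ M.deg d → toLin x ∈ N.deg d
  map_sq : ∀ (i : ℕ) (x : M.carrier), toLin (M.sq i x) = N.sq i (toLin x)

/-- A morphism is nontrivial if it is not the zero map. -/
def Hom.Nontrivial {M : SqMod.{u}} {N : SqMod.{v}} (f : Hom M N) : Prop := f.toLin ≠ 0

/-- Composition of morphisms. -/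
def Hom.comp {M : SqMod.{u}} {N : SqMod.{v}} {P : SqMod.{w}} (g : Hom N P) (f : Hom M N) :
    Hom M P where
  toLin := g.toLin ∘ₗ f.toLin
  map_deg d x hx := g.map_deg d _ (f.map_deg d x hx)
  map_sq i x := by simp [f.map_sq, g.map_sq]

/-- Isomorphisms: a pair of mutually inverse morphisms. -/
structure Iso (M : SqMod.{u}) (N : SqMod.{v}) where
  hom : Hom M N
  inv : Hom N M
  hom_inv : ∀ x, inv.toLin (hom.toLin x) = x
  inv_hom : ∀ y, hom.toLin (inv.toLin y) = y

/-- A subspace closed under all the `Sq^i`. -/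
def Stable (M : SqMod.{u}) (S : Submodule (ZMod 2) M.carrier) : Prop :=
  ∀ i, S ≤ S.comap (M.sq i)

/-- The quotient by a stable subspace, with the induced operations and homogeneous parts. -/
def quot (M : SqMod.{u}) (S : Submodule (ZMod 2) M.carrier) (hS : M.Stable S) : SqMod.{u} where
  carrier := M.carrier ⧸ S
  deg d := (M.deg d).map S.mkQ
  sq i := S.mapQ S (M.sq i) (hS i)

open scoped TensorProduct in
/-- Degree `d` of `M_0 ⊗ ⋯ ⊗ M_{n-1}`: spanned by the tensors of elements whose degrees
add up to `d`. -/
def tensorDeg {n : ℕ} (M : Fin n → SqMod.{u}) (d : ℕ) :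
    Submodule (ZMod 2) (⨂[ZMod 2] i, (M i).carrier) :=
  Submodule.span (ZMod 2)
    {t | ∃ (a : Fin n → ℕ) (m : ∀ i, (M i).carrier),
      ∑ i, a i = d ∧ (∀ i, m i ∈ (M i).deg (a i)) ∧ t = PiTensorProduct.tprod (ZMod 2) m}

open scoped TensorProduct in
/-- The Cartan formula: `Sq^k (m_0 ⊗ ⋯ ⊗ m_{n-1})` is the sum of all
`Sq^{a_0} m_0 ⊗ ⋯ ⊗ Sq^{a_{n-1}} m_{n-1}` with `a_0 + ⋯ + a_{n-1} = k`. -/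
def tensorSq {n : ℕ} (M : Fin n → SqMod.{u}) (k : ℕ) :
    (⨂[ZMod 2] i, (M i).carrier) →ₗ[ZMod 2] ⨂[ZMod 2] i, (M i).carrier :=
  ∑ a ∈ Finset.Nat.antidiagonalTuple n k, PiTensorProduct.map fun i => (M i).sq (a i)

theorem map_tensorDeg {n : ℕ} {M N : Fin n → SqMod.{u}} (f : ∀ i, Hom (M i) (N i)) (d : ℕ) :
    tensorDeg M d ≤ (tensorDeg N d).comap (PiTensorProduct.map fun i => (f i).toLin) := by
  refine Submodule.span_le.2 ?_
  rintro _ ⟨a, m, ha, hm, rfl⟩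
  change _ ∈ tensorDeg N d
  rw [PiTensorProduct.map_tprod]
  exact Submodule.subset_span ⟨a, _, ha, fun i => (f i).map_deg _ _ (hm i), rfl⟩

theorem map_tensorSq {n : ℕ} {M N : Fin n → SqMod.{u}} (f : ∀ i, Hom (M i) (N i)) (k : ℕ) :
    (PiTensorProduct.map fun i => (f i).toLin) ∘ₗ tensorSq M k =
      tensorSq N k ∘ₗ PiTensorProduct.map fun i => (f i).toLin := by
  have h : ∀ a : Fin n → ℕ,
      (PiTensorProduct.map fun i => (f i).toLin) ∘ₗ (PiTensorProduct.map fun i => (M i).sq (a i)) =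
        (PiTensorProduct.map fun i => (N i).sq (a i)) ∘ₗ
          PiTensorProduct.map fun i => (f i).toLin := by
    intro a
    rw [← PiTensorProduct.map_comp, ← PiTensorProduct.map_comp]
    congr 1
    funext i
    ext y
    exact (f i).map_sq _ _
  ext1
  ext m
  simp only [tensorSq, LinearMap.compMultilinearMap_apply, LinearMap.comp_apply,
    LinearMap.sum_apply, map_sum]
  exact Finset.sum_congr rfl fun a _ =>
    LinearMap.congr_fun (h a) (PiTensorProduct.tprod (ZMod 2) m)

open scoped TensorProduct in
/-- The tensor product `M_0 ⊗ ⋯ ⊗ M_{n-1}`. -/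
def tensor {n : ℕ} (M : Fin n → SqMod.{u}) : SqMod.{u} where
  carrier := ⨂[ZMod 2] i, (M i).carrier
  deg := tensorDeg M
  sq := tensorSq M

/-- The tensor product of morphisms. -/
def tensorMap {n : ℕ} {M N : Fin n → SqMod.{u}} (f : ∀ i, Hom (M i) (N i)) :
    Hom (tensor M) (tensor N) where
  toLin := PiTensorProduct.map fun i => (f i).toLin
  map_deg d _ hx := map_tensorDeg f d hx
  map_sq k x := LinearMap.congr_fun (map_tensorSq f k) x

end SqMod

/-! ## Brown–Gitler modules -/

namespace BrownGitler

open SteenrodAlgebra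

/-- The part of degree `d` of `J(k)`: linear forms on the part of degree `k - d` of the Steenrod
algebra (extended by zero) that vanish on all `a Sq^i b` with `i > d + |b|`, that is, the dual
of the part of degree `k` of the free unstable module on a generator of degree `d`. -/
def deg (k d : ℕ) : Submodule (ZMod 2) (Module.Dual (ZMod 2) SteenrodAlgebra) where
  carrier := {φ | (∀ e, d + e ≠ k → ∀ a ∈ SteenrodAlgebra.deg e, φ a = 0) ∧
    ∀ (i e : ℕ) (a b : SteenrodAlgebra), b ∈ SteenrodAlgebra.deg e → d + e < i →
      φ (a * Sq i * b) = 0}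
  zero_mem' := by simp
  add_mem' {φ ψ} hφ hψ := by
    refine ⟨fun e he a ha => ?_, fun i e a b hb hi => ?_⟩
    · simp [hφ.1 e he a ha, hψ.1 e he a ha]
    · simp [hφ.2 i e a b hb hi, hψ.2 i e a b hb hi]
  smul_mem' c φ hφ := by
    refine ⟨fun e he a ha => ?_, fun i e a b hb hi => ?_⟩
    · simp [hφ.1 e he a ha]
    · simp [hφ.2 i e a b hb hi]

/-- The operation `(Sq^i φ)(a) = φ(a Sq^i)` on linear forms on the Steenrod algebra. -/
def dualSq (i : ℕ) : Module.Dual (ZMod 2) SteenrodAlgebra →ₗ[ZMod 2]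
    Module.Dual (ZMod 2) SteenrodAlgebra :=
  (LinearMap.mulRight (ZMod 2) (Sq i)).dualMap

theorem mul_Sq_mem {e : ℕ} (i : ℕ) {a : SteenrodAlgebra} (ha : a ∈ SteenrodAlgebra.deg e) :
    a * Sq i ∈ SteenrodAlgebra.deg (e + i) := by
  refine Submodule.span_induction (p := fun a _ => a * Sq i ∈ SteenrodAlgebra.deg (e + i))
    ?_ ?_ ?_ ?_ ha
  · rintro _ ⟨l, hl, rfl⟩
    exact Submodule.subset_span ⟨l ++ [i], by simp [hl], by simp⟩
  · simp
  · intro x y _ _ hx hy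
    rw [add_mul]
    exact add_mem hx hy
  · intro c x _ hx
    rw [smul_mul_assoc]
    exact Submodule.smul_mem _ _ hx

theorem dualSq_mem {k d : ℕ} (i : ℕ) {φ : Module.Dual (ZMod 2) SteenrodAlgebra}
    (hφ : φ ∈ deg k d) : dualSq i φ ∈ deg k (d + i) := by
  refine ⟨fun e he a ha => ?_, fun j e a b hb hj => ?_⟩
  · exact hφ.1 (e + i) (by omega) _ (mul_Sq_mem i ha)
  · change φ (a * Sq j * b * Sq i) = 0
    rw [mul_assoc]
    exact hφ.2 j (e + i) a _ (mul_Sq_mem i hb) (by omega)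

/-- The underlying space of `J(k)`: the sum of its homogeneous parts. -/
def space (k : ℕ) : Submodule (ZMod 2) (Module.Dual (ZMod 2) SteenrodAlgebra) := ⨆ d, deg k d

theorem dualSq_space (k i : ℕ) (φ : Module.Dual (ZMod 2) SteenrodAlgebra) (hφ : φ ∈ space k) :
    dualSq i φ ∈ space k := by
  have h : space k ≤ (space k).comap (dualSq i) :=
    iSup_le fun d φ hφ => (le_iSup (deg k) (d + i)) (dualSq_mem i hφ)
  exact h hφ

end BrownGitler

/-- The Brown–Gitler module `J(k)`. -/
def brownGitler (k : ℕ) : SqMod where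
  carrier := BrownGitler.space k
  deg d := (BrownGitler.deg k d).comap (BrownGitler.space k).subtype
  sq i := (BrownGitler.dualSq i).restrict (BrownGitler.dualSq_space k i)

namespace SteenrodAlgebra

theorem prod_mem_deg (l : List ℕ) : (l.map Sq).prod ∈ deg l.sum :=
  Submodule.subset_span ⟨l, rfl, rfl⟩

theorem mul_mem_deg {e f : ℕ} {a b : SteenrodAlgebra} (ha : a ∈ deg e) (hb : b ∈ deg f) :
    a * b ∈ deg (e + f) := by
  have h : deg e * deg f ≤ deg (e + f) := by
    rw [deg, deg, Submodule.span_mul_span]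
    refine Submodule.span_mono ?_
    rintro _ ⟨_, ⟨l, hl, rfl⟩, _, ⟨l', hl', rfl⟩, rfl⟩
    exact ⟨l ++ l', by simp [hl, hl'], by simp⟩
  exact h (Submodule.mul_mem_mul ha hb)

/-- The homogeneous parts span the Steenrod algebra. -/
theorem iSup_deg : ⨆ e, deg e = ⊤ := by
  refine eq_top_iff.2 fun a _ => ?_
  obtain ⟨x, rfl⟩ := RingQuot.mkAlgHom_surjective (ZMod 2) AdemRel a
  have h1 : (1 : SteenrodAlgebra) ∈ ⨆ e, deg e :=
    (le_iSup deg 0) (Submodule.subset_span ⟨[], rfl, by simp⟩)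
  induction x using FreeAlgebra.induction with
  | grade0 r =>
    rw [AlgHom.commutes, Algebra.algebraMap_eq_smul_one]
    exact Submodule.smul_mem _ _ h1
  | grade1 i =>
    exact (le_iSup deg i) (Submodule.subset_span ⟨[i], by simp, by simp [Sq]⟩)
  | mul x y hx hy =>
    rw [map_mul]
    have hx := hx trivial
    have hy := hy trivial
    refine Submodule.iSup_induction deg (motive := fun u =>
      u * RingQuot.mkAlgHom (ZMod 2) AdemRel y ∈ ⨆ e, deg e) hx (fun e u hu => ?_) (by simp)
      fun u v hu hv => by
        rw [add_mul]
        exact add_mem hu hv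
    refine Submodule.iSup_induction deg (motive := fun v => u * v ∈ ⨆ e, deg e) hy
      (fun f v hv => (le_iSup deg (e + f)) (mul_mem_deg hu hv)) (by simp)
      fun v w hv hw => by
        rw [mul_add]
        exact add_mem hv hw
  | add x y hx hy =>
    rw [map_add]
    exact add_mem (hx trivial) (hy trivial)

end SteenrodAlgebra

namespace BrownGitler

open SteenrodAlgebra

theorem lift_sq_apply (k : ℕ) (x : FreeAlgebra (ZMod 2) ℕ) (φ : (brownGitler k).carrier)
    (b : SteenrodAlgebra) :
    (FreeAlgebra.lift (ZMod 2) (A := Module.End (ZMod 2) (brownGitler k).carrier)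
      (brownGitler k).sq x φ).1 b = φ.1 (b * RingQuot.mkAlgHom (ZMod 2) AdemRel x) := by
  induction x using FreeAlgebra.induction generalizing φ b with
  | grade0 r =>
    rw [AlgHom.commutes, AlgHom.commutes, Algebra.algebraMap_eq_smul_one,
      Algebra.algebraMap_eq_smul_one, mul_smul_comm, mul_one, map_smul]
    rfl
  | grade1 i =>
    rw [FreeAlgebra.lift_ι_apply]
    rfl
  | mul x y hx hy =>
    rw [map_mul, Module.End.mul_apply, hx, hy, mul_assoc,
      map_mul (RingQuot.mkAlgHom (ZMod 2) AdemRel)]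
  | add x y hx hy =>
    rw [map_add, map_add, mul_add, map_add, ← hx, ← hy]
    rfl

/-- `J(k)` is an unstable module. -/
theorem isUnstable (k : ℕ) : (brownGitler k).IsUnstable where
  isInternal := by
    refine DirectSum.isInternal_submodule_of_iSupIndep_of_iSup_eq_top ?_ ?_
    · intro d
      rw [Submodule.disjoint_def]
      intro φ hφ hφ'
      have h : (⨆ d', ⨆ (_ : d' ≠ d), (brownGitler k).deg d') ≤
          { carrier := {ψ | ∀ e, d + e = k → ∀ a ∈ SteenrodAlgebra.deg e, ψ.1 a = 0}
            zero_mem' := fun e _ a _ => rfl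
            add_mem' := fun {ψ χ} hψ hχ e he a ha => by
              change ψ.1 a + χ.1 a = 0
              rw [hψ e he a ha, hχ e he a ha, add_zero]
            smul_mem' := fun c ψ hψ e he a ha => by
              change c • ψ.1 a = 0
              rw [hψ e he a ha, smul_zero] } :=
        iSup₂_le fun d' hd' ψ hψ e he a ha => hψ.1 e (by omega) a ha
      have h0 : ∀ a ∈ ⨆ e, SteenrodAlgebra.deg e, φ.1 a = 0 := by
        intro a ha
        have : (⨆ e, SteenrodAlgebra.deg e) ≤ LinearMap.ker φ.1 := iSup_le fun e a ha => by
          by_cases he : d + e = k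
          · exact h hφ' e he a ha
          · exact hφ.1 e he a ha
        exact this ha
      refine Subtype.ext (LinearMap.ext fun a => h0 a ?_)
      rw [iSup_deg]
      trivial
    · refine eq_top_iff.2 fun φ _ => ?_
      have h : space k ≤ (⨆ d, (brownGitler k).deg d).map (space k).subtype :=
        iSup_le fun d ψ hψ => ⟨⟨ψ, (le_iSup (deg k) d) hψ⟩,
          (le_iSup (brownGitler k).deg d) hψ, rfl⟩
      obtain ⟨ψ, hψ, hψφ⟩ := h φ.2
      rwa [← Subtype.ext hψφ]
  sq_mem i d φ hφ := dualSq_mem i hφ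
  rel a b hab := by
    refine LinearMap.ext fun φ => Subtype.ext (LinearMap.ext fun c => ?_)
    rw [lift_sq_apply, lift_sq_apply, RingQuot.mkAlgHom_rel (ZMod 2) hab]
  unstable i d φ hφ hi := by
    refine Subtype.ext (LinearMap.ext fun a => ?_)
    have := hφ.2 i 0 a 1 (Submodule.subset_span ⟨[], rfl, by simp⟩) (by simpa using hi)
    rw [mul_one] at this
    exact this

/-- The linear form on the part of degree `k` of `M` given by a morphism `M → J(k)`. -/
def formOfHom {M : SqMod.{u}} {k : ℕ} (f : SqMod.Hom M (brownGitler k)) :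
    Module.Dual (ZMod 2) (M.deg k) :=
  (LinearMap.applyₗ (1 : SteenrodAlgebra)) ∘ₗ (space k).subtype ∘ₗ f.toLin ∘ₗ (M.deg k).subtype

/-- The action of the Steenrod algebra on an unstable module. -/
def action {M : SqMod.{u}} (hM : M.IsUnstable) :
    SteenrodAlgebra →ₐ[ZMod 2] Module.End (ZMod 2) M.carrier :=
  RingQuot.liftAlgHom (ZMod 2) ⟨FreeAlgebra.lift (ZMod 2) M.sq, fun a b h => hM.rel a b h⟩

theorem action_Sq {M : SqMod.{u}} (hM : M.IsUnstable) (i : ℕ) : action hM (Sq i) = M.sq i := by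
  simp [action, Sq]

theorem action_mem {M : SqMod.{u}} (hM : M.IsUnstable) {d e : ℕ} {a : SteenrodAlgebra}
    (ha : a ∈ SteenrodAlgebra.deg e) {x : M.carrier} (hx : x ∈ M.deg d) :
    action hM a x ∈ M.deg (d + e) := by
  refine Submodule.span_induction (p := fun a _ => action hM a x ∈ M.deg (d + e))
    ?_ ?_ ?_ ?_ ha
  · rintro _ ⟨l, rfl, rfl⟩
    clear ha
    induction l with
    | nil => simpa using hx
    | cons i l ih =>
      rw [List.map_cons, List.prod_cons, map_mul, action_Sq, List.sum_cons, add_comm i,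
        ← add_assoc]
      exact hM.sq_mem i _ _ ih
  · simp
  · intro a b _ _ ha hb
    rw [map_add]
    exact add_mem ha hb
  · intro c a _ ha
    rw [map_smul]
    exact Submodule.smul_mem _ _ ha

/-- The projection of an unstable module onto its part of degree `k`. -/
def proj {M : SqMod.{u}} (hM : M.IsUnstable) (k : ℕ) : M.carrier →ₗ[ZMod 2] M.deg k :=
  DirectSum.component (ZMod 2) ℕ (fun d => M.deg d) k ∘ₗ
    (LinearEquiv.ofBijective (DirectSum.coeLinearMap M.deg) hM.isInternal).symm.toLinearMap

theorem proj_of_mem {M : SqMod.{u}} (hM : M.IsUnstable) (k d : ℕ) {x : M.carrier}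
    (hx : x ∈ M.deg d) (h : d ≠ k) : proj hM k x = 0 := by
  have : (LinearEquiv.ofBijective (DirectSum.coeLinearMap M.deg) hM.isInternal).symm x =
      DirectSum.lof (ZMod 2) ℕ (fun d => M.deg d) d ⟨x, hx⟩ := by
    rw [LinearEquiv.symm_apply_eq]
    exact (DirectSum.coeLinearMap_lof M.deg (i := d) ⟨x, hx⟩).symm
  change DirectSum.component (ZMod 2) ℕ (fun d => M.deg d) k
    ((LinearEquiv.ofBijective (DirectSum.coeLinearMap M.deg) hM.isInternal).symm x) = 0
  rw [this, DirectSum.component.of, dif_neg h]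

theorem proj_self {M : SqMod.{u}} (hM : M.IsUnstable) (k : ℕ) (x : M.deg k) :
    proj hM k x.1 = x := by
  have : (LinearEquiv.ofBijective (DirectSum.coeLinearMap M.deg) hM.isInternal).symm x.1 =
      DirectSum.lof (ZMod 2) ℕ (fun d => M.deg d) k x := by
    rw [LinearEquiv.symm_apply_eq]
    exact (DirectSum.coeLinearMap_lof M.deg (i := k) x).symm
  change DirectSum.component (ZMod 2) ℕ (fun d => M.deg d) k
    ((LinearEquiv.ofBijective (DirectSum.coeLinearMap M.deg) hM.isInternal).symm x.1) = x
  rw [this, DirectSum.component.lof_self]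

theorem toLin_action {M : SqMod.{u}} (hM : M.IsUnstable) {k : ℕ}
    (f : SqMod.Hom M (brownGitler k)) (x : M.carrier) (a b : SteenrodAlgebra) :
    (f.toLin (action hM a x)).1 b = (f.toLin x).1 (b * a) := by
  obtain ⟨y, rfl⟩ := RingQuot.mkAlgHom_surjective (ZMod 2) AdemRel a
  rw [← lift_sq_apply]
  have h : ∀ z, f.toLin (FreeAlgebra.lift (ZMod 2)
      (A := Module.End (ZMod 2) M.carrier) M.sq y z) =
      FreeAlgebra.lift (ZMod 2) (A := Module.End (ZMod 2) (brownGitler k).carrier)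
        (brownGitler k).sq y (f.toLin z) := by
    induction y using FreeAlgebra.induction with
    | grade0 r =>
      intro z
      rw [AlgHom.commutes, AlgHom.commutes, Module.algebraMap_end_apply,
        Module.algebraMap_end_apply, map_smul]
    | grade1 i =>
      intro z
      rw [FreeAlgebra.lift_ι_apply, FreeAlgebra.lift_ι_apply, f.map_sq]
    | mul p q hp hq =>
      intro z
      rw [map_mul, map_mul, Module.End.mul_apply, Module.End.mul_apply, hp, hq]
    | add p q hp hq =>
      intro z
      rw [map_add, map_add, LinearMap.add_apply, LinearMap.add_apply, map_add, hp, hq]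
  have h2 : action hM (RingQuot.mkAlgHom (ZMod 2) AdemRel y) =
      FreeAlgebra.lift (ZMod 2) (A := Module.End (ZMod 2) M.carrier) M.sq y := by
    simp [action]
  rw [h2, h]

/-- `J(k)` represents `M ↦ (M^k)^*` on unstable modules. -/
theorem representable {M : SqMod.{u}} (hM : M.IsUnstable) (k : ℕ) :
    Function.Bijective fun f : SqMod.Hom M (brownGitler k) => formOfHom f := by
  constructor
  · intro f g hfg
    have key : ∀ d, ∀ x ∈ M.deg d, f.toLin x = g.toLin x := by
      intro d x hx
      refine Subtype.ext (LinearMap.ext fun a => ?_)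
      have ha : a ∈ ⨆ e, SteenrodAlgebra.deg e := by
        rw [iSup_deg]
        trivial
      have hle : (⨆ e, SteenrodAlgebra.deg e) ≤
          LinearMap.ker ((f.toLin x).1 - (g.toLin x).1) := by
        refine iSup_le fun e b hb => ?_
        rw [LinearMap.mem_ker, LinearMap.sub_apply, sub_eq_zero]
        by_cases he : d + e = k
        · have h := LinearMap.congr_fun hfg ⟨action hM b x, he ▸ action_mem hM hb hx⟩
          change (f.toLin (action hM b x)).1 1 = (g.toLin (action hM b x)).1 1 at h
          rwa [toLin_action, toLin_action, one_mul] at h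
        · exact ((f.map_deg d x hx).1 e he b hb).trans ((g.map_deg d x hx).1 e he b hb).symm
      exact sub_eq_zero.1 (hle ha)
    refine SqMod.Hom.ext (LinearMap.ext fun x => ?_)
    have hx : x ∈ ⨆ d, M.deg d := by
      rw [hM.isInternal.submodule_iSup_eq_top]
      trivial
    have hle : (⨆ d, M.deg d) ≤ LinearMap.ker (f.toLin - g.toLin) := iSup_le fun d x hx => by
      rw [LinearMap.mem_ker, LinearMap.sub_apply, sub_eq_zero]
      exact key d x hx
    exact sub_eq_zero.1 (hle hx)
  · intro l
    let F : M.carrier →ₗ[ZMod 2] Module.Dual (ZMod 2) SteenrodAlgebra :=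
      ((action hM).toLinearMap.flip).compr₂ (l ∘ₗ proj hM k)
    have hF : ∀ x a, F x a = l (proj hM k (action hM a x)) := fun x a => rfl
    have hdeg : ∀ d, ∀ x ∈ M.deg d, F x ∈ deg k d := by
      intro d x hx
      refine ⟨fun e he a ha => ?_, fun i e a b hb hi => ?_⟩
      · rw [hF, proj_of_mem hM k _ (action_mem hM ha hx) he, map_zero]
      · rw [hF, map_mul, map_mul, Module.End.mul_apply, Module.End.mul_apply, action_Sq,
          hM.unstable i _ _ (action_mem hM hb hx) hi]
        simp
    have hsp : ∀ x, F x ∈ space k := by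
      intro x
      have hx : x ∈ ⨆ d, M.deg d := by
        rw [hM.isInternal.submodule_iSup_eq_top]
        trivial
      have hle : (⨆ d, M.deg d) ≤ (space k).comap F :=
        iSup_le fun d x hx => (le_iSup (deg k) d) (hdeg d x hx)
      exact hle hx
    refine ⟨⟨F.codRestrict (space k) hsp, fun d x hx => hdeg d x hx, fun i x => ?_⟩, ?_⟩
    · refine Subtype.ext (LinearMap.ext fun a => ?_)
      change F (M.sq i x) a = F x (a * Sq i)
      rw [hF, hF, map_mul, Module.End.mul_apply, action_Sq]
    · refine LinearMap.ext fun x => ?_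
      change F x.1 1 = l x
      rw [hF, map_one, Module.End.one_apply, proj_self]

end BrownGitler

/-! ## Steinberg modules -/

namespace Steinberg

open MvPolynomial

/-- The total Steenrod square on `𝔽₂[x_i]`, `Sq_T = ∑ Sq^k T^k`: the algebra homomorphism with
`x_i ↦ x_i + x_i² T`. -/
def totalSq (n : ℕ) : MvPolynomial (Fin n) (ZMod 2) →ₐ[ZMod 2]
    Polynomial (MvPolynomial (Fin n) (ZMod 2)) :=
  aeval fun i => Polynomial.C (X i) + Polynomial.C (X i ^ 2) * Polynomial.X

/-- The Steenrod square `Sq^k` on `𝔽₂[x_0, …, x_{n-1}] = H^*(B(ℤ/2)^n; 𝔽₂)`. -/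
def sq (n k : ℕ) : MvPolynomial (Fin n) (ZMod 2) →ₗ[ZMod 2] MvPolynomial (Fin n) (ZMod 2) :=
  (Polynomial.lcoeff (MvPolynomial (Fin n) (ZMod 2)) k).restrictScalars (ZMod 2) ∘ₗ
    (totalSq n).toLinearMap

/-- The left action of matrices by linear substitutions, `x_i ↦ ∑_j σ_{j,i} x_j`. -/
def act {n : ℕ} (σ : Matrix (Fin n) (Fin n) (ZMod 2)) :
    MvPolynomial (Fin n) (ZMod 2) →ₐ[ZMod 2] MvPolynomial (Fin n) (ZMod 2) :=
  aeval fun i => ∑ j, C (σ j i) * X j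

open Classical in
/-- The Borel subgroup: invertible upper triangular matrices. -/
def borel (n : ℕ) : Finset (Matrix (Fin n) (Fin n) (ZMod 2)) :=
  Finset.univ.filter fun b => IsUnit b ∧ ∀ i j, j < i → b i j = 0

/-- The action of the Steinberg idempotent `e_n`, the product of the sum of all elements of the
Borel subgroup and the sum of all permutation matrices. -/
def idem (n : ℕ) : MvPolynomial (Fin n) (ZMod 2) →ₗ[ZMod 2] MvPolynomial (Fin n) (ZMod 2) :=
  (∑ b ∈ borel n, (act b).toLinearMap) ∘ₗ
    ∑ s : Equiv.Perm (Fin n), (act (s.permMatrix (ZMod 2))).toLinearMap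

/-- The top Dickson invariant `ω_n`: the product of all nonzero linear forms. -/
def omega (n : ℕ) : MvPolynomial (Fin n) (ZMod 2) :=
  ∏ v ∈ Finset.univ.erase (0 : Fin n → ZMod 2), ∑ i, C (v i) * X i

/-- `M_n = e_n · 𝔽₂[x_0, …, x_{n-1}]`. -/
def M (n : ℕ) : Submodule (ZMod 2) (MvPolynomial (Fin n) (ZMod 2)) := LinearMap.range (idem n)

/-- `L_n = ω_n M_n`. -/
def L (n : ℕ) : Submodule (ZMod 2) (MvPolynomial (Fin n) (ZMod 2)) :=
  (M n).map (LinearMap.mulLeft (ZMod 2) (omega n))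

/-- `L'_n = ω_n L_n`. -/
def L' (n : ℕ) : Submodule (ZMod 2) (MvPolynomial (Fin n) (ZMod 2)) :=
  (L n).map (LinearMap.mulLeft (ZMod 2) (omega n))

theorem sum_sq {n : ℕ} (c : Fin n → ZMod 2) :
    (∑ j, C (c j) * X j : MvPolynomial (Fin n) (ZMod 2)) ^ 2 = ∑ j, C (c j) * X j ^ 2 := by
  rw [sum_pow_char 2]
  refine Finset.sum_congr rfl fun j _ => ?_
  rw [mul_pow, ← C_pow, ZMod.pow_card]

theorem totalSq_linear {n : ℕ} (c : Fin n → ZMod 2) :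
    totalSq n (∑ j, C (c j) * X j) = Polynomial.C (∑ j, C (c j) * X j) *
      (1 + Polynomial.C (∑ j, C (c j) * X j) * Polynomial.X) := by
  have hC : ∀ c : ZMod 2, totalSq n (C c) = Polynomial.C (C c) := fun c =>
    (totalSq n).commutes c
  have hX : ∀ j, totalSq n (X j) =
      Polynomial.C (X j) + Polynomial.C (X j ^ 2) * Polynomial.X := fun j => by simp [totalSq]
  rw [mul_add, mul_one, ← mul_assoc, ← Polynomial.C_mul, ← pow_two, sum_sq]
  simp only [map_sum, map_mul, hC, hX, mul_add, Finset.sum_add_distrib, Finset.sum_mul, mul_assoc]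

theorem totalSq_act {n : ℕ} (σ : Matrix (Fin n) (Fin n) (ZMod 2))
    (f : MvPolynomial (Fin n) (ZMod 2)) :
    totalSq n (act σ f) = Polynomial.mapAlgHom (act σ) (totalSq n f) := by
  have h : (totalSq n).comp (act σ) = (Polynomial.mapAlgHom (act σ)).comp (totalSq n) := by
    refine MvPolynomial.algHom_ext fun i => ?_
    have hX : totalSq n (X i) = Polynomial.C (X i) + Polynomial.C (X i ^ 2) * Polynomial.X := by
      simp [totalSq]
    have ha : act σ (X i) = ∑ j, C (σ j i) * X j := by simp [act]
    rw [AlgHom.comp_apply, AlgHom.comp_apply, ha, totalSq_linear, hX]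
    simp only [map_add, map_mul, Polynomial.coe_mapAlgHom, Polynomial.map_C, Polynomial.map_X,
      RingHom.coe_coe, map_pow, ha]
    ring
  exact DFunLike.congr_fun h f

theorem sq_act {n : ℕ} (σ : Matrix (Fin n) (Fin n) (ZMod 2)) (k : ℕ)
    (f : MvPolynomial (Fin n) (ZMod 2)) : sq n k (act σ f) = act σ (sq n k f) := by
  simp [sq, totalSq_act]

theorem sq_idem (n k : ℕ) (f : MvPolynomial (Fin n) (ZMod 2)) :
    sq n k (idem n f) = idem n (sq n k f) := by
  simp [idem, sq_act]

/-- The cofactor in `Sq_T ω_n = ω_n · ∏ (1 + ℓ T)`. -/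
def omegaCofactor (n : ℕ) : Polynomial (MvPolynomial (Fin n) (ZMod 2)) :=
  ∏ v ∈ Finset.univ.erase (0 : Fin n → ZMod 2),
    (1 + Polynomial.C (∑ i, C (v i) * X i) * Polynomial.X)

theorem totalSq_omega (n : ℕ) :
    totalSq n (omega n) = Polynomial.C (omega n) * omegaCofactor n := by
  rw [omega, map_prod, map_prod, omegaCofactor, ← Finset.prod_mul_distrib]
  exact Finset.prod_congr rfl fun v _ => totalSq_linear v

theorem act_linear {n : ℕ} (σ : Matrix (Fin n) (Fin n) (ZMod 2)) (v : Fin n → ZMod 2) :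
    act σ (∑ i, C (v i) * X i) = ∑ j, C (σ.mulVec v j) * X j := by
  have hC : ∀ c : ZMod 2, act σ (C c) = C c := fun c => (act σ).commutes c
  have ha : ∀ i, act σ (X i) = ∑ j, C (σ j i) * X j := fun i => by simp [act]
  simp only [map_sum, map_mul, hC, ha, Matrix.mulVec, dotProduct, Finset.mul_sum,
    Finset.sum_mul]
  rw [Finset.sum_comm]
  refine Finset.sum_congr rfl fun j _ => Finset.sum_congr rfl fun i _ => ?_
  ring

theorem act_omegaCofactor {n : ℕ} (σ : Matrix (Fin n) (Fin n) (ZMod 2)) (hσ : IsUnit σ) :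
    Polynomial.mapAlgHom (act σ) (omegaCofactor n) = omegaCofactor n := by
  have hinj : Function.Injective σ.mulVec := Matrix.mulVec_injective_of_isUnit hσ
  have hbij : Function.Bijective σ.mulVec := Finite.injective_iff_bijective.1 hinj
  rw [omegaCofactor, map_prod]
  refine Finset.prod_bijective σ.mulVec hbij (fun v => ?_) fun v _ => ?_
  · have : σ.mulVec v = 0 ↔ v = 0 :=
      ⟨fun h => hinj (by rw [h, Matrix.mulVec_zero]), fun h => by rw [h, Matrix.mulVec_zero]⟩
    simp [this]
  · rw [← act_linear]
    simp only [map_add, map_one, map_mul, Polynomial.coe_mapAlgHom, Polynomial.map_C,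
      Polynomial.map_X, RingHom.coe_coe]

theorem act_coeff {n : ℕ} (σ : Matrix (Fin n) (Fin n) (ZMod 2)) (hσ : IsUnit σ) (k : ℕ) :
    act σ ((omegaCofactor n).coeff k) = (omegaCofactor n).coeff k := by
  conv_rhs => rw [← act_omegaCofactor σ hσ]
  simp

theorem isUnit_of_mem_borel {n : ℕ} {b : Matrix (Fin n) (Fin n) (ZMod 2)} (hb : b ∈ borel n) :
    IsUnit b := by
  simp only [borel, Finset.mem_filter] at hb
  exact hb.2.1

theorem isUnit_permMatrix {n : ℕ} (s : Equiv.Perm (Fin n)) : IsUnit (s.permMatrix (ZMod 2)) := by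
  rw [Matrix.isUnit_iff_isUnit_det, Matrix.det_permutation]
  exact (Equiv.Perm.sign s).isUnit.map (Int.castRingHom (ZMod 2))

theorem idem_coeff_mul (n k : ℕ) (f : MvPolynomial (Fin n) (ZMod 2)) :
    idem n ((omegaCofactor n).coeff k * f) = (omegaCofactor n).coeff k * idem n f := by
  have h1 : ∀ s : Equiv.Perm (Fin n), act (s.permMatrix (ZMod 2)) ((omegaCofactor n).coeff k * f) =
      (omegaCofactor n).coeff k * act (s.permMatrix (ZMod 2)) f := fun s => by
    rw [map_mul, act_coeff _ (isUnit_permMatrix s)]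
  have h2 : ∀ b ∈ borel n, ∀ g, act b ((omegaCofactor n).coeff k * g) =
      (omegaCofactor n).coeff k * act b g := fun b hb g => by
    rw [map_mul, act_coeff b (isUnit_of_mem_borel hb)]
  have h3 : ∀ g, idem n g = ∑ b ∈ borel n, act b
      (∑ s : Equiv.Perm (Fin n), act (s.permMatrix (ZMod 2)) g) := fun g => by
    simp only [idem, LinearMap.comp_apply, LinearMap.sum_apply, AlgHom.toLinearMap_apply]
  rw [h3, h3, Finset.mul_sum]
  refine Finset.sum_congr rfl fun b hb => ?_
  rw [← h2 b hb, Finset.mul_sum]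
  exact congrArg _ (Finset.sum_congr rfl fun s _ => h1 s)

/-- `L_n` is closed under the Steenrod squares. -/
theorem sq_mem_L (n k : ℕ) (f : MvPolynomial (Fin n) (ZMod 2)) (hf : f ∈ L n) :
    sq n k f ∈ L n := by
  obtain ⟨_, ⟨g, rfl⟩, rfl⟩ := hf
  have h : sq n k (omega n * idem n g) = ∑ p ∈ Finset.HasAntidiagonal.antidiagonal k,
      omega n * idem n ((omegaCofactor n).coeff p.1 * sq n p.2 g) := by
    change (totalSq n _).coeff k = _
    rw [map_mul, totalSq_omega, mul_assoc, Polynomial.coeff_C_mul, Polynomial.coeff_mul,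
      Finset.mul_sum]
    refine Finset.sum_congr rfl fun p _ => ?_
    rw [idem_coeff_mul, ← sq_idem]
    rfl
  change sq n k (omega n * idem n g) ∈ _
  rw [h]
  exact sum_mem fun p _ => ⟨_, ⟨_, rfl⟩, rfl⟩

end Steinberg

/-- The Steinberg module `L_n`, graded by polynomial degree; `L_1` is the ideal `(x)` of `𝔽₂[x]`,
the reduced cohomology of `Bℤ/2`. -/
def steinbergL (n : ℕ) : SqMod where
  carrier := Steinberg.L n
  deg d := (MvPolynomial.homogeneousSubmodule (Fin n) (ZMod 2) d).comap (Steinberg.L n).subtype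
  sq k := (Steinberg.sq n k).restrict (Steinberg.sq_mem_L n k)

/-- `L_1^{⊗n}`. -/
def L₁Pow (n : ℕ) : SqMod := SqMod.tensor fun _ : Fin n => steinbergL 1

namespace L₁Pow

open MvPolynomial

/-- The identification of `L_1^{⊗n}` with the ideal `(x_0 ⋯ x_{n-1})` of `𝔽₂[x_0, …, x_{n-1}]`:
`f_0 ⊗ ⋯ ⊗ f_{n-1} ↦ f_0(x_0) ⋯ f_{n-1}(x_{n-1})`. -/
def toPoly (n : ℕ) : (L₁Pow n).carrier →ₗ[ZMod 2] MvPolynomial (Fin n) (ZMod 2) :=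
  PiTensorProduct.lift
    ((MultilinearMap.mkPiAlgebra (ZMod 2) (Fin n) (MvPolynomial (Fin n) (ZMod 2))).compLinearMap
      fun i => (rename fun _ : Fin 1 => i).toLinearMap ∘ₗ (Steinberg.L 1).subtype)

/-- `MP(i+1) = L_1^{⊗i} ⊗ L_2 ⊗ L_1^{⊗(n-i-2)}` for `i < n - 1` (the factor `L_2` sits in the
variables `x_i, x_{i+1}`), and `MP(n) = L_1^{⊗(n-1)} ⊗ L'_1` for `i = n - 1`. -/
def MP (n : ℕ) (i : Fin n) : Submodule (ZMod 2) (L₁Pow n).carrier :=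
  if h : i.1 + 1 < n then
    (Submodule.span (ZMod 2) {q | ∃ p ∈ Steinberg.L 2, ∃ f : Fin n → Steinberg.L 1,
      q = rename ![i, ⟨i.1 + 1, h⟩] p *
        ∏ l ∈ Finset.univ.filter (fun l : Fin n => l ≠ i ∧ l ≠ ⟨i.1 + 1, h⟩),
          rename (fun _ : Fin 1 => l) (f l).1}).comap (toPoly n)
  else
    Submodule.span (ZMod 2) {t | ∃ f : Fin n → Steinberg.L 1, (f i).1 ∈ Steinberg.L' 1 ∧
      t = PiTensorProduct.tprod (ZMod 2) f}

end L₁Pow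

/-- The composite `L_1^{⊗n} → J(2^{n-1}) ⊗ ⋯ ⊗ J(1) → J(2^n - 1)` of `π_{n-1} ⊗ ⋯ ⊗ π_0`
with `μ`. -/
def gMap (n : ℕ) (π : ∀ s : ℕ, SqMod.Hom (steinbergL 1) (brownGitler (2 ^ s)))
    (μ : SqMod.Hom (SqMod.tensor fun i : Fin n => brownGitler (2 ^ (n - 1 - i.1)))
      (brownGitler (2 ^ n - 1))) :
    SqMod.Hom (L₁Pow n) (brownGitler (2 ^ n - 1)) :=
  μ.comp (SqMod.tensorMap fun i : Fin n => π (n - 1 - i.1))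

end

/-!
The form on the part of degree `2^n - 1` of `L_1^{⊗n}` that corresponds to `g` is the coefficient
of `x_0^{2^{n-1}} x_1^{2^{n-2}} ⋯ x_{n-1}` (the *top coefficient*), so that `g(z)` is the linear
form `θ ↦ top coefficient of θ z` on the Steenrod algebra (`L₁Pow.gMap_apply`). Everything about
`g` is read off from this formula.

*Upper bound for the quotient.* The `MP(i)` lie in the kernel of `g` (`L₁Pow.gMap_MP`): each is
contained in a subspace of the polynomial ring that is closed under the Steenrod squares and on
which the top coefficient vanishes; for `i < n` the reason is that the elements of `L_2` do not
involve the monomials `x^{2s} y^s` with `s` a power of two (`Steinberg.coeff_of_mem_L_two`). Modulo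
the `MP(i)`, a monomial with `a_i > 2 a_{i+1}` is a combination of monomials whose exponents are
moved to the right, because of explicit elements of `L_2` (`Steinberg.mem_L_two`), and a monomial
with `a_{n-1} > 1` is zero. Hence the quotient is spanned by the monomials with Cayley exponents:
positive, `a_i ≤ 2 a_{i+1}`, `a_{n-1} = 1` (`L₁Pow.gen_mem_span_isCayley_sup`).

*Upper bound for `J(2^n - 1)`.* By the Adem relations a linear form on the Steenrod algebra is
determined by its values on the admissible `Sq^{k_1} Sq^{k_2} ⋯`, and the instability condition
leaves only those with `2 k_1 ≤ 2^n - 1`. So the dimension of the part of degree `d` is at most the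
number of chains `2^n - 1 = k_0, k_1, k_2, …` with `2 k_{t+1} ≤ k_t` and
`k_1 + k_2 + ⋯ = 2^n - 1 - d` (`halvingChains.finrank_deg_le`). The substitution
`k_{t+1} = 2^{n-1-t} - a_t` embeds the Cayley sequences of sum `d` in the set of these chains.

*Lower bound for the rank of `g`.* A chain is the same as a multiset of `d` powers of two of sum
`2^n - 1`, with multiplicities `k_t - 2 k_{t+1}`, and the symmetric sum of the monomials with these
exponents in `d` variables is obtained from `x_0 ⋯ x_{d-1}` by a Steenrod operation
(`TwoPower.exists_lift_eq_msym`). A nonzero homogeneous polynomial of degree `2^n - 1` over `𝔽₂` has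
a linear substitution after which its top coefficient is not zero
(`Detection.exists_topCoeff_ne_zero`), by induction on `n` from the existence of a direction in
which it has at least half its total degree (`Detection.exists_direction`). Applied to combinations
of the symmetric sums, this shows that no combination of the operations vanishes on all the `g(z)`
with `z` of degree `d` (`L₁Pow.span_evalOps`). Therefore the numbers of Cayley sequences and of
chains agree, the images of the Cayley monomials are a basis of `J(2^n - 1)`, and the kernel of `g`
is exactly the sum of the `MP(i)` (`L₁Pow.ker_gMap`).

That the tensor products are unstable modules, which is needed for the representing property of
`J(k)`, rests on the Bullett–Macdonald form of the Adem relations: an identity between products of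
total squares, which visibly passes to the Cartan formula (`BullettMacdonald.identity_iff_ademSeq`,
`BullettMacdonald.Identity.mul`).
-/

/-! ### The Bullett–Macdonald form of the Adem relations -/

namespace BullettMacdonald

open Polynomial Finset

/-- The coefficient of `Sq^a Sq^b` in
`P(X² + X) P(1) + P(1 + X) P(X²)`, where `P(u) = ∑ u^k Sq^k` and `p = (a, b)`. -/
noncomputable def weight (p : ℕ × ℕ) : (ZMod 2)[X] := (X ^ 2 + X) ^ p.1 + (1 + X) ^ p.1 * X ^ (2 * p.2)

/-- The residue of `f` at `0` with respect to the parameter `X² + X`: the coefficient of `X^a` in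
`f / (1 + X)^(a + 1)`. -/
noncomputable def residue (a : ℕ) : (ZMod 2)[X] →ₗ[ZMod 2] ZMod 2 where
  toFun f := PowerSeries.coeff a ((f : PowerSeries (ZMod 2)) * ((1 + PowerSeries.X) ^ (a + 1))⁻¹)
  map_add' f g := by simp [add_mul]
  map_smul' c f := by simp [Polynomial.coe_smul]

theorem residue_apply (a : ℕ) (f : (ZMod 2)[X]) : residue a f =
    PowerSeries.coeff a ((f : PowerSeries (ZMod 2)) * ((1 + PowerSeries.X) ^ (a + 1))⁻¹) := rfl

theorem constCoeff_ne (m : ℕ) :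
    PowerSeries.constantCoeff ((1 + PowerSeries.X : PowerSeries (ZMod 2)) ^ m) ≠ 0 := by
  simp

theorem pow_mul_inv {m k : ℕ} (h : k ≤ m) : (1 + PowerSeries.X : PowerSeries (ZMod 2)) ^ m *
    ((1 + PowerSeries.X) ^ k)⁻¹ = (1 + PowerSeries.X) ^ (m - k) := by
  obtain ⟨r, rfl⟩ := Nat.exists_eq_add_of_le h
  rw [add_comm k r, pow_add, mul_assoc, PowerSeries.mul_inv_cancel _ (constCoeff_ne k), mul_one,
    Nat.add_sub_cancel]

theorem pow_mul_inv' {m k : ℕ} (h : m ≤ k) : (1 + PowerSeries.X : PowerSeries (ZMod 2)) ^ m *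
    ((1 + PowerSeries.X) ^ k)⁻¹ = ((1 + PowerSeries.X) ^ (k - m))⁻¹ := by
  obtain ⟨r, rfl⟩ := Nat.exists_eq_add_of_le h
  rw [Nat.add_sub_cancel_left, PowerSeries.eq_inv_iff_mul_eq_one (constCoeff_ne r), mul_right_comm,
    ← pow_add, PowerSeries.mul_inv_cancel _ (constCoeff_ne _)]

/-- In characteristic two the coefficient of `X^k` in `(1 + X)^(-k-1)` is the central binomial
coefficient, hence zero for `k > 0`. -/
theorem coeff_inv_pow (k : ℕ) : PowerSeries.coeff k
    (((1 + PowerSeries.X : PowerSeries (ZMod 2)) ^ (k + 1))⁻¹) = if k = 0 then 1 else 0 := by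
  have h := PowerSeries.mk_add_choose_mul_one_sub_pow_eq_one (S := ZMod 2) k
  have h2 : (1 - PowerSeries.X : PowerSeries (ZMod 2)) = 1 + PowerSeries.X := by
    ext i
    rw [map_sub, map_add, CharTwo.sub_eq_add]
  rw [h2, ← PowerSeries.eq_inv_iff_mul_eq_one (constCoeff_ne _)] at h
  rw [← h, PowerSeries.coeff_mk]
  split_ifs with hk
  · subst hk; simp
  · have := Nat.two_dvd_centralBinom_of_one_le (Nat.pos_of_ne_zero hk)
    rw [Nat.centralBinom, two_mul] at this
    exact (ZMod.natCast_eq_zero_iff _ _).2 this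

theorem residue_first (a m : ℕ) : residue a ((X ^ 2 + X) ^ m) = if m = a then 1 else 0 := by
  have h : (((X ^ 2 + X) ^ m : (ZMod 2)[X]) : PowerSeries (ZMod 2)) =
      PowerSeries.X ^ m * (1 + PowerSeries.X) ^ m := by
    push_cast
    rw [← mul_pow]
    ring
  rw [residue_apply, h, mul_assoc]
  rcases lt_or_ge a m with hm | hm
  · rw [PowerSeries.coeff_X_pow_mul', if_neg (by omega), if_neg (by omega)]
  · rw [PowerSeries.coeff_X_pow_mul', if_pos hm, pow_mul_inv' (by omega),
      show a + 1 - m = (a - m) + 1 by omega, coeff_inv_pow]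
    congr 1
    simp only [eq_iff_iff]
    omega

theorem residue_second (a m j : ℕ) : residue a ((1 + X) ^ m * X ^ (2 * j)) =
    if 2 * j ≤ a then PowerSeries.coeff (a - 2 * j)
      ((1 + PowerSeries.X : PowerSeries (ZMod 2)) ^ m * ((1 + PowerSeries.X) ^ (a + 1))⁻¹)
    else 0 := by
  have h : (((1 + X) ^ m * X ^ (2 * j) : (ZMod 2)[X]) : PowerSeries (ZMod 2)) =
      PowerSeries.X ^ (2 * j) * (1 + PowerSeries.X) ^ m := by
    push_cast
    ring
  rw [residue_apply, h, mul_assoc, PowerSeries.coeff_X_pow_mul']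

theorem coeff_one_add_pow (m k : ℕ) :
    PowerSeries.coeff k ((1 + PowerSeries.X : PowerSeries (ZMod 2)) ^ m) = (m.choose k : ZMod 2) := by
  have : ((1 + PowerSeries.X : PowerSeries (ZMod 2)) ^ m) = (((1 + X) ^ m : (ZMod 2)[X]) :
      PowerSeries (ZMod 2)) := by push_cast; rfl
  rw [this, Polynomial.coeff_coe, Polynomial.coeff_one_add_X_pow]

theorem residue_second_of_lt {a b m j : ℕ} (hN : m + j = a + b) (hab : a < 2 * b) :
    residue a ((1 + X) ^ m * X ^ (2 * j)) =
      if 2 * j ≤ a then ((b - j - 1).choose (a - 2 * j) : ZMod 2) else 0 := by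
  rw [residue_second]
  split_ifs with h
  · rw [pow_mul_inv (by omega), coeff_one_add_pow]
    congr 2
    omega
  · rfl

theorem residue_second_of_eq {b m j : ℕ} (hN : m + j = 2 * b + b) :
    residue (2 * b) ((1 + X) ^ m * X ^ (2 * j)) = if j = b then 1 else 0 := by
  rw [residue_second]
  split_ifs with h h1 h1
  · subst h1
    rw [pow_mul_inv' (by omega)]
    simp
  · rw [pow_mul_inv (by omega), coeff_one_add_pow, Nat.choose_eq_zero_of_lt (by omega), Nat.cast_zero]
  · omega
  · rfl

theorem sum_antidiagonal_first (N : ℕ) {a b : ℕ} (h : a + b = N) (x : ℕ × ℕ → ZMod 2) :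
    ∑ p ∈ antidiagonal N, x p * (if p.1 = a then 1 else 0) = x (a, b) := by
  rw [Finset.sum_eq_single (a, b)]
  · simp
  · rintro ⟨c, d⟩ hp hne
    rw [HasAntidiagonal.mem_antidiagonal] at hp
    rw [if_neg, mul_zero]
    rintro rfl
    apply hne
    simp only at hp ⊢
    congr 1
    omega
  · intro hn
    exact absurd (HasAntidiagonal.mem_antidiagonal.2 h) hn

/-- The residues of the Bullett–Macdonald identity are the Adem relations. -/
theorem residue_sum_of_lt (x : ℕ × ℕ → ZMod 2) {a b : ℕ} (hab : a < 2 * b) :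
    residue a (∑ p ∈ antidiagonal (a + b), x p • weight p) =
      x (a, b) + ∑ c ∈ range (a / 2 + 1), ((b - c - 1).choose (a - 2 * c) : ZMod 2) *
        x (a + b - c, c) := by
  simp only [map_sum, map_smul, weight, map_add, residue_first, smul_eq_mul, mul_add,
    Finset.sum_add_distrib]
  rw [sum_antidiagonal_first _ rfl]
  congr 1
  refine (Finset.sum_of_injOn (fun c => (a + b - c, c)) (fun c _ d _ h => congrArg Prod.snd h)
    (fun c hc => ?_) ?_ fun c hc => ?_).symm
  · have hc' : c < a / 2 + 1 := by simpa using hc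
    exact mem_coe.2 (HasAntidiagonal.mem_antidiagonal.2 (show a + b - c + c = a + b by omega))
  · rintro ⟨m, j⟩ hp hn
    rw [HasAntidiagonal.mem_antidiagonal] at hp
    simp only at hp
    rw [residue_second_of_lt hp hab, if_neg, mul_zero]
    intro hj
    refine hn ⟨j, mem_coe.2 (mem_range.2 (by omega)), ?_⟩
    change (a + b - j, j) = (m, j)
    rw [← hp, Nat.add_sub_cancel]
  · rw [mem_range] at hc
    rw [residue_second_of_lt (show a + b - c + c = a + b by omega) hab, if_pos (by omega), mul_comm]

theorem residue_sum_of_eq (x : ℕ × ℕ → ZMod 2) (b : ℕ) :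
    residue (2 * b) (∑ p ∈ antidiagonal (2 * b + b), x p • weight p) = 0 := by
  simp only [map_sum, map_smul, weight, map_add, residue_first, smul_eq_mul]
  rw [Finset.sum_eq_zero]
  rintro ⟨m, j⟩ hp
  rw [HasAntidiagonal.mem_antidiagonal] at hp
  simp only at hp ⊢
  rw [residue_second_of_eq hp]
  have : (m = 2 * b) ↔ j = b := by omega
  simp only [this]
  rw [CharTwo.add_self_eq_zero, mul_zero]

/-- A polynomial whose first residues vanish vanishes to high order at `0`. -/
theorem X_pow_dvd_of_residue {A : ℕ} {f : (ZMod 2)[X]} (h : ∀ a < A, residue a f = 0) :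
    X ^ A ∣ f := by
  rw [X_pow_dvd_iff]
  intro a
  induction a using Nat.strong_induction_on with
  | _ a ih =>
    intro ha
    have h1 := h a ha
    rw [residue_apply, PowerSeries.coeff_mul, Finset.sum_eq_single (a, 0)] at h1
    · simpa using h1
    · rintro ⟨c, d⟩ hp hne
      rw [HasAntidiagonal.mem_antidiagonal] at hp
      simp only at hp ⊢
      rw [Polynomial.coeff_coe, ih c _ (by omega), zero_mul]
      rcases Nat.lt_or_ge c a with h | h
      · exact h
      · exact absurd (by congr 1 <;> omega) hne
    · simp

theorem reflect_X_sq_add_X_pow (m : ℕ) :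
    reflect (2 * m) ((X ^ 2 + X : (ZMod 2)[X]) ^ m) = (1 + X) ^ m := by
  induction m with
  | zero => simp
  | succ m ih =>
    rw [pow_succ, mul_add, mul_one, reflect_mul _ _ ?_ ?_, ih, pow_succ]
    · congr 1
      ext i
      rw [coeff_reflect]
      rcases i with _ | _ | _ | i
      · simp [revAt_le, coeff_X, coeff_one]
      · simp [revAt_le, coeff_X, coeff_one]
      · simp [revAt_le, coeff_X, coeff_one, coeff_monomial]
      · rw [revAt_eq_self_of_lt (by omega)]
        simp [coeff_X, coeff_one, coeff_monomial]
    · refine natDegree_pow_le.trans ?_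
      have : (X ^ 2 + X : (ZMod 2)[X]).natDegree ≤ 2 := by compute_degree
      nlinarith
    · compute_degree

theorem natDegree_first_le (m : ℕ) : ((X ^ 2 + X : (ZMod 2)[X]) ^ m).natDegree ≤ 2 * m := by
  refine natDegree_pow_le.trans ?_
  have : (X ^ 2 + X : (ZMod 2)[X]).natDegree ≤ 2 := by compute_degree
  nlinarith

theorem natDegree_one_add_X_pow_le (m : ℕ) : ((1 + X : (ZMod 2)[X]) ^ m).natDegree ≤ m := by
  refine natDegree_pow_le.trans ?_
  have : (1 + X : (ZMod 2)[X]).natDegree ≤ 1 := by compute_degree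
  nlinarith

theorem natDegree_weight_le (p : ℕ × ℕ) : (weight p).natDegree ≤ 2 * (p.1 + p.2) := by
  refine (natDegree_add_le _ _).trans (max_le ((natDegree_first_le _).trans (by omega)) ?_)
  refine natDegree_mul_le.trans ?_
  have := natDegree_one_add_X_pow_le p.1
  have := natDegree_X_pow_le (R := ZMod 2) (2 * p.2)
  omega

/-- The two terms of `weight` are exchanged by `X ↦ 1 / X`. -/
theorem reflect_weight (p : ℕ × ℕ) : reflect (2 * (p.1 + p.2)) (weight p) = weight p := by
  have h1 : reflect (2 * (p.1 + p.2)) ((X ^ 2 + X : (ZMod 2)[X]) ^ p.1) =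
      (1 + X) ^ p.1 * X ^ (2 * p.2) := by
    have := reflect_mul ((X ^ 2 + X : (ZMod 2)[X]) ^ p.1) 1 (natDegree_first_le p.1)
      (G := 2 * p.2) (by simp)
    rw [mul_one, reflect_X_sq_add_X_pow, reflect_one, ← mul_add] at this
    exact this
  rw [weight, reflect_add, h1, add_comm ((1 + X) ^ p.1 * X ^ (2 * p.2)) _]
  congr 1
  rw [← h1]
  ext i
  rw [coeff_reflect, coeff_reflect, revAt_invol]

/-- A palindromic polynomial of formal degree `N` divisible by `X^A` has degree at most `N - A`. -/
theorem natDegree_le_of_reflect {N A : ℕ} {f : (ZMod 2)[X]} (hf : reflect N f = f)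
    (hN : f.natDegree ≤ N) (h : X ^ A ∣ f) (hA : A ≤ N) : f.natDegree + A ≤ N := by
  have : f.natDegree ≤ N - A := by
    rw [natDegree_le_iff_coeff_eq_zero]
    intro i hi
    rcases le_or_gt i N with hiN | hiN
    · rw [← hf, coeff_reflect, revAt_le hiN]
      exact X_pow_dvd_iff.1 h _ (by omega)
    · exact coeff_eq_zero_of_natDegree_lt (by omega)
  omega

/-- A combination of weights of the same degree vanishes at `1` to at least the same order as at
`0`: `f(1 + X) = f(X) + (1 + X)^{2N} f(X / (1 + X))`. -/
theorem dvd_comp {N A : ℕ} {x : ℕ × ℕ → ZMod 2} {f : (ZMod 2)[X]}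
    (hf : f = ∑ p ∈ HasAntidiagonal.antidiagonal N, x p • weight p) (h : X ^ A ∣ f) :
    X ^ A ∣ f.comp (1 + X) := by
  let t : PowerSeries (ZMod 2) := (1 + PowerSeries.X)⁻¹
  have ht : (1 + PowerSeries.X) * t = 1 := PowerSeries.mul_inv_cancel _ (by simp)
  have h2 : (2 : PowerSeries (ZMod 2)) = 0 := by
    rw [← map_ofNat (PowerSeries.C (R := ZMod 2)) 2, show (OfNat.ofNat 2 : ZMod 2) = 0 from rfl,
      map_zero]
  have e1 : (1 + PowerSeries.X) ^ 2 * ((PowerSeries.X * t) ^ 2 + PowerSeries.X * t) =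
      PowerSeries.X := by
    linear_combination (PowerSeries.X ^ 2 * ((1 + PowerSeries.X) * t + 1) +
      PowerSeries.X * (1 + PowerSeries.X)) * ht + PowerSeries.X ^ 2 * h2
  have e2 : (1 + PowerSeries.X) ^ 2 * (1 + PowerSeries.X * t) = 1 + PowerSeries.X := by
    linear_combination (PowerSeries.X * (1 + PowerSeries.X)) * ht +
      (PowerSeries.X + PowerSeries.X ^ 2) * h2
  have e3 : (1 + PowerSeries.X) ^ 2 * (PowerSeries.X * t) ^ 2 = PowerSeries.X ^ 2 := by
    linear_combination (PowerSeries.X ^ 2 * ((1 + PowerSeries.X) * t + 1)) * ht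
  -- `X ↦ 1 + X` fixes the first term of `weight (a, b)`, `X ↦ X / (1 + X)` the second up to the
  -- factor, and both take the other term to `X^a (1 + X)^{2b}`
  have key : ((f.comp (1 + X) : (ZMod 2)[X]) : PowerSeries (ZMod 2)) =
      (f : PowerSeries (ZMod 2)) + (1 + PowerSeries.X) ^ (2 * N) * aeval (PowerSeries.X * t) f := by
    have hterm : ∀ p ∈ HasAntidiagonal.antidiagonal N,
        (((weight p).comp (1 + X) : (ZMod 2)[X]) : PowerSeries (ZMod 2)) =
        (weight p : PowerSeries (ZMod 2)) +
          (1 + PowerSeries.X) ^ (2 * N) * aeval (PowerSeries.X * t) (weight p) := by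
      rintro ⟨a, b⟩ hp
      rw [HasAntidiagonal.mem_antidiagonal] at hp
      simp only at hp
      have e4 : (1 + PowerSeries.X) ^ (2 * N) * aeval (PowerSeries.X * t) (weight (a, b)) =
          PowerSeries.X ^ a * (1 + PowerSeries.X) ^ (2 * b) +
            (1 + PowerSeries.X) ^ a * PowerSeries.X ^ (2 * b) := by
        simp only [weight, map_add, map_mul, map_pow, aeval_X, map_one]
        have e0 : (1 + PowerSeries.X : PowerSeries (ZMod 2)) ^ (2 * N) =
            ((1 + PowerSeries.X) ^ 2) ^ a * ((1 + PowerSeries.X) ^ 2) ^ b := by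
          rw [← hp, ← pow_add, ← pow_mul]
        rw [e0, mul_add, mul_right_comm, ← mul_pow, e1, mul_mul_mul_comm, ← mul_pow, e2,
          pow_mul (PowerSeries.X * t), ← mul_pow, e3, ← pow_mul, ← pow_mul]
      rw [e4]
      have e5 : (X + 1 + 1 : (ZMod 2)[X]) = X := by
        rw [add_assoc, CharTwo.add_self_eq_zero, add_zero]
      have e6 : ((1 + X) ^ 2 + (1 + X) : (ZMod 2)[X]) = X ^ 2 + X := by
        linear_combination (1 + X) * (CharTwo.two_eq_zero (R := (ZMod 2)[X]))
      have e7 : (1 + (1 + X) : (ZMod 2)[X]) = X := by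
        linear_combination (CharTwo.two_eq_zero (R := (ZMod 2)[X]))
      simp only [weight, add_comp, pow_comp, X_comp, mul_comp, one_comp, e6, e7]
      push_cast
      linear_combination (-(1 + PowerSeries.X) ^ a * PowerSeries.X ^ (2 * b)) * h2
    rw [hf, Polynomial.sum_comp, map_sum, Finset.mul_sum]
    rw [← Polynomial.coeToPowerSeries.ringHom_apply, map_sum,
      ← Polynomial.coeToPowerSeries.ringHom_apply, map_sum, ← Finset.sum_add_distrib]
    refine Finset.sum_congr rfl fun p hp => ?_
    rw [smul_comp, Polynomial.coeToPowerSeries.ringHom_apply,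
      Polynomial.coeToPowerSeries.ringHom_apply, Polynomial.coe_smul, Polynomial.coe_smul,
      hterm p hp, smul_add, map_smul, mul_smul_comm]
  have hd : (PowerSeries.X : PowerSeries (ZMod 2)) ^ A ∣ ((f.comp (1 + X) : (ZMod 2)[X]) :
      PowerSeries (ZMod 2)) := by
    rw [key]
    obtain ⟨g, rfl⟩ := h
    refine dvd_add ⟨g, by push_cast; rfl⟩ (Dvd.dvd.mul_left ?_ _)
    rw [map_mul, map_pow, aeval_X, mul_pow, mul_assoc]
    exact dvd_mul_right _ _
  rw [X_pow_dvd_iff]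
  intro d hdA
  rw [← Polynomial.coeff_coe]
  exact PowerSeries.X_pow_dvd_iff.1 hd d hdA

/-- The scalar form of the equivalence of the Adem relations with the Bullett–Macdonald identity:
if the residues of `f = ∑ x(a, b) weight(a, b)` that express Adem relations vanish, then `f`
vanishes to order more than `2N / 3` at `0`, hence also at `1`, and at `∞` because it is
palindromic of formal degree `2N`. This is more than a nonzero `f` can do. -/
theorem sum_weight_eq_zero {N : ℕ} {x : ℕ × ℕ → ZMod 2}
    (h : ∀ a b, a + b = N → a < 2 * b → x (a, b) =
      ∑ c ∈ range (a / 2 + 1), ((b - c - 1).choose (a - 2 * c) : ZMod 2) * x (a + b - c, c)) :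
    ∑ p ∈ HasAntidiagonal.antidiagonal N, x p • weight p = 0 := by
  set f := ∑ p ∈ HasAntidiagonal.antidiagonal N, x p • weight p with hf
  set A := 2 * N / 3 + 1 with hA
  have h1 : X ^ A ∣ f := by
    refine X_pow_dvd_of_residue fun a ha => ?_
    obtain ⟨b, hb⟩ : ∃ b, a + b = N := ⟨N - a, by omega⟩
    rcases lt_or_eq_of_le (show a ≤ 2 * b by omega) with hab | hab
    · rw [hf, ← hb, residue_sum_of_lt x hab, ← h a b hb hab, CharTwo.add_self_eq_zero]
    · rw [hf, ← hb, hab, residue_sum_of_eq]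
  by_contra hne
  have hdeg : f.natDegree ≤ 2 * N := by
    refine natDegree_sum_le_of_forall_le _ _ fun p hp => ?_
    rw [HasAntidiagonal.mem_antidiagonal] at hp
    exact (natDegree_smul_le _ _).trans (hp ▸ natDegree_weight_le p)
  have hrefl : reflect (2 * N) f = f := by
    ext i
    rw [coeff_reflect, hf, finsetSum_coeff, finsetSum_coeff]
    refine Finset.sum_congr rfl fun p hp => ?_
    rw [HasAntidiagonal.mem_antidiagonal] at hp
    rw [coeff_smul, coeff_smul, ← hp, ← coeff_reflect, reflect_weight]
  rcases Nat.lt_or_ge (2 * N) A with hlt | hge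
  · obtain ⟨g, hg⟩ := h1
    rw [hg] at hdeg hne
    rw [natDegree_X_pow_mul _ (right_ne_zero_of_mul hne)] at hdeg
    omega
  have h3 := natDegree_le_of_reflect hrefl hdeg h1 hge
  have h2 : (1 + X) ^ A ∣ f := by
    obtain ⟨g, hg⟩ := dvd_comp hf h1
    refine ⟨g.comp (1 + X), ?_⟩
    have : (f.comp (1 + X)).comp (1 + X) = f := by
      rw [comp_assoc]
      have : ((1 + X : (ZMod 2)[X]).comp (1 + X)) = X := by
        simp only [add_comp, one_comp, X_comp]
        linear_combination (CharTwo.two_eq_zero (R := (ZMod 2)[X]))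
      rw [this, comp_X]
    rw [← this, hg]
    simp
  have hcop : IsCoprime (X ^ A : (ZMod 2)[X]) ((1 + X) ^ A) :=
    IsCoprime.pow ⟨-1, 1, by ring⟩
  obtain ⟨g, hg⟩ := hcop.mul_dvd h1 h2
  have hg0 : g ≠ 0 := by rintro rfl; exact hne (by rw [hg, mul_zero])
  have hmonic : (1 + X : (ZMod 2)[X]).Monic := by
    rw [add_comm]; exact monic_X_add_C 1
  have hd : f.natDegree = A + A + g.natDegree := by
    rw [hg, ((monic_X_pow A).mul (hmonic.pow A)).natDegree_mul' hg0,
      (monic_X_pow A).natDegree_mul (hmonic.pow A), natDegree_X_pow, hmonic.natDegree_pow,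
      show (1 + X : (ZMod 2)[X]).natDegree = 1 by
        rw [add_comm]; exact natDegree_X_add_C 1, mul_one]
  omega

variable {B : Type*} [Ring B] [Algebra (ZMod 2) B]

/-- The relations of the Steenrod algebra for a sequence of elements of an `𝔽₂`-algebra. -/
def AdemSeq (q : ℕ → B) : Prop :=
  q 0 = 1 ∧ ∀ i j, 0 < i → i < 2 * j → q i * q j = ∑ c ∈ range (i / 2 + 1),
    (((j - c - 1).choose (i - 2 * c) : ℕ) : ZMod 2) • (q (i + j - c) * q c)

theorem ademSeq_iff (q : ℕ → B) : (∀ a b : FreeAlgebra (ZMod 2) ℕ, AdemRel a b →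
    FreeAlgebra.lift (ZMod 2) q a = FreeAlgebra.lift (ZMod 2) q b) ↔ AdemSeq q := by
  constructor
  · intro h
    refine ⟨by simpa using h _ _ AdemRel.sq_zero, fun i j hi hij => ?_⟩
    simpa using h _ _ (AdemRel.adem i j hi hij)
  · rintro ⟨h0, h⟩ a b (_ | ⟨i, j, hi, hij⟩)
    · simpa using h0
    · simpa using h i j hi hij

/-- The Bullett–Macdonald identity `P(X² + X) P(1) = P(1 + X) P(X²)`, `P(u) = ∑ q_k u^k`. -/
def Identity (q : ℕ → B) : Prop :=
  ∀ N k, ∑ p ∈ HasAntidiagonal.antidiagonal N, (weight p).coeff k • (q p.1 * q p.2) = 0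

theorem sum_smul_weight_of_identity {q : ℕ → B} (h : Identity q) (φ : Module.Dual (ZMod 2) B)
    (N : ℕ) :
    ∑ p ∈ HasAntidiagonal.antidiagonal N, φ (q p.1 * q p.2) • weight p = 0 := by
  ext k
  have := congrArg φ (h N k)
  simpa [finsetSum_coeff, mul_comm] using this

/-- The Bullett–Macdonald identity is equivalent to the Adem relations. -/
theorem identity_iff_ademSeq {q : ℕ → B} (h0 : q 0 = 1) : Identity q ↔ AdemSeq q := by
  constructor
  · refine fun h => ⟨h0, fun i j hi hij => ?_⟩
    rw [← sub_eq_zero, ← Module.forall_dual_apply_eq_zero_iff (ZMod 2)]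
    intro φ
    have := residue_sum_of_lt (fun p => φ (q p.1 * q p.2)) hij
    rw [sum_smul_weight_of_identity h, map_zero] at this
    rw [map_sub, map_sum, CharTwo.sub_eq_add]
    simpa using this.symm
  · rintro ⟨-, h⟩ N k
    rw [← Module.forall_dual_apply_eq_zero_iff (ZMod 2)]
    intro φ
    have := sum_weight_eq_zero (N := N) (x := fun p => φ (q p.1 * q p.2)) (fun a b hN hab => by
      -- the relation with `a = 0` is trivial since `q 0 = 1`
      rcases Nat.eq_zero_or_pos a with rfl | ha
      · simp [h0]
      · simp [h a b ha hab])
    simpa [finsetSum_coeff, mul_comm] using congrArg (fun f => f.coeff k) this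

/-- The total operation `∑ q_k u^k T^k`. -/
noncomputable def total (q : ℕ → B) (u : B[X]) : PowerSeries B[X] :=
  PowerSeries.mk fun k => C (q k) * u ^ k

theorem identity_iff_total (q : ℕ → B) : Identity q ↔
    total q (X ^ 2 + X) * total q 1 + total q (1 + X) * total q (X ^ 2) = 0 := by
  have hX : ∀ p : B[X], Commute X p := fun p => commute_X p
  have h1 : ∀ p : B[X], Commute (X ^ 2 + X) p := fun p => ((hX p).pow_left 2).add_left (hX p)
  have h2 : ∀ p : B[X], Commute (1 + X) p := fun p => (Commute.one_left p).add_left (hX p)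
  have hw : ∀ p : ℕ × ℕ, (weight p).map (algebraMap (ZMod 2) B) =
      (X ^ 2 + X) ^ p.1 + (1 + X) ^ p.1 * X ^ (2 * p.2) := fun p => by simp [weight]
  have h : ∀ N, PowerSeries.coeff N
      (total q (X ^ 2 + X) * total q 1 + total q (1 + X) * total q (X ^ 2)) =
      ∑ p ∈ HasAntidiagonal.antidiagonal N,
        C (q p.1 * q p.2) * (weight p).map (algebraMap (ZMod 2) B) := by
    intro N
    rw [map_add, PowerSeries.coeff_mul, PowerSeries.coeff_mul, ← Finset.sum_add_distrib]
    refine Finset.sum_congr rfl fun p _ => ?_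
    simp only [total, PowerSeries.coeff_mk, one_pow, mul_one]
    rw [hw, mul_assoc, ((h1 (C (q p.2))).pow_left p.1).eq, mul_assoc, ← mul_assoc (_ ^ p.1),
      ((h2 (C (q p.2))).pow_left p.1).eq, C_mul, ← pow_mul]
    simp only [mul_add, mul_assoc]
  constructor
  · intro hq
    ext N k
    rw [h, finsetSum_coeff]
    simp only [coeff_C_mul, coeff_map, ← Algebra.commutes, ← Algebra.smul_def]
    simpa using hq N k
  · intro hq N k
    have := h N
    rw [hq, map_zero] at this
    have := congrArg (fun f => f.coeff k) this.symm
    simp only [finsetSum_coeff, coeff_C_mul, coeff_map, ← Algebra.commutes,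
      ← Algebra.smul_def] at this
    simpa using this

theorem mul_add_mul_eq_zero {R : Type*} [Ring R] {a b c d a' b' c' d' : R}
    (h : a * b + c * d = 0) (h' : a' * b' + c' * d' = 0) (hab : Commute a' b) (hcd : Commute c' d)
    (h2 : ∀ x : R, x + x = 0) : a * a' * (b * b') + c * c' * (d * d') = 0 := by
  have e1 := eq_neg_of_add_eq_zero_left h
  have e2 := eq_neg_of_add_eq_zero_left h'
  rw [hab.mul_mul_mul_comm, hcd.mul_mul_mul_comm, e1, e2, neg_mul_neg, h2]

/-- The Bullett–Macdonald identity passes to products of commuting total operations. This is why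
the Adem relations hold on tensor products. -/
theorem Identity.mul {q r : ℕ → B} (hq : Identity q) (hr : Identity r)
    (hc : ∀ i j, Commute (q i) (r j)) :
    Identity fun k => ∑ p ∈ HasAntidiagonal.antidiagonal k, q p.1 * r p.2 := by
  rw [identity_iff_total] at hq hr ⊢
  have h2 : ∀ x : PowerSeries B[X], x + x = 0 := by
    intro x
    ext N k
    have : (1 + 1 : ZMod 2) = 0 := rfl
    rw [map_add, coeff_add, ← one_smul (ZMod 2) ((PowerSeries.coeff N x).coeff k), ← add_smul,
      this, zero_smul]
    simp
  have hX : ∀ p : B[X], Commute X p := fun p => commute_X p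
  have hmul : ∀ u : B[X], (∀ p, Commute u p) →
      total (fun k => ∑ p ∈ HasAntidiagonal.antidiagonal k, q p.1 * r p.2) u =
      total q u * total r u := by
    intro u hu
    ext1 N
    rw [PowerSeries.coeff_mul]
    simp only [total, PowerSeries.coeff_mk, map_sum, Finset.sum_mul]
    refine Finset.sum_congr rfl fun p hp => ?_
    rw [HasAntidiagonal.mem_antidiagonal] at hp
    rw [← hp, pow_add, C_mul, mul_assoc, mul_assoc, ← mul_assoc (C (r p.2)),
      ← ((hu (C (r p.2))).pow_left p.1).eq, mul_assoc]
  have hcomm : ∀ u v : B[X], (∀ p, Commute u p) → (∀ p, Commute v p) →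
      Commute (total r u) (total q v) := by
    intro u v hu hv
    change _ * _ = _ * _
    ext1 N
    rw [PowerSeries.coeff_mul, PowerSeries.coeff_mul,
      ← Finset.sum_equiv (Equiv.prodComm ℕ ℕ) (s := HasAntidiagonal.antidiagonal N)
        (t := HasAntidiagonal.antidiagonal N) (by simp [HasAntidiagonal.mem_antidiagonal, add_comm])
        (fun p _ => rfl)]
    refine Finset.sum_congr rfl fun p _ => ?_
    simp only [total, PowerSeries.coeff_mk, Equiv.prodComm_apply, Prod.fst_swap, Prod.snd_swap]
    have h1 : Commute (C (r p.2)) (C (q p.1)) := by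
      change _ * _ = _ * _
      rw [← C_mul, ← C_mul, (hc p.1 p.2).eq]
    have h3 : Commute (C (r p.2)) (v ^ p.1) := ((hv _).pow_left _).symm
    have h4 : Commute (u ^ p.2) (C (q p.1) * v ^ p.1) := (hu _).pow_left _
    exact ((h1.mul_right h3).mul_left h4).eq
  have c1 : ∀ p : B[X], Commute (X ^ 2 + X) p := fun p => ((hX p).pow_left 2).add_left (hX p)
  have c2 : ∀ p : B[X], Commute (1 + X) p := fun p => (Commute.one_left p).add_left (hX p)
  have c3 : ∀ p : B[X], Commute (X ^ 2) p := fun p => (hX p).pow_left 2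
  have c4 : ∀ p : B[X], Commute 1 p := Commute.one_left
  rw [hmul _ c1, hmul _ c2, hmul _ c3, hmul _ c4]
  exact mul_add_mul_eq_zero hq hr (hcomm _ _ c1 c4) (hcomm _ _ c2 c3) h2

theorem sum_antidiagonalTuple_succ {M : Type*} [AddCommMonoid M] (n k : ℕ)
    (f : (Fin (n + 1) → ℕ) → M) : ∑ a ∈ Finset.Nat.antidiagonalTuple (n + 1) k, f a =
    ∑ p ∈ HasAntidiagonal.antidiagonal k, ∑ a ∈ Finset.Nat.antidiagonalTuple n p.2,
      f (Fin.cons p.1 a) := by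
  rw [Finset.sum_sigma']
  refine Finset.sum_bij' (fun a _ => ⟨(a 0, ∑ i, Fin.tail a i), Fin.tail a⟩)
    (fun x _ => Fin.cons x.1.1 x.2) (fun a ha => ?_) (fun x hx => ?_) (fun a _ => ?_)
    (fun x hx => ?_) fun a _ => ?_
  · simp only [Finset.Nat.mem_antidiagonalTuple, Fin.sum_univ_succ] at ha
    simp [HasAntidiagonal.mem_antidiagonal, Finset.Nat.mem_antidiagonalTuple, Fin.tail, ha]
  · simp only [mem_sigma, HasAntidiagonal.mem_antidiagonal, Finset.Nat.mem_antidiagonalTuple] at hx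
    simp [Finset.Nat.mem_antidiagonalTuple, Fin.sum_univ_succ, hx]
  · simp
  · simp only [mem_sigma, HasAntidiagonal.mem_antidiagonal, Finset.Nat.mem_antidiagonalTuple] at hx
    obtain ⟨⟨x, y⟩, a⟩ := x
    simp only at hx
    obtain ⟨-, rfl⟩ := hx
    simp
  · simp

/-- The Bullett–Macdonald identity for a product of several commuting total operations. -/
theorem identity_prod {n : ℕ} {q : Fin n → ℕ → B} (hq : ∀ i, Identity (q i))
    (hc : ∀ i j, i ≠ j → ∀ k l, Commute (q i k) (q j l)) :
    Identity fun k => ∑ a ∈ Finset.Nat.antidiagonalTuple n k,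
      (List.ofFn fun i => q i (a i)).prod := by
  induction n with
  | zero =>
    rw [identity_iff_total]
    have : ∀ u : B[X], total (fun k => ∑ a ∈ Finset.Nat.antidiagonalTuple 0 k,
        (List.ofFn fun i => q i (a i)).prod) u = 1 := by
      intro u
      ext1 N
      rcases N with _ | N
      · simp [total]
      · simp [total, PowerSeries.coeff_one]
    simp only [this]
    have : (1 + 1 : ZMod 2) = 0 := rfl
    ext N k
    rw [mul_one, map_add, coeff_add, ← one_smul (ZMod 2)
      ((PowerSeries.coeff N (1 : PowerSeries B[X])).coeff k), ← add_smul, this, zero_smul]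
    simp
  | succ n ih =>
    have h := (hq 0).mul (ih (q := fun i => q i.succ) (fun i => hq i.succ)
      fun i j hij => hc _ _ ((Fin.succ_injective n).ne hij)) (fun i k => ?_)
    · convert h using 2 with k
      rw [sum_antidiagonalTuple_succ]
      refine Finset.sum_congr rfl fun p _ => ?_
      rw [Finset.mul_sum]
      refine Finset.sum_congr rfl fun a _ => ?_
      simp [List.ofFn_succ]
    · refine Commute.sum_right _ _ _ fun a _ => Commute.list_prod_right _ _ fun x hx => ?_
      rw [List.mem_ofFn] at hx
      obtain ⟨l, rfl⟩ := hx
      exact hc _ _ (Fin.succ_ne_zero l).symm _ _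

end BullettMacdonald

/-! ### Steenrod squares on polynomial rings -/

namespace Steinberg

open MvPolynomial

theorem totalSq_X {n : ℕ} (i : Fin n) :
    totalSq n (X i) = Polynomial.C (X i) + Polynomial.C (X i ^ 2) * Polynomial.X := by
  simp [totalSq]

theorem sq_eq_coeff (n k : ℕ) (f : MvPolynomial (Fin n) (ZMod 2)) :
    sq n k f = (totalSq n f).coeff k := rfl

/-- The Cartan formula. -/
theorem sq_mul (n k : ℕ) (f g : MvPolynomial (Fin n) (ZMod 2)) :
    sq n k (f * g) = ∑ p ∈ Finset.HasAntidiagonal.antidiagonal k, sq n p.1 f * sq n p.2 g := by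
  simp only [sq_eq_coeff, map_mul, Polynomial.coeff_mul]

/-- A polynomial in `T` has weight `d` if its coefficients are those of the total square of an
element of degree `d` in an unstable module: homogeneous of degree `d + k` at `T^k`, and zero for
`k > d`. -/
def HasWeight {n : ℕ} (d : ℕ) (F : Polynomial (MvPolynomial (Fin n) (ZMod 2))) : Prop :=
  ∀ k, (F.coeff k).IsHomogeneous (d + k) ∧ (d < k → F.coeff k = 0)

theorem HasWeight.mul {n d e : ℕ} {F G : Polynomial (MvPolynomial (Fin n) (ZMod 2))}
    (hF : HasWeight d F) (hG : HasWeight e G) : HasWeight (d + e) (F * G) := by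
  intro k
  rw [Polynomial.coeff_mul]
  constructor
  · refine IsHomogeneous.sum _ _ _ fun p hp => ?_
    rw [Finset.HasAntidiagonal.mem_antidiagonal] at hp
    rw [← hp, add_add_add_comm]
    exact (hF p.1).1.mul (hG p.2).1
  · intro hk
    refine Finset.sum_eq_zero fun p hp => ?_
    rw [Finset.HasAntidiagonal.mem_antidiagonal] at hp
    rcases lt_or_ge d p.1 with h | h
    · rw [(hF p.1).2 h, zero_mul]
    · rw [(hG p.2).2 (by omega), mul_zero]

theorem hasWeight_C (n : ℕ) (c : ZMod 2) :
    HasWeight 0 (Polynomial.C (C c) : Polynomial (MvPolynomial (Fin n) (ZMod 2))) := by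
  intro k
  rw [Polynomial.coeff_C]
  split_ifs with h
  · subst h
    exact ⟨isHomogeneous_C _ _, fun h => absurd h (lt_irrefl _)⟩
  · exact ⟨isHomogeneous_zero _ _ _, fun _ => rfl⟩

theorem hasWeight_X {n : ℕ} (i : Fin n) : HasWeight 1 (totalSq n (X i)) := by
  intro k
  rw [totalSq_X]
  rcases k with _ | _ | k
  · simpa using isHomogeneous_X (ZMod 2) i
  · have := isHomogeneous_X_pow (R := ZMod 2) i 2
    generalize (X i ^ 2 : MvPolynomial (Fin n) (ZMod 2)) = y at *
    simpa [Polynomial.coeff_C] using this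
  · generalize (X i ^ 2 : MvPolynomial (Fin n) (ZMod 2)) = y at *
    simp [isHomogeneous_zero]

theorem hasWeight_monomial {n : ℕ} (s : Fin n →₀ ℕ) (c : ZMod 2) :
    HasWeight s.degree (totalSq n (monomial s c)) := by
  have hprod : ∀ t : Finset (Fin n), HasWeight (∑ i ∈ t, s i) (∏ i ∈ t, totalSq n (X i) ^ s i) := by
    intro t
    induction t using Finset.induction_on with
    | empty => simpa using hasWeight_C n 1
    | insert i t hi ih =>
      rw [Finset.sum_insert hi, Finset.prod_insert hi]
      refine HasWeight.mul ?_ ih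
      generalize s i = m
      induction m with
      | zero => simpa using hasWeight_C n 1
      | succ m ihm => rw [pow_succ]; exact ihm.mul (hasWeight_X i)
  have h := (hasWeight_C n c).mul (hprod s.support)
  rw [zero_add] at h
  convert h using 1
  swap
  rw [monomial_eq, map_mul, Finsupp.prod, map_prod]
  simp only [map_pow]
  congr 1
  · exact (totalSq n).commutes c
  · rfl

theorem hasWeight_totalSq {n d : ℕ} {f : MvPolynomial (Fin n) (ZMod 2)} (hf : f.IsHomogeneous d) :
    HasWeight d (totalSq n f) := by
  have h : ∀ s ∈ f.support, HasWeight d (totalSq n (monomial s (f.coeff s))) := by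
    intro s hs
    have := hasWeight_monomial s (f.coeff s)
    rwa [show s.degree = d by
      rw [← hf (mem_support_iff.1 hs), Finsupp.degree_eq_weight_one]; rfl] at this
  intro k
  rw [f.as_sum, map_sum, Polynomial.finsetSum_coeff]
  exact ⟨IsHomogeneous.sum _ _ _ fun s hs => (h s hs k).1,
    fun hk => Finset.sum_eq_zero fun s hs => (h s hs k).2 hk⟩

theorem isHomogeneous_sq {n d : ℕ} (k : ℕ) {f : MvPolynomial (Fin n) (ZMod 2)}
    (hf : f.IsHomogeneous d) : (sq n k f).IsHomogeneous (d + k) :=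
  (hasWeight_totalSq hf k).1

theorem sq_eq_zero {n d k : ℕ} {f : MvPolynomial (Fin n) (ZMod 2)}
    (hf : f.IsHomogeneous d) (h : d < k) : sq n k f = 0 :=
  (hasWeight_totalSq hf k).2 h

theorem sq_zero_apply (n : ℕ) (f : MvPolynomial (Fin n) (ZMod 2)) : sq n 0 f = f := by
  have h : (Polynomial.aeval (0 : MvPolynomial (Fin n) (ZMod 2))).toRingHom.comp
      (totalSq n).toRingHom = RingHom.id _ := by
    refine MvPolynomial.ringHom_ext (fun c => ?_) fun i => ?_
    · have := (totalSq n).commutes c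
      change Polynomial.aeval _ (totalSq n (C c)) = C c
      change totalSq n (C c) = Polynomial.C (C c) at this
      rw [this, Polynomial.aeval_C]
      rfl
    · change Polynomial.aeval _ (totalSq n (X i)) = X i
      rw [totalSq_X]
      simp
  have := DFunLike.congr_fun h f
  change Polynomial.aeval _ (totalSq n f) = f at this
  rw [sq_eq_coeff, Polynomial.coeff_zero_eq_aeval_zero]
  exact this

theorem coeff_eval₂_mul_X {R S : Type*} [CommRing R] [CommRing S] (φ : R →+* Polynomial S) (v : S)
    (F : Polynomial R) (N : ℕ) : (F.eval₂ φ (Polynomial.C v * Polynomial.X)).coeff N =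
      ∑ p ∈ Finset.HasAntidiagonal.antidiagonal N, (φ (F.coeff p.2)).coeff p.1 * v ^ p.2 := by
  induction F using Polynomial.induction_on' with
  | add F G hF hG =>
    simp only [Polynomial.eval₂_add, Polynomial.coeff_add, hF, hG, map_add, add_mul,
      Finset.sum_add_distrib]
  | monomial m c =>
    rw [Polynomial.eval₂_monomial, mul_pow, ← Polynomial.C_pow, ← mul_assoc,
      Polynomial.coeff_mul_X_pow', Polynomial.coeff_mul_C]
    split_ifs with h
    · rw [Finset.sum_eq_single (N - m, m)]
      · simp
      · rintro ⟨a, b⟩ hp hne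
        rw [Finset.HasAntidiagonal.mem_antidiagonal] at hp
        simp only at hp
        have hb : m ≠ b := by
          rintro rfl
          exact hne (by rw [← hp, Nat.add_sub_cancel])
        simp [Polynomial.coeff_monomial, hb]
      · intro hn
        exact absurd (Finset.HasAntidiagonal.mem_antidiagonal.2 (Nat.sub_add_cancel h)) hn
    · refine (Finset.sum_eq_zero fun p hp => ?_).symm
      rw [Finset.HasAntidiagonal.mem_antidiagonal] at hp
      simp [Polynomial.coeff_monomial, show m ≠ p.2 by omega]

/-- The total square with parameter `u T`, `f ↦ ∑ Sq^k f u^k T^k`. -/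
noncomputable def twistedSq (n : ℕ) (u : Polynomial (MvPolynomial (Fin n) (ZMod 2))) :
    MvPolynomial (Fin n) (ZMod 2) →+* Polynomial (Polynomial (MvPolynomial (Fin n) (ZMod 2))) :=
  (Polynomial.eval₂RingHom (Polynomial.C.comp Polynomial.C) (Polynomial.C u * Polynomial.X)).comp
    (totalSq n).toRingHom

/-- The iterated total square `f ↦ ∑ Sq^a Sq^b f u^a v^b T^(a+b)`. -/
noncomputable def twistedSqSq (n : ℕ) (u v : Polynomial (MvPolynomial (Fin n) (ZMod 2))) :
    MvPolynomial (Fin n) (ZMod 2) →+* Polynomial (Polynomial (MvPolynomial (Fin n) (ZMod 2))) :=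
  (Polynomial.eval₂RingHom (twistedSq n u) (Polynomial.C v * Polynomial.X)).comp
    (totalSq n).toRingHom

theorem coeff_twistedSq (n : ℕ) (u) (f : MvPolynomial (Fin n) (ZMod 2)) (a : ℕ) :
    (twistedSq n u f).coeff a = Polynomial.C (sq n a f) * u ^ a := by
  change ((totalSq n f).eval₂ (Polynomial.C.comp Polynomial.C)
    (Polynomial.C u * Polynomial.X)).coeff a = _
  rw [coeff_eval₂_mul_X, Finset.sum_eq_single (0, a)]
  · simp [sq_eq_coeff]
  · rintro ⟨c, d⟩ hp hne
    rw [Finset.HasAntidiagonal.mem_antidiagonal] at hp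
    have : c ≠ 0 := by
      rintro rfl
      exact hne (by rw [← hp]; simp)
    simp [Polynomial.coeff_C, this]
  · simp

theorem coeff_twistedSqSq (n : ℕ) (u v) (f : MvPolynomial (Fin n) (ZMod 2)) (N : ℕ) :
    (twistedSqSq n u v f).coeff N = ∑ p ∈ Finset.HasAntidiagonal.antidiagonal N,
      Polynomial.C (sq n p.1 (sq n p.2 f)) * (u ^ p.1 * v ^ p.2) := by
  change ((totalSq n f).eval₂ (twistedSq n u) (Polynomial.C v * Polynomial.X)).coeff N = _
  rw [coeff_eval₂_mul_X]
  refine Finset.sum_congr rfl fun p _ => ?_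
  rw [coeff_twistedSq, mul_assoc]
  rfl

theorem twistedSq_C (n : ℕ) (u) (c : ZMod 2) : twistedSq n u (C c) =
    Polynomial.C (Polynomial.C (C c)) := by
  change (totalSq n (C c)).eval₂ _ _ = _
  rw [show totalSq n (C c) = Polynomial.C (C c) from (totalSq n).commutes c, Polynomial.eval₂_C]
  rfl

theorem twistedSq_X {n : ℕ} (u) (i : Fin n) : twistedSq n u (X i) =
    Polynomial.C (Polynomial.C (X i)) +
      Polynomial.C (Polynomial.C (X i)) ^ 2 * (Polynomial.C u * Polynomial.X) := by
  change Polynomial.eval₂RingHom (Polynomial.C.comp Polynomial.C) (Polynomial.C u * Polynomial.X)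
    (totalSq n (X i)) = _
  rw [totalSq_X, map_add, map_mul, Polynomial.coe_eval₂RingHom, Polynomial.eval₂_C,
    Polynomial.eval₂_C, Polynomial.eval₂_X, map_pow]
  rfl

theorem twistedSqSq_X {n : ℕ} (u v) (i : Fin n) : twistedSqSq n u v (X i) =
    twistedSq n u (X i) + twistedSq n u (X i) ^ 2 * (Polynomial.C v * Polynomial.X) := by
  change Polynomial.eval₂RingHom (twistedSq n u) (Polynomial.C v * Polynomial.X)
    (totalSq n (X i)) = _
  rw [totalSq_X, map_add, map_mul, Polynomial.coe_eval₂RingHom, Polynomial.eval₂_C,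
    Polynomial.eval₂_C, Polynomial.eval₂_X, map_pow]

/-- The two sides of the Bullett–Macdonald identity on a variable `x`, written with `s` for the
parameter. -/
theorem twisted_eq {R : Type*} [CommRing R] (h2 : (2 : R) = 0) (x s T : R) :
    x + x ^ 2 * ((s ^ 2 + s) * T) + (x + x ^ 2 * ((s ^ 2 + s) * T)) ^ 2 * (1 * T) =
      x + x ^ 2 * ((1 + s) * T) + (x + x ^ 2 * ((1 + s) * T)) ^ 2 * (s ^ 2 * T) := by
  linear_combination (x ^ 3 * T ^ 2 * (s ^ 2 + s) - x ^ 3 * T ^ 2 * (1 + s) * s ^ 2) * h2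

/-- Both sides of the Bullett–Macdonald identity are ring homomorphisms, so that they agree on
polynomials because they agree on the variables. -/
theorem twistedSqSq_eq (n : ℕ) :
    twistedSqSq n (Polynomial.X ^ 2 + Polynomial.X) 1 =
      twistedSqSq n (1 + Polynomial.X) (Polynomial.X ^ 2) := by
  refine MvPolynomial.ringHom_ext (fun c => ?_) fun i => ?_
  · change (totalSq n (C c)).eval₂ _ _ = (totalSq n (C c)).eval₂ _ _
    rw [show totalSq n (C c) = Polynomial.C (C c) from (totalSq n).commutes c, Polynomial.eval₂_C,
      Polynomial.eval₂_C, twistedSq_C, twistedSq_C]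
  · rw [twistedSqSq_X, twistedSqSq_X, twistedSq_X, twistedSq_X]
    simp only [Polynomial.C_add, Polynomial.C_1, Polynomial.C_pow]
    generalize Polynomial.C (Polynomial.C (X i : MvPolynomial (Fin n) (ZMod 2))) = x
    refine twisted_eq (R := Polynomial (Polynomial (MvPolynomial (Fin n) (ZMod 2)))) ?_ _ _ _
    rw [← map_ofNat (Polynomial.C.comp (Polynomial.C.comp
      (C : ZMod 2 →+* MvPolynomial (Fin n) (ZMod 2)))) 2, show (OfNat.ofNat 2 : ZMod 2) = 0 from rfl,
      map_zero]

theorem identity_sq (n : ℕ) : BullettMacdonald.Identity (B := Module.End (ZMod 2)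
    (MvPolynomial (Fin n) (ZMod 2))) (sq n) := by
  intro N k
  refine LinearMap.ext fun f => ?_
  have h := congrArg (fun F => (Polynomial.coeff (Polynomial.coeff F N) k))
    (DFunLike.congr_fun (twistedSqSq_eq n) f)
  simp only [coeff_twistedSqSq, Polynomial.finsetSum_coeff, Polynomial.coeff_C_mul] at h
  have hw : ∀ p : ℕ × ℕ, algebraMap (ZMod 2) (MvPolynomial (Fin n) (ZMod 2))
      ((BullettMacdonald.weight p).coeff k) =
      ((Polynomial.X ^ 2 + Polynomial.X) ^ p.1 * 1 ^ p.2 :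
        Polynomial (MvPolynomial (Fin n) (ZMod 2))).coeff k +
      ((1 + Polynomial.X) ^ p.1 * (Polynomial.X ^ 2) ^ p.2 :
        Polynomial (MvPolynomial (Fin n) (ZMod 2))).coeff k := by
    intro p
    rw [← Polynomial.coeff_map, ← Polynomial.coeff_add]
    simp [BullettMacdonald.weight, pow_mul]
  rw [LinearMap.sum_apply]
  have h' := CharTwo.add_eq_zero.2 h
  rw [← Finset.sum_add_distrib] at h'
  rw [LinearMap.zero_apply, ← h']
  refine Finset.sum_congr rfl fun p _ => ?_
  rw [LinearMap.smul_apply, Module.End.mul_apply, Algebra.smul_def, hw, ← mul_add, mul_comm]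

/-- The Adem relations on polynomial rings. -/
theorem ademSeq_sq (n : ℕ) : BullettMacdonald.AdemSeq (B := Module.End (ZMod 2)
    (MvPolynomial (Fin n) (ZMod 2))) (sq n) :=
  (BullettMacdonald.identity_iff_ademSeq (LinearMap.ext (sq_zero_apply n))).1 (identity_sq n)

end Steinberg

/-! ### Tensor products of unstable modules -/

theorem List.prod_ofFn_ite_eq {G : Type*} [Monoid G] {n : ℕ} (j : Fin n) (f : Fin n → G) :
    (List.ofFn fun i => if j = i then f i else 1).prod = f j := by
  induction n with
  | zero => exact j.elim0
  | succ n ih =>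
    rw [List.ofFn_succ, List.prod_cons]
    refine Fin.cases ?_ (fun j => ?_) j
    · rw [if_pos rfl, List.prod_eq_one, mul_one]
      intro x hx
      obtain ⟨i, rfl⟩ := List.mem_ofFn.1 hx
      exact if_neg (Fin.succ_ne_zero i).symm
    · rw [if_neg (Fin.succ_ne_zero j), one_mul]
      simpa using ih j (fun i => f i.succ)

theorem BullettMacdonald.Identity.map {B B' : Type*} [Ring B] [Algebra (ZMod 2) B] [Ring B']
    [Algebra (ZMod 2) B'] {q : ℕ → B} (hq : Identity q) (φ : B →ₗ[ZMod 2] B')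
    (hφ : ∀ a b, φ (a * b) = φ a * φ b) : Identity fun k => φ (q k) := by
  intro N k
  have := congrArg φ (hq N k)
  simpa [hφ] using this

namespace SqMod

open PiTensorProduct
open scoped TensorProduct

theorem IsUnstable.ademSeq {M : SqMod.{u}} (hM : M.IsUnstable) :
    BullettMacdonald.AdemSeq (B := Module.End (ZMod 2) M.carrier) M.sq :=
  (BullettMacdonald.ademSeq_iff (B := Module.End (ZMod 2) M.carrier) _).1 hM.rel

/-- A grading whose parts are separated by projections is a direct sum decomposition. -/
theorem isInternal_of_proj {V : Type*} [AddCommGroup V] [Module (ZMod 2) V]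
    {D : ℕ → Submodule (ZMod 2) V} (p : ℕ → V →ₗ[ZMod 2] V) (h1 : ∀ d, ∀ x ∈ D d, p d x = x)
    (h2 : ∀ d e, e ≠ d → ∀ x ∈ D e, p d x = 0) (htop : ⨆ d, D d = ⊤) :
    DirectSum.IsInternal D := by
  refine DirectSum.isInternal_submodule_of_iSupIndep_of_iSup_eq_top (fun d => ?_) htop
  rw [Submodule.disjoint_def]
  intro x hx hx'
  have h : (⨆ e, ⨆ (_ : e ≠ d), D e) ≤ LinearMap.ker (p d) :=
    iSup₂_le fun e he y hy => h2 d e he y hy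
  rw [← h1 d x hx]
  exact h hx'

variable {n : ℕ} {M : Fin n → SqMod.{u}}

/-- The elements that are homogeneous. -/
abbrev Homogeneous (M : SqMod.{u}) : Type u := {x : M.carrier // ∃ d, x ∈ M.deg d}

theorem IsUnstable.span_homogeneous {M : SqMod.{u}} (hM : M.IsUnstable) :
    Submodule.span (ZMod 2) (Set.range (Subtype.val : M.Homogeneous → M.carrier)) = ⊤ := by
  rw [eq_top_iff, ← hM.isInternal.submodule_iSup_eq_top]
  exact iSup_le fun d x hx => Submodule.subset_span ⟨⟨x, d, hx⟩, rfl⟩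

theorem span_tprod_homogeneous (hM : ∀ i, (M i).IsUnstable) :
    Submodule.span (ZMod 2) (Set.range fun m : ∀ i, (M i).Homogeneous =>
      tprod (ZMod 2) fun i => (m i).1) = ⊤ :=
  submodule_span_eq_top (g := fun i (m : (M i).Homogeneous) => m.1)
    fun i => (hM i).span_homogeneous

theorem tprod_mem_tensorDeg {a : Fin n → ℕ} {m : ∀ i, (M i).carrier}
    (hm : ∀ i, m i ∈ (M i).deg (a i)) : tprod (ZMod 2) m ∈ tensorDeg M (∑ i, a i) :=
  Submodule.subset_span ⟨a, m, rfl, hm, rfl⟩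

theorem isInternal_tensorDeg (hM : ∀ i, (M i).IsUnstable) :
    DirectSum.IsInternal (tensorDeg M) := by
  let P : ∀ i, ℕ → (M i).carrier →ₗ[ZMod 2] (M i).carrier := fun i k =>
    ((M i).deg k).subtype ∘ₗ BrownGitler.proj (hM i) k
  have hP : ∀ i k, ∀ x ∈ (M i).deg k, P i k x = x := fun i k x hx =>
    congrArg Subtype.val (BrownGitler.proj_self (hM i) k ⟨x, hx⟩)
  have hP' : ∀ i k d, d ≠ k → ∀ x ∈ (M i).deg d, P i k x = 0 := fun i k d h x hx =>
    congrArg Subtype.val (BrownGitler.proj_of_mem (hM i) k d hx h)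
  have hmap : ∀ (a b : Fin n → ℕ) (m : ∀ i, (M i).carrier), (∀ i, m i ∈ (M i).deg (b i)) →
      PiTensorProduct.map (fun i => P i (a i)) (tprod (ZMod 2) m) =
        if a = b then tprod (ZMod 2) m else 0 := by
    intro a b m hm
    rw [map_tprod]
    split_ifs with h
    · subst h
      exact congrArg _ (funext fun i => hP i _ _ (hm i))
    · obtain ⟨i, hi⟩ := Function.ne_iff.1 h
      exact (PiTensorProduct.tprod (ZMod 2)).map_coord_zero i (hP' i _ _ hi.symm _ (hm i))
  have key : ∀ (d : ℕ) (b : Fin n → ℕ) (m : ∀ i, (M i).carrier), (∀ i, m i ∈ (M i).deg (b i)) →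
      (∑ a ∈ Finset.Nat.antidiagonalTuple n d, PiTensorProduct.map fun i => P i (a i))
        (tprod (ZMod 2) m) = if ∑ i, b i = d then tprod (ZMod 2) m else 0 := by
    intro d b m hm
    rw [LinearMap.sum_apply, Finset.sum_congr rfl fun a _ => hmap a b m hm, Finset.sum_ite_eq']
    simp [Finset.Nat.mem_antidiagonalTuple]
  refine isInternal_of_proj (fun d => ∑ a ∈ Finset.Nat.antidiagonalTuple n d,
    PiTensorProduct.map fun i => P i (a i)) (fun d => ?_) (fun d e he => ?_) ?_
  · refine fun x hx => LinearMap.eqOn_span (f := ∑ a ∈ Finset.Nat.antidiagonalTuple n d,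
      PiTensorProduct.map fun i => P i (a i)) (g := LinearMap.id) ?_ hx
    rintro _ ⟨b, m, hb, hm, rfl⟩
    rw [key d b m hm, if_pos hb, LinearMap.id_apply]
  · refine fun x hx => LinearMap.eqOn_span (f := ∑ a ∈ Finset.Nat.antidiagonalTuple n d,
      PiTensorProduct.map fun i => P i (a i)) (g := 0) ?_ hx
    rintro _ ⟨b, m, hb, hm, rfl⟩
    rw [key d b m hm, if_neg (by omega), LinearMap.zero_apply]
  · rw [eq_top_iff, ← span_tprod_homogeneous hM, Submodule.span_le]
    rintro _ ⟨m, rfl⟩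
    exact (le_iSup (tensorDeg M) _)
      (tprod_mem_tensorDeg (a := fun i => (m i).2.choose) fun i => (m i).2.choose_spec)

/-- The Cartan formula satisfies the Adem relations: the operations on the factors, extended by
the identity, are commuting families that satisfy the Bullett–Macdonald identity. -/
theorem ademSeq_tensorSq (hM : ∀ i, (M i).IsUnstable) : BullettMacdonald.AdemSeq
    (B := Module.End (ZMod 2) (⨂[ZMod 2] i, (M i).carrier)) (tensorSq M) := by
  classical
  let φ : ∀ i, Module.End (ZMod 2) (M i).carrier →ₗ[ZMod 2]
      Module.End (ZMod 2) (⨂[ZMod 2] i, (M i).carrier) := fun i =>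
    (mapMultilinear (ZMod 2) (fun i => (M i).carrier) (fun i => (M i).carrier)).toLinearMap
      (fun _ => LinearMap.id) i
  have hφ : ∀ i f, φ i f = mapMonoidHom (Pi.mulSingle i f) := fun i f => rfl
  have h0 : tensorSq M 0 = 1 := by
    have : ∀ i, (M i).sq 0 = LinearMap.id := fun i => (hM i).ademSeq.1
    rw [tensorSq, Finset.Nat.antidiagonalTuple_zero_right, Finset.sum_singleton]
    simp only [Pi.zero_apply, this]
    exact PiTensorProduct.map_id
  refine (BullettMacdonald.identity_iff_ademSeq h0).1 ?_
  have h := BullettMacdonald.identity_prod (q := fun i k => φ i ((M i).sq k)) (fun i =>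
    ((BullettMacdonald.identity_iff_ademSeq (hM i).ademSeq.1).2 (hM i).ademSeq).map (φ i)
      fun a b => by rw [hφ, hφ, hφ, Pi.mulSingle_mul, map_mul]) fun i j hij k l => by
        simp only [hφ]
        exact (Pi.mulSingle_commute hij _ _).map mapMonoidHom
  convert h using 2 with k
  refine Finset.sum_congr rfl fun a _ => ?_
  have : (List.ofFn fun i => φ i ((M i).sq (a i))).prod =
      mapMonoidHom (List.ofFn fun i => (Pi.mulSingle i ((M i).sq (a i)) :
        ∀ i, Module.End (ZMod 2) (M i).carrier)).prod := by
    rw [map_list_prod, List.map_ofFn]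
    rfl
  rw [this]
  refine congrArg (mapMonoidHom (R := ZMod 2)) (funext fun j => ?_)
  rw [Pi.list_prod_apply, List.map_ofFn, ← List.prod_ofFn_ite_eq j fun _ => (M j).sq (a j)]
  congr 2
  funext i
  by_cases h : j = i
  · subst h
    simp
  · simp [h]

/-- Tensor products of unstable modules are unstable. -/
theorem isUnstable_tensor (hM : ∀ i, (M i).IsUnstable) : (tensor M).IsUnstable where
  isInternal := isInternal_tensorDeg hM
  sq_mem k d x hx := by
    have : tensorDeg M d ≤ (tensorDeg M (d + k)).comap (tensorSq M k) := by
      refine Submodule.span_le.2 ?_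
      rintro _ ⟨b, m, hb, hm, rfl⟩
      change tensorSq M k _ ∈ tensorDeg M (d + k)
      rw [tensorSq, LinearMap.sum_apply]
      refine sum_mem fun a ha => ?_
      rw [map_tprod]
      rw [Finset.Nat.mem_antidiagonalTuple] at ha
      rw [← hb, ← ha, ← Finset.sum_add_distrib]
      exact tprod_mem_tensorDeg fun i => (hM i).sq_mem _ _ _ (hm i)
    exact this hx
  rel := (BullettMacdonald.ademSeq_iff (B := Module.End (ZMod 2) (⨂[ZMod 2] i, (M i).carrier)) _).2
    (ademSeq_tensorSq hM)
  unstable k d x hx hk := by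
    have : tensorDeg M d ≤ LinearMap.ker (tensorSq M k) := by
      refine Submodule.span_le.2 ?_
      rintro _ ⟨b, m, hb, hm, rfl⟩
      change tensorSq M k _ = 0
      rw [tensorSq, LinearMap.sum_apply]
      refine Finset.sum_eq_zero fun a ha => ?_
      rw [map_tprod]
      rw [Finset.Nat.mem_antidiagonalTuple] at ha
      obtain ⟨i, -, hi⟩ := Finset.exists_lt_of_sum_lt (show ∑ i, b i < ∑ i, a i by omega)
      exact (PiTensorProduct.tprod (ZMod 2)).map_coord_zero i ((hM i).unstable _ _ _ (hm i) hi)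
    exact this hx

end SqMod

/-! ### The module `L₁` -/

namespace Steinberg

open MvPolynomial

theorem act_one (n : ℕ) : act (1 : Matrix (Fin n) (Fin n) (ZMod 2)) = AlgHom.id _ _ := by
  refine MvPolynomial.algHom_ext fun i => ?_
  simp only [act, aeval_X, AlgHom.id_apply]
  rw [Finset.sum_eq_single i] <;> simp +contextual

theorem eq_one_of_isUnit {b : Matrix (Fin 1) (Fin 1) (ZMod 2)} (h : IsUnit b) : b = 1 := by
  rw [Matrix.isUnit_iff_isUnit_det, Matrix.det_fin_one, isUnit_iff_ne_zero] at h
  ext i j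
  rw [Subsingleton.elim i 0, Subsingleton.elim j 0, Matrix.one_apply_eq]
  generalize b 0 0 = c at h
  revert c
  decide

theorem idem_one : idem 1 = LinearMap.id := by
  have hb : borel 1 = {1} := by
    ext b
    rw [Finset.mem_singleton]
    refine ⟨fun h => eq_one_of_isUnit (isUnit_of_mem_borel h), ?_⟩
    rintro rfl
    simp only [borel, Finset.mem_filter, Finset.mem_univ, true_and]
    exact ⟨isUnit_one, fun i j h => absurd h (by simp [Subsingleton.elim i j])⟩
  have hs : (Finset.univ : Finset (Equiv.Perm (Fin 1))) = {1} := by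
    ext s
    simp [Subsingleton.elim s 1]
  rw [idem, hb, hs, Finset.sum_singleton, Finset.sum_singleton,
    eq_one_of_isUnit (isUnit_permMatrix _), act_one]
  rfl

theorem omega_one : omega 1 = X 0 := by
  have : (Finset.univ.erase (0 : Fin 1 → ZMod 2)) = {fun _ => 1} := by decide
  rw [omega, this]
  simp

theorem mem_L_one {f : MvPolynomial (Fin 1) (ZMod 2)} : f ∈ L 1 ↔ f.coeff 0 = 0 := by
  rw [L, M, idem_one, omega_one, LinearMap.range_id, Submodule.map_top]
  constructor
  · rintro ⟨g, rfl⟩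
    rw [LinearMap.mulLeft_apply, coeff_X_mul', if_neg (by simp)]
  · intro h
    suffices X 0 ∣ f by
      obtain ⟨g, rfl⟩ := this
      exact ⟨g, rfl⟩
    rw [f.as_sum]
    refine Finset.dvd_sum fun s hs => ?_
    rw [X_dvd_monomial]
    right
    intro h0
    rw [mem_support_iff] at hs
    refine hs ?_
    rw [← h]
    rw [show s = 0 from Finsupp.ext fun i => by rw [Subsingleton.elim i 0, h0]; rfl]

theorem mem_L'_one {f : MvPolynomial (Fin 1) (ZMod 2)} : f ∈ L' 1 ↔ ∃ g ∈ L 1, f = X 0 * g := by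
  rw [L', omega_one, Submodule.mem_map]
  simp only [LinearMap.mulLeft_apply, eq_comm]

theorem isUnstable_L_one : (steinbergL 1).IsUnstable where
  isInternal := by
    have hmem : ∀ d, ∀ f ∈ L 1, homogeneousComponent d f ∈ L 1 := by
      intro d f hf
      rw [mem_L_one] at hf ⊢
      rw [coeff_homogeneousComponent]
      simp [hf]
    refine SqMod.isInternal_of_proj (D := (steinbergL 1).deg) (V := (steinbergL 1).carrier)
      (fun d => (homogeneousComponent d).restrict (hmem d)) (fun d x hx => ?_)
      (fun d e he x hx => ?_) ?_
    · refine Subtype.ext ?_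
      change homogeneousComponent d x.1 = x.1
      rw [homogeneousComponent_of_mem (show x.1 ∈ homogeneousSubmodule _ _ d from hx), if_pos rfl]
    · refine Subtype.ext ?_
      change homogeneousComponent d x.1 = 0
      rw [homogeneousComponent_of_mem (show x.1 ∈ homogeneousSubmodule _ _ e from hx), if_neg he.symm]
    · rw [eq_top_iff]
      intro x _
      have : x = ∑ d ∈ Finset.range (x.1.totalDegree + 1),
          (⟨homogeneousComponent d x.1, hmem d _ x.2⟩ : L 1) := by
        refine Subtype.ext ?_
        rw [AddSubmonoidClass.coe_finsetSum]
        exact (sum_homogeneousComponent x.1).symm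
      rw [this]
      exact sum_mem fun d _ => (le_iSup (steinbergL 1).deg d)
        (show homogeneousComponent d x.1 ∈ homogeneousSubmodule _ _ d from
          homogeneousComponent_isHomogeneous d x.1)
  sq_mem i d x hx := isHomogeneous_sq i (show x.1.IsHomogeneous d from hx)
  rel := by
    refine (BullettMacdonald.ademSeq_iff (B := Module.End (ZMod 2) (L 1)) _).2
      ⟨LinearMap.ext fun x => Subtype.ext (sq_zero_apply 1 x.1), fun i j hi hij =>
        LinearMap.ext fun x => Subtype.ext ?_⟩
    have := LinearMap.congr_fun ((ademSeq_sq 1).2 i j hi hij) x.1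
    rw [LinearMap.sum_apply] at this ⊢
    rw [AddSubmonoidClass.coe_finsetSum]
    exact this
  unstable i d x hx hi := Subtype.ext (sq_eq_zero (show x.1.IsHomogeneous d from hx) hi)

end Steinberg

theorem L₁Pow.isUnstable (n : ℕ) : (L₁Pow n).IsUnstable :=
  SqMod.isUnstable_tensor fun _ => Steinberg.isUnstable_L_one

/-! ### Morphisms into Brown–Gitler modules -/

namespace BrownGitler

open SteenrodAlgebra

theorem eq_one_of_ne_zero {c : ZMod 2} (h : c ≠ 0) : c = 1 := by
  revert c
  decide

theorem hom_eq_of_formOfHom {M : SqMod.{u}} (hM : M.IsUnstable) {k : ℕ} {v : M.carrier}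
    (hspan : M.deg k ≤ Submodule.span (ZMod 2) {v})
    {f g : SqMod.Hom M (brownGitler k)} (h : (f.toLin v).1 1 = (g.toLin v).1 1) : f = g := by
  refine (representable hM k).1 (LinearMap.ext fun x => ?_)
  obtain ⟨c, hc⟩ := Submodule.mem_span_singleton.1 (hspan x.2)
  change (f.toLin x.1).1 1 = (g.toLin x.1).1 1
  rw [← hc, map_smul, map_smul]
  change c • (f.toLin v).1 1 = c • (g.toLin v).1 1
  rw [h]

theorem apply_one_of_nontrivial {M : SqMod.{u}} (hM : M.IsUnstable) {k : ℕ} {v : M.carrier}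
    (hspan : M.deg k ≤ Submodule.span (ZMod 2) {v})
    {f : SqMod.Hom M (brownGitler k)} (hf : f.Nontrivial) : (f.toLin v).1 1 = 1 := by
  refine eq_one_of_ne_zero fun h => hf ?_
  have : f = ⟨0, fun d x _ => zero_mem _, fun i x => by simp⟩ :=
    hom_eq_of_formOfHom hM hspan h
  rw [this]

/-- If the part of degree `k` of `M` is a line, there is exactly one nonzero morphism
`M → J(k)`. -/
theorem existsUnique_nontrivial {M : SqMod.{u}} (hM : M.IsUnstable) {k : ℕ} {v : M.carrier}
    (hv : v ∈ M.deg k) (h0 : v ≠ 0) (hspan : M.deg k ≤ Submodule.span (ZMod 2) {v}) :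
    ∃! f : SqMod.Hom M (brownGitler k), f.Nontrivial := by
  obtain ⟨l, hl⟩ : ∃ l : Module.Dual (ZMod 2) (M.deg k), l ⟨v, hv⟩ ≠ 0 := by
    by_contra! h
    exact h0 (congrArg Subtype.val ((Module.forall_dual_apply_eq_zero_iff (ZMod 2) _).1 h))
  obtain ⟨f, hf⟩ := (representable hM k).2 l
  have hfv : (f.toLin v).1 1 = l ⟨v, hv⟩ := LinearMap.congr_fun hf ⟨v, hv⟩
  refine ⟨f, fun h => hl ?_, fun g hg => ?_⟩
  · rw [← hfv, h]
    rfl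
  · refine hom_eq_of_formOfHom hM hspan ?_
    rw [apply_one_of_nontrivial hM hspan hg, hfv, eq_one_of_ne_zero hl]

theorem Sq_zero : Sq 0 = 1 := by
  rw [Sq, RingQuot.mkAlgHom_rel (ZMod 2) AdemRel.sq_zero, map_one]

/-- A linear form on the Steenrod algebra is determined by its values on the products of
Steenrod squares. -/
theorem dual_ext {φ ψ : Module.Dual (ZMod 2) SteenrodAlgebra}
    (h : ∀ l : List ℕ, φ (l.map Sq).prod = ψ (l.map Sq).prod) : φ = ψ := by
  refine LinearMap.ext fun a => ?_
  have ha : a ∈ ⨆ e, SteenrodAlgebra.deg e := by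
    rw [iSup_deg]
    trivial
  have hle : (⨆ e, SteenrodAlgebra.deg e) ≤ LinearMap.eqLocus φ ψ := by
    refine iSup_le fun e => Submodule.span_le.2 ?_
    rintro _ ⟨l, -, rfl⟩
    exact h l
  exact hle ha

theorem prod_eq_one_of_sum_eq_zero {l : List ℕ} (h : l.sum = 0) : (l.map Sq).prod = 1 := by
  refine List.prod_eq_one fun x hx => ?_
  obtain ⟨i, hi, rfl⟩ := List.mem_map.1 hx
  rw [List.sum_eq_zero_iff.1 h i hi, Sq_zero]

theorem eq_zero_of_mem_deg {k d : ℕ} (h : k < d) {x : (brownGitler k).carrier}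
    (hx : x ∈ (brownGitler k).deg d) : x = 0 :=
  Subtype.ext (dual_ext fun l => hx.1 l.sum (by omega) _ (prod_mem_deg l))

theorem apply_one_of_mem_deg {k d : ℕ} (h : d ≠ k) {x : (brownGitler k).carrier}
    (hx : x ∈ (brownGitler k).deg d) : x.1 1 = 0 :=
  hx.1 0 (by omega) _ (prod_mem_deg [])

theorem top_eq_smul {k : ℕ} {t x : (brownGitler k).carrier} (ht : t ∈ (brownGitler k).deg k)
    (h1 : t.1 1 = 1) (hx : x ∈ (brownGitler k).deg k) : x = x.1 1 • t := by
  refine Subtype.ext (dual_ext fun l => ?_)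
  change _ = x.1 1 • t.1 _
  rcases Nat.eq_zero_or_pos l.sum with h | h
  · rw [prod_eq_one_of_sum_eq_zero h, h1, smul_eq_mul, mul_one]
  · refine (hx.1 l.sum (by omega) _ (prod_mem_deg l)).trans (Eq.symm ?_)
    exact (congrArg _ (ht.1 l.sum (by omega) _ (prod_mem_deg l))).trans (smul_zero _)

end BrownGitler

namespace SqMod

/-- Operators intertwined by a linear map. -/
theorem map_lift {V W : Type*} [AddCommGroup V] [Module (ZMod 2) V] [AddCommGroup W]
    [Module (ZMod 2) W] {S : ℕ → Module.End (ZMod 2) V} {T : ℕ → Module.End (ZMod 2) W}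
    (φ : V →ₗ[ZMod 2] W) (h : ∀ i v, φ (S i v) = T i (φ v)) (θ : FreeAlgebra (ZMod 2) ℕ) (v : V) :
    φ (FreeAlgebra.lift (ZMod 2) S θ v) = FreeAlgebra.lift (ZMod 2) T θ (φ v) := by
  induction θ using FreeAlgebra.induction generalizing v with
  | grade0 r => simp
  | grade1 i => simp [h]
  | mul x y hx hy => simp [hx, hy]
  | add x y hx hy => simp [hx, hy]

theorem lift_mem {V : Type*} [AddCommGroup V] [Module (ZMod 2) V]
    {S : ℕ → Module.End (ZMod 2) V} {W : Submodule (ZMod 2) V} (h : ∀ i, ∀ v ∈ W, S i v ∈ W)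
    (θ : FreeAlgebra (ZMod 2) ℕ) {v : V} (hv : v ∈ W) : FreeAlgebra.lift (ZMod 2) S θ v ∈ W := by
  induction θ using FreeAlgebra.induction generalizing v with
  | grade0 r => simpa using W.smul_mem r hv
  | grade1 i => simpa using h i v hv
  | mul x y hx hy => simpa using hx (hy hv)
  | add x y hx hy => simpa using W.add_mem (hx hv) (hy hv)

end SqMod

/-! ### The morphism `g` -/

namespace Steinberg

open MvPolynomial

/-- The power `x^m` in `L₁`, for `m > 0`. -/
noncomputable def power (m : ℕ) : L 1 :=
  if h : 0 < m then ⟨X 0 ^ m, mem_L_one.2 (by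
    rw [X_pow_eq_monomial, coeff_monomial, if_neg]
    rw [Finsupp.single_eq_zero]
    exact h.ne')⟩ else 0

theorem coe_power {m : ℕ} (h : 0 < m) : (power m).1 = X 0 ^ m := by
  rw [power, dif_pos h]

theorem power_mem (m : ℕ) : power m ∈ (steinbergL 1).deg m := by
  change (power m).1.IsHomogeneous m
  rcases Nat.eq_zero_or_pos m with rfl | h
  · exact isHomogeneous_zero _ _ _
  · rw [coe_power h]
    exact isHomogeneous_X_pow 0 m

theorem power_ne_zero {m : ℕ} (h : 0 < m) : power m ≠ 0 := by
  intro h0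
  have := congrArg Subtype.val h0
  rw [coe_power h] at this
  exact pow_ne_zero _ (X_ne_zero _) this

theorem mem_span_power (x : L 1) :
    x = ∑ s ∈ x.1.support, x.1.coeff s • power (s 0) := by
  refine Subtype.ext ?_
  rw [AddSubmonoidClass.coe_finsetSum]
  conv_lhs => rw [x.1.as_sum]
  refine Finset.sum_congr rfl fun s hs => ?_
  have h : 0 < s 0 := by
    rw [Nat.pos_iff_ne_zero]
    intro h0
    have : s = 0 := Finsupp.ext fun i => by rw [Subsingleton.elim i 0, h0]; rfl
    rw [this, mem_support_iff] at hs
    exact hs (mem_L_one.1 x.2)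
  rw [Submodule.coe_smul, coe_power h, X_pow_eq_monomial, smul_monomial, smul_eq_mul, mul_one]
  congr 1
  have : s = Finsupp.single 0 (s 0) := Finsupp.ext fun i => by
    rw [Subsingleton.elim i 0, Finsupp.single_eq_same]
  rw [← this]

theorem span_power : Submodule.span (ZMod 2)
    (Set.range fun m : {m : ℕ // 0 < m} => (power m.1 : (steinbergL 1).carrier)) = ⊤ := by
  rw [eq_top_iff]
  intro x _
  rw [mem_span_power x]
  refine Submodule.sum_mem _ fun s hs => Submodule.smul_mem _ _ ?_
  rcases Nat.eq_zero_or_pos (s 0) with h | h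
  · rw [h, power, dif_neg (lt_irrefl _)]
    exact zero_mem _
  · exact Submodule.subset_span ⟨⟨_, h⟩, rfl⟩

theorem deg_le_span_power (k : ℕ) :
    (steinbergL 1).deg k ≤ Submodule.span (ZMod 2) {power k} := by
  have key : ∀ x : L 1, x.1.IsHomogeneous k → x ∈ Submodule.span (ZMod 2) {power k} := by
    intro x hx
    rw [mem_span_power x]
    refine Submodule.sum_mem _ fun s hs => Submodule.smul_mem _ _ ?_
    have h1 : s.degree = k := by
      rw [← hx (mem_support_iff.1 hs), Finsupp.degree_eq_weight_one]
      rfl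
    rw [Finsupp.degree_eq_sum] at h1
    simp only [Finset.univ_unique, Fin.default_eq_zero, Fin.isValue, Finset.sum_singleton] at h1
    rw [h1]
    exact Submodule.mem_span_singleton_self _
  exact fun x hx => key x hx

theorem totalSq_rename {m n : ℕ} (e : Fin m → Fin n) (f : MvPolynomial (Fin m) (ZMod 2)) :
    totalSq n (rename e f) = Polynomial.mapAlgHom (rename e) (totalSq m f) := by
  have h : (totalSq n).comp (rename e) = (Polynomial.mapAlgHom (rename e)).comp (totalSq m) := by
    refine MvPolynomial.algHom_ext fun i => ?_
    rw [AlgHom.comp_apply, AlgHom.comp_apply, rename_X, totalSq_X, totalSq_X]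
    simp
  exact DFunLike.congr_fun h f

theorem sq_rename {m n : ℕ} (e : Fin m → Fin n) (k : ℕ) (f : MvPolynomial (Fin m) (ZMod 2)) :
    sq n k (rename e f) = rename e (sq m k f) := by
  simp [sq_eq_coeff, totalSq_rename]

theorem coeff_prod_fin {R : Type*} [CommSemiring R] {n : ℕ} (F : Fin n → Polynomial R) (k : ℕ) :
    (∏ i, F i).coeff k =
      ∑ a ∈ Finset.Nat.antidiagonalTuple n k, ∏ i, (F i).coeff (a i) := by
  induction n generalizing k with
  | zero => rcases k with _ | k <;> simp [Polynomial.coeff_one]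
  | succ n ih =>
    rw [Fin.prod_univ_succ, Polynomial.coeff_mul, BullettMacdonald.sum_antidiagonalTuple_succ]
    refine Finset.sum_congr rfl fun p _ => ?_
    rw [ih, Finset.mul_sum]
    refine Finset.sum_congr rfl fun a _ => ?_
    simp [Fin.prod_univ_succ]

theorem sq_prod {n m : ℕ} (f : Fin m → MvPolynomial (Fin n) (ZMod 2)) (k : ℕ) :
    sq n k (∏ i, f i) = ∑ a ∈ Finset.Nat.antidiagonalTuple m k, ∏ i, sq n (a i) (f i) := by
  simp only [sq_eq_coeff, map_prod, coeff_prod_fin]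

end Steinberg

namespace L₁Pow

open MvPolynomial Steinberg BrownGitler
open scoped TensorProduct

variable {n : ℕ}

theorem toPoly_tprod (f : Fin n → L 1) :
    toPoly n (PiTensorProduct.tprod (ZMod 2) f) = ∏ i, rename (fun _ : Fin 1 => i) (f i).1 := by
  exact PiTensorProduct.lift.tprod _

theorem toPoly_sq (k : ℕ) (z : (L₁Pow n).carrier) :
    toPoly n ((L₁Pow n).sq k z) = sq n k (toPoly n z) := by
  have h : toPoly n ∘ₗ SqMod.tensorSq (fun _ : Fin n => steinbergL 1) k = sq n k ∘ₗ toPoly n := by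
    refine PiTensorProduct.ext (MultilinearMap.ext fun f => ?_)
    change toPoly n (SqMod.tensorSq _ k (PiTensorProduct.tprod (ZMod 2) f)) =
      sq n k (toPoly n (PiTensorProduct.tprod (ZMod 2) f))
    refine Eq.trans ?_ ((congrArg (sq n k) (toPoly_tprod f)).trans (sq_prod _ _)).symm
    rw [SqMod.tensorSq, LinearMap.sum_apply]
    refine (map_sum (toPoly n) _ _).trans (Finset.sum_congr rfl fun a _ => ?_)
    rw [PiTensorProduct.map_tprod]
    refine (toPoly_tprod _).trans ?_
    exact Finset.prod_congr rfl fun i _ => (sq_rename _ _ _).symm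
  exact LinearMap.congr_fun h z

/-- The tensor `x^{a_0} ⊗ ⋯ ⊗ x^{a_{n-1}}`, for positive exponents. -/
noncomputable def gen (a : Fin n → ℕ) : (L₁Pow n).carrier :=
  PiTensorProduct.tprod (ZMod 2) fun i => (power (a i) : (steinbergL 1).carrier)

theorem gen_mem (a : Fin n → ℕ) : gen a ∈ (L₁Pow n).deg (∑ i, a i) :=
  SqMod.tprod_mem_tensorDeg fun i => power_mem (a i)

theorem toPoly_gen {a : Fin n → ℕ} (ha : ∀ i, 0 < a i) : toPoly n (gen a) = ∏ i, X i ^ a i := by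
  rw [gen, toPoly_tprod]
  refine Finset.prod_congr rfl fun i _ => ?_
  rw [coe_power (ha i), map_pow, rename_X]

theorem span_gen : Submodule.span (ZMod 2)
    (Set.range fun a : Fin n → {m : ℕ // 0 < m} => gen fun i => (a i).1) = ⊤ :=
  PiTensorProduct.submodule_span_eq_top
    (g := fun _ (m : {m : ℕ // 0 < m}) => (power m.1 : (steinbergL 1).carrier))
    fun _ => span_power

/-- The coefficient of `x_0^{2^{n-1}} x_1^{2^{n-2}} ⋯ x_{n-1}`. -/
noncomputable def topCoeff (n : ℕ) : MvPolynomial (Fin n) (ZMod 2) →ₗ[ZMod 2] ZMod 2 :=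
  lcoeff (ZMod 2) (Finsupp.equivFunOnFinite.symm fun i : Fin n => 2 ^ (n - 1 - i.1))

theorem coeff_prod_X_pow (s : Fin n →₀ ℕ) (a : Fin n → ℕ) :
    coeff s (∏ i, X i ^ a i : MvPolynomial (Fin n) (ZMod 2)) = if ⇑s = a then 1 else 0 := by
  have : (∏ i, X i ^ a i : MvPolynomial (Fin n) (ZMod 2)) =
      monomial (Finsupp.equivFunOnFinite.symm a) 1 := by
    rw [monomial_eq, C_1, one_mul, Finsupp.prod_fintype _ _ fun i => pow_zero _]
    rfl
  rw [this, coeff_monomial]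
  congr 1
  rw [eq_iff_iff, ← DFunLike.coe_fn_eq, eq_comm]
  rfl

theorem topCoeff_prod (a : Fin n → ℕ) : topCoeff n (∏ i, X i ^ a i) =
    if (fun i : Fin n => 2 ^ (n - 1 - i.1)) = a then 1 else 0 :=
  coeff_prod_X_pow _ a

theorem sum_two_pow (n : ℕ) : ∑ i : Fin n, 2 ^ (n - 1 - i.1) = 2 ^ n - 1 := by
  rw [Fin.sum_univ_eq_sum_range (fun i => 2 ^ (n - 1 - i)) n, Finset.sum_range_reflect]
  exact Nat.geomSum_eq (le_refl 2) n |>.trans (by simp)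

variable (π : ∀ s : ℕ, SqMod.Hom (steinbergL 1) (brownGitler (2 ^ s)))

theorem π_power (hπ : ∀ s, (π s).Nontrivial) (s : ℕ) :
    ((π s).toLin (power (2 ^ s))).1 1 = 1 :=
  apply_one_of_nontrivial isUnstable_L_one (deg_le_span_power _) (hπ s)

/-- The tensor of the top classes of the modules `J(2^{n-1-i})`. -/
noncomputable def topTensor (n : ℕ) :
    (SqMod.tensor fun i : Fin n => brownGitler (2 ^ (n - 1 - i.1))).carrier :=
  PiTensorProduct.tprod (ZMod 2) fun i => (π (n - 1 - i.1)).toLin (power (2 ^ (n - 1 - i.1)))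

theorem topTensor_mem (n : ℕ) : topTensor π n ∈
    (SqMod.tensor fun i : Fin n => brownGitler (2 ^ (n - 1 - i.1))).deg (2 ^ n - 1) := by
  rw [← sum_two_pow]
  exact SqMod.tprod_mem_tensorDeg fun i => (π _).map_deg _ _ (power_mem _)

theorem topTensor_ne_zero (hπ : ∀ s, (π s).Nontrivial) (n : ℕ) : topTensor π n ≠ 0 := by
  intro h
  have := congrArg (PiTensorProduct.lift ((MultilinearMap.mkPiAlgebra (ZMod 2) (Fin n)
    (ZMod 2)).compLinearMap fun i => LinearMap.applyₗ (1 : SteenrodAlgebra) ∘ₗ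
      (BrownGitler.space (2 ^ (n - 1 - i.1))).subtype)) h
  refine one_ne_zero (α := ZMod 2) (Eq.trans ?_ (this.trans (map_zero _)))
  refine Eq.trans ?_ (PiTensorProduct.lift.tprod _).symm
  change 1 = ∏ i : Fin n, ((π (n - 1 - i.1)).toLin (power (2 ^ (n - 1 - i.1)))).1 1
  exact (Finset.prod_eq_one fun i _ => π_power π hπ _).symm

/-- A tensor of degree `2^n - 1` has a factor above the top degree, which is zero, or all its factors
in the top degrees, which are lines. -/
theorem deg_le_span_topTensor (hπ : ∀ s, (π s).Nontrivial) (n : ℕ) :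
    (SqMod.tensor fun i : Fin n => brownGitler (2 ^ (n - 1 - i.1))).deg (2 ^ n - 1) ≤
      Submodule.span (ZMod 2) {topTensor π n} := by
  refine Submodule.span_le.2 ?_
  rintro _ ⟨a, m, ha, hm, rfl⟩
  by_cases h : ∃ i : Fin n, 2 ^ (n - 1 - i.1) < a i
  · obtain ⟨i, hi⟩ := h
    rw [(PiTensorProduct.tprod (ZMod 2)).map_coord_zero i (eq_zero_of_mem_deg hi (hm i))]
    exact zero_mem _
  · push Not at h
    have h1 : ∀ i, a i = 2 ^ (n - 1 - i.1) := by
      have := (Finset.sum_eq_sum_iff_of_le fun i _ => h i).1 (ha.trans (sum_two_pow n).symm)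
      exact fun i => this i (Finset.mem_univ i)
    have h2 : m = fun i => (m i).1 1 • (π (n - 1 - i.1)).toLin (power (2 ^ (n - 1 - i.1))) :=
      _root_.funext fun i => top_eq_smul ((π _).map_deg _ _ (power_mem _)) (π_power π hπ _) (by
        have := hm i
        rw [h1 i] at this
        exact this)
    rw [h2, MultilinearMap.map_smul_univ]
    exact Submodule.smul_mem (Submodule.span (ZMod 2) {topTensor π n}) _
      (Submodule.subset_span rfl)

theorem isUnstable_tensor_brownGitler (n : ℕ) :
    (SqMod.tensor fun i : Fin n => brownGitler (2 ^ (n - 1 - i.1))).IsUnstable :=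
  SqMod.isUnstable_tensor fun _ => BrownGitler.isUnstable _

variable {π} {μ : SqMod.Hom (SqMod.tensor fun i : Fin n => brownGitler (2 ^ (n - 1 - i.1)))
    (brownGitler (2 ^ n - 1))}

theorem gMap_gen_apply_one (hπ : ∀ s, (π s).Nontrivial) (hμ : μ.Nontrivial) (a : Fin n → ℕ) :
    ((gMap n π μ).toLin (gen a)).1 1 =
      if (fun i : Fin n => 2 ^ (n - 1 - i.1)) = a then 1 else 0 := by
  split_ifs with h
  · have : (gMap n π μ).toLin (gen a) = μ.toLin (topTensor π n) := by
      subst h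
      exact congrArg μ.toLin (PiTensorProduct.map_tprod _ _)
    rw [this]
    exact apply_one_of_nontrivial (isUnstable_tensor_brownGitler n)
      (deg_le_span_topTensor π hπ n) hμ
  by_cases hs : ∑ i, a i = 2 ^ n - 1
  · obtain ⟨i, hi⟩ : ∃ i : Fin n, 2 ^ (n - 1 - i.1) < a i := by
      by_contra! h'
      have := (Finset.sum_eq_sum_iff_of_le fun i _ => h' i).1 (hs.trans (sum_two_pow n).symm)
      exact h (_root_.funext fun i => (this i (Finset.mem_univ i)).symm)
    have : (gMap n π μ).toLin (gen a) = 0 := by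
      refine (congrArg μ.toLin (PiTensorProduct.map_tprod _ _)).trans ?_
      rw [(PiTensorProduct.tprod (ZMod 2)).map_coord_zero i
        (eq_zero_of_mem_deg hi ((π _).map_deg _ _ (power_mem _)))]
      exact map_zero μ.toLin
    rw [this]
    rfl
  · exact apply_one_of_mem_deg hs ((gMap n π μ).map_deg _ _ (gen_mem a))

/-- The linear form corresponding to `g` is the coefficient of
`x_0^{2^{n-1}} x_1^{2^{n-2}} ⋯ x_{n-1}`. -/
theorem gMap_apply_one (hπ : ∀ s, (π s).Nontrivial) (hμ : μ.Nontrivial) (z : (L₁Pow n).carrier) :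
    ((gMap n π μ).toLin z).1 1 = topCoeff n (toPoly n z) := by
  have h : LinearMap.applyₗ (1 : SteenrodAlgebra) ∘ₗ (BrownGitler.space (2 ^ n - 1)).subtype ∘ₗ
      (gMap n π μ).toLin = topCoeff n ∘ₗ toPoly n := by
    refine PiTensorProduct.ext_of_span_eq_top
      (g := fun _ (m : {m : ℕ // 0 < m}) => (power m.1 : (steinbergL 1).carrier))
      (fun _ => span_power) fun a => ?_
    change ((gMap n π μ).toLin (gen fun i => (a i).1)).1 1 =
      topCoeff n (toPoly n (gen fun i => (a i).1))
    rw [gMap_gen_apply_one hπ hμ, toPoly_gen fun i => (a i).2, topCoeff_prod]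
  exact LinearMap.congr_fun h z

/-- The value of `g(z)` on an operation `θ` is the top coefficient of `θ z`. -/
theorem gMap_apply (hπ : ∀ s, (π s).Nontrivial) (hμ : μ.Nontrivial) (z : (L₁Pow n).carrier)
    (θ : FreeAlgebra (ZMod 2) ℕ) :
    ((gMap n π μ).toLin z).1 (RingQuot.mkAlgHom (ZMod 2) AdemRel θ) =
      topCoeff n (FreeAlgebra.lift (ZMod 2) (A := Module.End (ZMod 2)
        (MvPolynomial (Fin n) (ZMod 2))) (sq n) θ (toPoly n z)) := by
  have h := toLin_action (L₁Pow.isUnstable n) (gMap n π μ) z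
    (RingQuot.mkAlgHom (ZMod 2) AdemRel θ) 1
  rw [one_mul] at h
  rw [← h, gMap_apply_one hπ hμ]
  have h2 : action (L₁Pow.isUnstable n) (RingQuot.mkAlgHom (ZMod 2) AdemRel θ) =
      FreeAlgebra.lift (ZMod 2) (A := Module.End (ZMod 2) (L₁Pow n).carrier) (L₁Pow n).sq θ := by
    simp [action]
  rw [h2, SqMod.map_lift (toPoly n) toPoly_sq]

/-- A criterion for the kernel of `g`: a subspace that is closed under the Steenrod squares and on
which the top coefficient vanishes. -/
theorem gMap_eq_zero (hπ : ∀ s, (π s).Nontrivial) (hμ : μ.Nontrivial) {z : (L₁Pow n).carrier}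
    {W : Submodule (ZMod 2) (MvPolynomial (Fin n) (ZMod 2))} (hW : ∀ k, ∀ f ∈ W, sq n k f ∈ W)
    (hW' : ∀ f ∈ W, topCoeff n f = 0) (hz : toPoly n z ∈ W) : (gMap n π μ).toLin z = 0 := by
  refine Subtype.ext (LinearMap.ext fun b => ?_)
  obtain ⟨θ, rfl⟩ := RingQuot.mkAlgHom_surjective (ZMod 2) AdemRel b
  rw [gMap_apply hπ hμ]
  exact hW' _ (SqMod.lift_mem hW θ hz)

end L₁Pow

/-! ### Detection of polynomials by linear substitutions -/

namespace Detection

open MvPolynomial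

variable {N : ℕ}

/-- The linear form with coefficients `w`. -/
noncomputable def linForm (w : Fin N → ZMod 2) : MvPolynomial (Fin N) (ZMod 2) :=
  ∑ i, C (w i) * X i

theorem linForm_isHomogeneous (w : Fin N → ZMod 2) : (linForm w).IsHomogeneous 1 :=
  IsHomogeneous.sum _ _ _ fun _ _ => isHomogeneous_C_mul_X _ _

theorem coeff_linForm (w : Fin N → ZMod 2) (i : Fin N) :
    coeff (Finsupp.single i 1) (linForm w) = w i := by
  rw [linForm, coeff_sum, Finset.sum_eq_single i]
  · simp
  · intro j _ hj
    rw [coeff_C_mul, coeff_X, if_neg, mul_zero]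
    intro h
    exact hj (Finsupp.single_left_injective one_ne_zero h)
  · simp

theorem linForm_injective : Function.Injective (linForm (N := N)) := by
  intro w w' h
  funext i
  rw [← coeff_linForm w, h, coeff_linForm]

theorem map_linForm {A : Type*} [CommSemiring A] [Algebra (ZMod 2) A]
    (φ : MvPolynomial (Fin N) (ZMod 2) →ₐ[ZMod 2] A) (w : Fin N → ZMod 2) :
    φ (linForm w) = ∑ i, algebraMap _ _ (w i) * φ (X i) := by
  rw [linForm, map_sum]
  refine Finset.sum_congr rfl fun i _ => ?_
  rw [map_mul]
  congr 1
  exact φ.commutes _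

/-- The restriction `h ↦ h(x + y v)` of a polynomial to lines with direction `v`, as a polynomial
in `y`. -/
noncomputable def lineSub (v : Fin N → ZMod 2) : MvPolynomial (Fin N) (ZMod 2) →ₐ[ZMod 2]
    Polynomial (MvPolynomial (Fin N) (ZMod 2)) :=
  ((finSuccEquiv (ZMod 2) N).toAlgHom).comp (aeval fun i => X i.succ + C (v i) * X 0)

theorem lineSub_X (v : Fin N → ZMod 2) (i : Fin N) : lineSub v (X i) =
    Polynomial.C (X i) + Polynomial.C (C (v i)) * Polynomial.X := by
  have hC : ∀ c : ZMod 2, finSuccEquiv (ZMod 2) N (C c) = Polynomial.C (C c) := fun c =>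
    (finSuccEquiv (ZMod 2) N).commutes c
  change finSuccEquiv (ZMod 2) N (aeval _ (X i)) = _
  rw [aeval_X, map_add, map_mul, finSuccEquiv_X_succ, finSuccEquiv_X_zero, hC]

theorem isHomogeneous_coeff_lineSub {d : ℕ} {h : MvPolynomial (Fin N) (ZMod 2)}
    (hh : h.IsHomogeneous d) (v : Fin N → ZMod 2) {i j : ℕ} (hij : i + j = d) :
    ((lineSub v h).coeff i).IsHomogeneous j := by
  refine IsHomogeneous.finSuccEquiv_coeff_isHomogeneous (n := d) ?_ i j hij
  have := hh.aeval (n := 1) (fun i : Fin N => (X i.succ + C (v i) * X 0 :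
    MvPolynomial (Fin (N + 1)) (ZMod 2)))
    fun i => (isHomogeneous_X _ _).add (isHomogeneous_C_mul_X _ _)
  rwa [one_mul] at this

theorem natDegree_lineSub_le {d : ℕ} {h : MvPolynomial (Fin N) (ZMod 2)}
    (hh : h.IsHomogeneous d) (v : Fin N → ZMod 2) : (lineSub v h).natDegree ≤ d := by
  have := hh.aeval (n := 1) (fun i : Fin N => (X i.succ + C (v i) * X 0 :
    MvPolynomial (Fin (N + 1)) (ZMod 2)))
    fun i => (isHomogeneous_X _ _).add (isHomogeneous_C_mul_X _ _)
  rw [one_mul] at this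
  exact (natDegree_finSuccEquiv _).trans_le ((degreeOf_le_totalDegree _ _).trans
    this.totalDegree_le)

theorem coeff_zero_lineSub (v : Fin N → ZMod 2) (h : MvPolynomial (Fin N) (ZMod 2)) :
    (lineSub v h).coeff 0 = h := by
  have : ((Polynomial.aeval (0 : MvPolynomial (Fin N) (ZMod 2))).restrictScalars (ZMod 2)).comp
      (lineSub v) = AlgHom.id _ _ := by
    refine MvPolynomial.algHom_ext fun i => ?_
    rw [AlgHom.comp_apply, lineSub_X]
    simp
  rw [Polynomial.coeff_zero_eq_aeval_zero]
  exact DFunLike.congr_fun this h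

theorem lineSub_ne_zero {h : MvPolynomial (Fin N) (ZMod 2)} (hh : h ≠ 0) (v : Fin N → ZMod 2) :
    lineSub v h ≠ 0 := by
  intro h0
  rw [← coeff_zero_lineSub v h, h0, Polynomial.coeff_zero] at hh
  exact hh rfl

/-- The restriction to the hyperplane `x_0 = w(x_1, …, x_N)`. -/
noncomputable def restrict (w : Fin N → ZMod 2) : MvPolynomial (Fin (N + 1)) (ZMod 2) →ₐ[ZMod 2]
    MvPolynomial (Fin N) (ZMod 2) :=
  aeval (Fin.cons (linForm w) X)

theorem isHomogeneous_restrict {d : ℕ} {h : MvPolynomial (Fin (N + 1)) (ZMod 2)}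
    (hh : h.IsHomogeneous d) (w : Fin N → ZMod 2) : (restrict w h).IsHomogeneous d := by
  have := hh.aeval (n := 1) (Fin.cons (linForm w) X : Fin (N + 1) → MvPolynomial (Fin N) (ZMod 2))
    (Fin.cases (linForm_isHomogeneous w) fun i => isHomogeneous_X _ _)
  rwa [one_mul] at this

theorem restrict_eq_eval (w : Fin N → ZMod 2) (h : MvPolynomial (Fin (N + 1)) (ZMod 2)) :
    restrict w h = (finSuccEquiv (ZMod 2) N h).eval (linForm w) := by
  have : restrict w = ((Polynomial.aeval (linForm w)).restrictScalars (ZMod 2)).comp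
      (finSuccEquiv (ZMod 2) N).toAlgHom := by
    refine MvPolynomial.algHom_ext fun i => ?_
    change aeval _ (X i) = Polynomial.aeval _ (finSuccEquiv (ZMod 2) N (X i))
    refine Fin.cases ?_ (fun i => ?_) i
    · rw [finSuccEquiv_X_zero]; simp
    · rw [finSuccEquiv_X_succ]; simp
  rw [this]
  exact Polynomial.coe_aeval_eq_eval (linForm w) ▸ rfl

/-- Lines in the hyperplane `x_0 = w(x_1, …, x_N)`. -/
theorem lineSub_restrict (w v : Fin N → ZMod 2) (h : MvPolynomial (Fin (N + 1)) (ZMod 2)) :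
    lineSub v (restrict w h) =
      Polynomial.mapAlgHom (restrict w) (lineSub (Fin.cons (∑ i, w i * v i) v) h) := by
  have : (lineSub v).comp (restrict w) = (Polynomial.mapAlgHom (restrict w)).comp
      (lineSub (Fin.cons (∑ i, w i * v i) v)) := by
    refine MvPolynomial.algHom_ext fun i => ?_
    have hC : ∀ c : ZMod 2, restrict w (C c) = C c := fun c => (restrict w).commutes c
    have hX : ∀ i, restrict w (X i) = (Fin.cons (linForm w) X :
        Fin (N + 1) → MvPolynomial (Fin N) (ZMod 2)) i := fun i => aeval_X _ _
    rw [AlgHom.comp_apply, AlgHom.comp_apply, lineSub_X]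
    simp only [map_add, map_mul, Polynomial.coe_mapAlgHom, Polynomial.map_C, Polynomial.map_X,
      RingHom.coe_coe, hC, hX]
    refine Fin.cases ?_ (fun i => ?_) i
    · rw [Fin.cons_zero, Fin.cons_zero, map_linForm]
      simp only [lineSub_X, mul_add, Finset.sum_add_distrib, linForm, map_sum, map_mul,
        Finset.sum_mul, mul_assoc]
      rfl
    · rw [Fin.cons_succ, Fin.cons_succ, lineSub_X]
  exact DFunLike.congr_fun this h

/-- The product of all the linear forms `x_0 + w(x_1, …, x_N)`. -/
noncomputable def hyperplanes (N : ℕ) : MvPolynomial (Fin (N + 1)) (ZMod 2) :=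
  ∏ w : Fin N → ZMod 2, linForm (Fin.cons 1 w)

theorem isHomogeneous_hyperplanes (N : ℕ) : (hyperplanes N).IsHomogeneous (2 ^ N) := by
  have := IsHomogeneous.prod (Finset.univ : Finset (Fin N → ZMod 2))
    (fun w => linForm (Fin.cons (1 : ZMod 2) w)) (fun _ => 1) fun w _ => linForm_isHomogeneous _
  rw [hyperplanes]
  simpa using this

theorem finSuccEquiv_linForm (c : ZMod 2) (w : Fin N → ZMod 2) :
    finSuccEquiv (ZMod 2) N (linForm (Fin.cons c w)) =
      Polynomial.C (C c) * Polynomial.X + Polynomial.C (linForm w) := by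
  have hC : ∀ c : ZMod 2, finSuccEquiv (ZMod 2) N (C c) = Polynomial.C (C c) := fun c =>
    (finSuccEquiv (ZMod 2) N).commutes c
  rw [linForm, Fin.sum_univ_succ]
  simp [hC, finSuccEquiv_X_zero, finSuccEquiv_X_succ, linForm]

/-- A polynomial that vanishes on all hyperplanes `x_0 = w(x_1, …, x_N)` is divisible by the
product of their equations. -/
theorem hyperplanes_dvd {h : MvPolynomial (Fin (N + 1)) (ZMod 2)} (hh : ∀ w, restrict w h = 0) :
    hyperplanes N ∣ h := by
  rcases eq_or_ne h 0 with rfl | h0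
  · exact dvd_zero _
  rw [← map_dvd_iff (finSuccEquiv (ZMod 2) N)]
  have hp : finSuccEquiv (ZMod 2) N h ≠ 0 := by
    rwa [Ne, EmbeddingLike.map_eq_zero_iff]
  have := (Multiset.prod_X_sub_C_dvd_iff_le_roots hp
    ((Finset.univ : Finset (Fin N → ZMod 2)).val.map linForm)).2 (by
      rw [Multiset.le_iff_subset (Multiset.Nodup.map linForm_injective Finset.univ.nodup)]
      intro a ha
      obtain ⟨w, -, rfl⟩ := Multiset.mem_map.1 ha
      rw [Polynomial.mem_roots hp, Polynomial.IsRoot, ← restrict_eq_eval]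
      exact hh w)
  rw [Multiset.map_map] at this
  convert this using 1
  rw [hyperplanes, map_prod]
  refine Finset.prod_congr rfl fun w _ => ?_
  rw [finSuccEquiv_linForm, Function.comp_apply, CharTwo.sub_eq_add, C_1, Polynomial.C_1, one_mul]

theorem lineSub_linForm (v w : Fin N → ZMod 2) : lineSub v (linForm w) =
    Polynomial.C (linForm w) + Polynomial.C (C (∑ i, w i * v i)) * Polynomial.X := by
  rw [map_linForm]
  simp only [lineSub_X, mul_add, Finset.sum_add_distrib, linForm, map_sum, map_mul,
    Finset.sum_mul, mul_assoc]
  rfl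

/-- A nonzero vector is off at least half of the hyperplanes. -/
theorem le_card_filter {v : Fin (N + 1) → ZMod 2} (hv : v ≠ 0) : 2 ^ N ≤
    2 * (Finset.univ.filter fun w : Fin N → ZMod 2 => v 0 + ∑ i, w i * v i.succ = 1).card := by
  have hcard : (Finset.univ : Finset (Fin N → ZMod 2)).card = 2 ^ N := by simp
  have h01 : ∀ c : ZMod 2, c ≠ 1 ↔ c + 1 = 1 := by decide
  by_cases h : ∃ i : Fin N, v i.succ ≠ 0
  · obtain ⟨i, hi⟩ := h
    have hi1 := BrownGitler.eq_one_of_ne_zero hi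
    rw [← hcard, ← Finset.card_filter_add_card_filter_not
      (fun w : Fin N → ZMod 2 => v 0 + ∑ i, w i * v i.succ = 1), two_mul]
    refine Nat.add_le_add_left (Finset.card_le_card_of_injOn (fun w => w + Pi.single i 1) ?_ ?_) _
    · intro w hw
      simp only [Finset.coe_filter, Finset.mem_univ, true_and, Set.mem_ofPred_eq] at hw ⊢
      rw [← ne_eq, h01] at hw
      refine Eq.trans ?_ hw
      simp only [Pi.add_apply, add_mul, Finset.sum_add_distrib, add_assoc]
      congr 2
      rw [Finset.sum_eq_single i] <;> simp +contextual [hi1]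
    · intro w _ w' _ hww
      exact add_right_cancel hww
  · push Not at h
    have h0 : v 0 = 1 := by
      refine BrownGitler.eq_one_of_ne_zero fun h0 => hv ?_
      funext i
      exact Fin.cases h0 h i
    rw [Finset.filter_true_of_mem fun w _ => by simp [h, h0], hcard]
    omega

theorem le_natDegree_hyperplanes {v : Fin (N + 1) → ZMod 2} (hv : v ≠ 0) :
    2 ^ N ≤ 2 * (lineSub v (hyperplanes N)).natDegree := by
  have hne : ∀ w : Fin N → ZMod 2, linForm (Fin.cons 1 w : Fin (N + 1) → ZMod 2) ≠ 0 := by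
    intro w h
    have := coeff_linForm (Fin.cons 1 w : Fin (N + 1) → ZMod 2) 0
    rw [h, Fin.cons_zero, coeff_zero] at this
    exact zero_ne_one this
  refine (le_card_filter hv).trans (Nat.mul_le_mul_left 2 ?_)
  rw [hyperplanes, map_prod, Polynomial.natDegree_prod _ _ fun w _ => lineSub_ne_zero (hne w) v,
    Finset.card_filter]
  refine Finset.sum_le_sum fun w _ => ?_
  split_ifs with hw
  · rw [lineSub_linForm, Fin.sum_univ_succ]
    simp only [Fin.cons_zero, Fin.cons_succ, one_mul, hw]
    rw [C_1, Polynomial.C_1, one_mul, add_comm (Polynomial.C _), Polynomial.natDegree_X_add_C]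
  · exact Nat.zero_le _

/-- A homogeneous multiple of a homogeneous polynomial is a homogeneous multiple. -/
theorem exists_isHomogeneous_factor {σ R : Type*} [CommRing R] {d e : ℕ} {D h : MvPolynomial σ R}
    (hD : D.IsHomogeneous e) (hh : h.IsHomogeneous d) (hd : D ∣ h) (h0 : h ≠ 0) :
    ∃ (d' : ℕ) (h' : MvPolynomial σ R), d = e + d' ∧ h'.IsHomogeneous d' ∧ h = D * h' := by
  obtain ⟨q, hq⟩ := hd
  have key : h = ∑ i ∈ Finset.range (q.totalDegree + 1),
      if e + i = d then D * homogeneousComponent i q else 0 := by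
    conv_lhs => rw [← if_pos (rfl : d = d) (t := h) (e := 0),
      ← homogeneousComponent_of_mem (m := d) hh, hq,
      ← sum_homogeneousComponent q, Finset.mul_sum, map_sum]
    refine Finset.sum_congr rfl fun i _ => ?_
    rw [homogeneousComponent_of_mem (hD.mul (homogeneousComponent_isHomogeneous i q))]
    simp only [eq_comm]
  by_cases he : e ≤ d
  · refine ⟨d - e, homogeneousComponent (d - e) q, by omega,
      homogeneousComponent_isHomogeneous _ _, ?_⟩
    by_cases hm : d - e ∈ Finset.range (q.totalDegree + 1)
    · rw [Finset.sum_eq_single (d - e)] at key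
      · rwa [if_pos (by omega)] at key
      · intro i _ hi
        rw [if_neg (by omega)]
      · exact fun h => absurd hm h
    · rw [Finset.sum_eq_zero] at key
      · exact absurd key h0
      · intro i hi
        rw [if_neg]
        rintro rfl
        rw [Nat.add_sub_cancel_left] at hm
        exact hm hi
  · rw [Finset.sum_eq_zero fun i _ => if_neg (by omega)] at key
    exact absurd key h0

/-- A nonzero homogeneous polynomial has a direction in which its degree is at least half its
total degree. If it does not vanish on some hyperplane `x_0 = w(x_1, …, x_N)`, there is one in that
hyperplane; otherwise it is a multiple of the product of these hyperplanes, which has at least half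
its degree in every direction. -/
theorem exists_direction {d : ℕ} (hd : 0 < d) {h : MvPolynomial (Fin N) (ZMod 2)}
    (hh : h.IsHomogeneous d) (h0 : h ≠ 0) :
    ∃ v : Fin N → ZMod 2, v ≠ 0 ∧ d ≤ 2 * (lineSub v h).natDegree := by
  induction N generalizing d with
  | zero =>
    refine absurd ?_ h0
    rw [MvPolynomial.eq_C_of_isEmpty h] at hh ⊢
    by_contra hne
    have := hh.totalDegree hne
    rw [totalDegree_C] at this
    omega
  | succ N ihN =>
    induction d using Nat.strong_induction_on generalizing h with
    | _ d ihd =>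
      by_cases hw : ∃ w, restrict w h ≠ 0
      · obtain ⟨w, hw⟩ := hw
        obtain ⟨v, hv, hdeg⟩ := ihN hd (isHomogeneous_restrict hh w) hw
        refine ⟨Fin.cons (∑ i, w i * v i) v, fun hv0 => hv ?_, hdeg.trans ?_⟩
        · funext i
          have := congrFun hv0 i.succ
          rwa [Fin.cons_succ] at this
        · rw [lineSub_restrict]
          exact Nat.mul_le_mul_left 2 Polynomial.natDegree_map_le
      · push Not at hw
        obtain ⟨d', h', hdd, hh', rfl⟩ := exists_isHomogeneous_factor
          (isHomogeneous_hyperplanes N) hh (hyperplanes_dvd hw) h0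
        have hpos : 0 < 2 ^ N := by positivity
        have hne := right_ne_zero_of_mul h0
        have hmul : ∀ v, (lineSub v (hyperplanes N * h')).natDegree =
            (lineSub v (hyperplanes N)).natDegree + (lineSub v h').natDegree := fun v => by
          rw [map_mul, Polynomial.natDegree_mul (lineSub_ne_zero (left_ne_zero_of_mul h0) v)
            (lineSub_ne_zero hne v)]
        obtain ⟨v, hv, hdeg⟩ : ∃ v : Fin (N + 1) → ZMod 2, v ≠ 0 ∧
            d' ≤ 2 * (lineSub v h').natDegree := by
          rcases Nat.eq_zero_or_pos d' with rfl | hd'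
          · exact ⟨Pi.single 0 1, by simp, Nat.zero_le _⟩
          · exact ihd d' (by omega) hd' hh' hne
        refine ⟨v, hv, ?_⟩
        have := le_natDegree_hyperplanes hv
        rw [hmul]
        omega

/-- Restricting twice to lines in the same direction: Taylor's formula. -/
theorem lineSub_coeff_lineSub (v : Fin N → ZMod 2) (h : MvPolynomial (Fin N) (ZMod 2)) (k : ℕ) :
    lineSub v ((lineSub v h).coeff k) = Polynomial.hasseDeriv k (lineSub v h) := by
  have key : (Polynomial.mapAlgHom (lineSub v)).comp (lineSub v) =
      ((Polynomial.taylorAlgHom Polynomial.X).restrictScalars (ZMod 2)).comp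
        ((Polynomial.mapAlgHom (Algebra.ofId (MvPolynomial (Fin N) (ZMod 2))
          (Polynomial (MvPolynomial (Fin N) (ZMod 2))) |>.restrictScalars (ZMod 2))).comp
          (lineSub v)) := by
    refine MvPolynomial.algHom_ext fun i => ?_
    have hC : ∀ c : ZMod 2, lineSub v (C c) = Polynomial.C (C c) := fun c =>
      (lineSub v).commutes c
    simp only [AlgHom.comp_apply, lineSub_X, map_add, map_mul, Polynomial.coe_mapAlgHom,
      Polynomial.map_C, Polynomial.map_X, RingHom.coe_coe, hC, AlgHom.restrictScalars_apply]
    simp [Algebra.ofId_apply]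
    ring
  have h2 := congrArg (fun F => Polynomial.coeff F k) (DFunLike.congr_fun key h)
  simp only [AlgHom.comp_apply, Polynomial.coe_mapAlgHom, Polynomial.coeff_map,
    RingHom.coe_coe, AlgHom.restrictScalars_apply] at h2
  rw [h2]
  change (Polynomial.taylor Polynomial.X ((lineSub v h).map Polynomial.C)).coeff k = _
  rw [Polynomial.taylor_coeff, show Polynomial.hasseDeriv k ((lineSub v h).map Polynomial.C) =
    (Polynomial.hasseDeriv k (lineSub v h)).map Polynomial.C by
      ext1 i; simp [Polynomial.hasseDeriv_coeff], Polynomial.eval_map, Polynomial.eval₂_C_X]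

theorem choose_two_pow {r e : ℕ} (h1 : 2 ^ r ≤ e) (h2 : e < 2 * 2 ^ r) :
    ((e.choose (2 ^ r) : ℕ) : ZMod 2) = 1 := by
  obtain ⟨m, rfl⟩ := Nat.exists_eq_add_of_le h1
  rw [← Polynomial.coeff_one_add_X_pow (ZMod 2) (2 ^ r + m) (2 ^ r), pow_add, add_pow_char_pow,
    one_pow, add_mul, one_mul, Polynomial.coeff_add, Polynomial.coeff_X_pow_mul', if_pos le_rfl,
    Nat.sub_self, Polynomial.coeff_one_add_X_pow, Polynomial.coeff_one_add_X_pow,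
    Nat.choose_eq_zero_of_lt (by omega)]
  simp

/-- If the coefficient of `y^{2^r}` in `h(x + y v)` vanished, so would its restriction to lines in
the direction `v`. By Taylor's formula that restriction contains the leading term of `h(x + y v)`
with an odd binomial coefficient. -/
theorem coeff_lineSub_ne_zero {r : ℕ} {h : MvPolynomial (Fin N) (ZMod 2)} {v : Fin N → ZMod 2}
    (hh : h.IsHomogeneous (2 * 2 ^ r - 1)) (h0 : h ≠ 0)
    (hv : 2 * 2 ^ r - 1 ≤ 2 * (lineSub v h).natDegree) : (lineSub v h).coeff (2 ^ r) ≠ 0 := by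
  intro hc
  have h1 := lineSub_coeff_lineSub v h (2 ^ r)
  have hpos : 0 < 2 ^ r := by positivity
  have hle := natDegree_lineSub_le hh v
  rw [hc, map_zero] at h1
  have h2 := congrArg (fun F => Polynomial.coeff F ((lineSub v h).natDegree - 2 ^ r)) h1.symm
  simp only [Polynomial.hasseDeriv_coeff, Polynomial.coeff_zero] at h2
  rw [Nat.sub_add_cancel (by omega)] at h2
  have h3 : (((lineSub v h).natDegree.choose (2 ^ r) : ℕ) : MvPolynomial (Fin N) (ZMod 2)) = 1 := by
    rw [← map_natCast (C : ZMod 2 →+* MvPolynomial (Fin N) (ZMod 2)),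
      choose_two_pow (by omega) (by omega), C_1]
  rw [h3, one_mul, Polynomial.coeff_natDegree, Polynomial.leadingCoeff_eq_zero] at h2
  exact lineSub_ne_zero h0 v h2

/-- Every nonzero homogeneous polynomial of degree `2^n - 1` is detected by the coefficient of
`x_0^{2^{n-1}} ⋯ x_{n-1}` after some linear substitution. -/
theorem exists_topCoeff_ne_zero (n : ℕ) {h : MvPolynomial (Fin N) (ZMod 2)}
    (hh : h.IsHomogeneous (2 ^ n - 1)) (h0 : h ≠ 0) : ∃ V : Fin N → Fin n → ZMod 2,
      L₁Pow.topCoeff n (aeval (fun i => linForm (V i)) h) ≠ 0 := by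
  induction n generalizing h with
  | zero =>
    refine ⟨fun _ => 0, ?_⟩
    rw [totalDegree_eq_zero_iff_eq_C.1 (Nat.le_zero.1 hh.totalDegree_le)] at h0 ⊢
    rw [aeval_C]
    intro h1
    refine h0 ?_
    rw [show coeff 0 h = 0 from ?_, C_0]
    rw [← h1]
    change _ = coeff _ (C _)
    rw [coeff_C, if_pos (Finsupp.ext fun i => i.elim0)]
    rfl
  | succ n ih =>
    have hpos : 0 < 2 ^ n := by positivity
    rw [pow_succ', show 2 * 2 ^ n - 1 = 2 * 2 ^ n - 1 from rfl] at hh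
    obtain ⟨v, hv, hdeg⟩ := exists_direction (by omega) hh h0
    obtain ⟨V, hV⟩ := ih (isHomogeneous_coeff_lineSub hh v (i := 2 ^ n) (by omega))
      (coeff_lineSub_ne_zero hh h0 hdeg)
    -- `x_0` is the coordinate along `v`, and the other variables detect the coefficient of `y^{2^n}`
    refine ⟨fun i => Fin.cons (v i) (V i), ?_⟩
    have key : ((finSuccEquiv (ZMod 2) n).toAlgHom).comp
        (aeval fun i => linForm (Fin.cons (v i) (V i) : Fin (n + 1) → ZMod 2)) =
        (Polynomial.mapAlgHom (aeval fun i => linForm (V i))).comp (lineSub v) := by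
      refine MvPolynomial.algHom_ext fun i => ?_
      change finSuccEquiv (ZMod 2) n (aeval _ (X i)) = Polynomial.mapAlgHom _ (lineSub v (X i))
      rw [aeval_X, finSuccEquiv_linForm, lineSub_X]
      simp only [map_add, map_mul, Polynomial.coe_mapAlgHom, Polynomial.map_C, Polynomial.map_X,
        RingHom.coe_coe, aeval_X]
      rw [add_comm, MvPolynomial.aeval_C]
      rfl
    have h2 := congrArg (fun F => Polynomial.coeff F (2 ^ n)) (DFunLike.congr_fun key h)
    simp only [AlgHom.comp_apply, Polynomial.coe_mapAlgHom, Polynomial.coeff_map,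
      RingHom.coe_coe] at h2
    rw [← h2] at hV
    convert hV using 1
    change coeff _ _ = coeff _ (Polynomial.coeff (finSuccEquiv (ZMod 2) n _) _)
    rw [finSuccEquiv_coeff_coeff]
    congr 1
    ext i
    refine Fin.cases ?_ (fun i => ?_) i
    · simp
    · simp
      omega

end Detection

/-! ### Symmetric sums of monomials with exponents powers of two -/

namespace TwoPower

open MvPolynomial Steinberg

variable {d : ℕ}

/-- The monomial with exponents `2^{j_i}`. -/
noncomputable def expo (j : Fin d → ℕ) : MvPolynomial (Fin d) (ZMod 2) := ∏ i, X i ^ 2 ^ j i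

/-- The multiset of the values of a tuple. -/
def typ (j : Fin d → ℕ) : Multiset ℕ := Finset.univ.val.map j

/-- The tuples with a given multiset of values. -/
def tuples (d : ℕ) (c : Multiset ℕ) : Finset (Fin d → ℕ) :=
  (Fintype.piFinset fun _ => c.toFinset).filter fun j => typ j = c

theorem mem_tuples {c : Multiset ℕ} {j : Fin d → ℕ} : j ∈ tuples d c ↔ typ j = c := by
  rw [tuples, Finset.mem_filter, Fintype.mem_piFinset, and_iff_right_iff_imp]
  rintro rfl i
  rw [Multiset.mem_toFinset]
  exact Multiset.mem_map_of_mem _ (Finset.mem_univ i)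

/-- The sum of the monomials `∏ x_i^{2^{j_i}}` over all tuples `j` with the multiset of values
`c`. -/
noncomputable def msym (d : ℕ) (c : Multiset ℕ) : MvPolynomial (Fin d) (ZMod 2) :=
  ∑ j ∈ tuples d c, expo j

theorem coeff_expo (s : Fin d →₀ ℕ) (j : Fin d → ℕ) :
    coeff s (expo j) = if ⇑s = fun i => 2 ^ j i then 1 else 0 :=
  L₁Pow.coeff_prod_X_pow s _

theorem two_pow_injective : Function.Injective fun (j : Fin d → ℕ) i => 2 ^ j i := fun _ _ h =>
  _root_.funext fun i => Nat.pow_right_injective le_rfl (congrFun h i)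

theorem coeff_msym {s : Fin d →₀ ℕ} {j : Fin d → ℕ} (hs : ⇑s = fun i => 2 ^ j i)
    (c : Multiset ℕ) : coeff s (msym d c) = if typ j = c then 1 else 0 := by
  rw [msym, coeff_sum]
  simp only [coeff_expo, hs, two_pow_injective.eq_iff]
  rw [Finset.sum_ite_eq]
  simp only [mem_tuples]

theorem coeff_msym_eq_zero {s : Fin d →₀ ℕ} (hs : ∀ j : Fin d → ℕ, ⇑s ≠ fun i => 2 ^ j i)
    (c : Multiset ℕ) : coeff s (msym d c) = 0 := by
  rw [msym, coeff_sum]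
  refine Finset.sum_eq_zero fun j _ => ?_
  rw [coeff_expo, if_neg (hs j)]

theorem typ_comp (j : Fin d → ℕ) (σ : Equiv.Perm (Fin d)) : typ (j ∘ σ) = typ j := by
  rw [typ, typ, ← Multiset.map_map, Multiset.map_univ_val_equiv]

theorem coe_ofFn (f : Fin d → ℕ) : ((List.ofFn f : List ℕ) : Multiset ℕ) = typ f := by
  rw [typ, List.ofFn_eq_map, ← Multiset.map_coe]
  rfl

theorem exists_typ_eq {c : Multiset ℕ} (hc : c.card = d) : ∃ j : Fin d → ℕ, typ j = c := by
  subst hc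
  induction c using Quot.inductionOn with
  | h l =>
    refine ⟨fun i => l.get i, ?_⟩
    rw [← coe_ofFn]
    exact congrArg _ (List.ofFn_get l)

theorem exists_perm_of_typ_eq {j j' : Fin d → ℕ} (h : typ j = typ j') :
    ∃ σ : Equiv.Perm (Fin d), j' = j ∘ σ := by
  have hperm : (List.ofFn (j ∘ Tuple.sort j)).Perm (List.ofFn (j' ∘ Tuple.sort j')) := by
    rw [← Multiset.coe_eq_coe, coe_ofFn, coe_ofFn, typ_comp, typ_comp, h]
  have h1 : j ∘ Tuple.sort j = j' ∘ Tuple.sort j' := List.ofFn_injective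
    (hperm.eq_of_pairwise' (Tuple.monotone_sort j).sortedLE_ofFn.pairwise
      (Tuple.monotone_sort j').sortedLE_ofFn.pairwise)
  refine ⟨(Tuple.sort j')⁻¹.trans (Tuple.sort j), ?_⟩
  funext i
  have := congrFun h1 ((Tuple.sort j')⁻¹ i)
  simpa using this.symm

theorem rename_expo (σ : Equiv.Perm (Fin d)) (j : Fin d → ℕ) :
    rename σ (expo j) = expo (j ∘ σ.symm) := by
  rw [expo, expo, map_prod, ← Equiv.prod_comp σ (fun i => X i ^ 2 ^ (j ∘ σ.symm) i)]
  simp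

theorem msym_isSymmetric (d : ℕ) (c : Multiset ℕ) : (msym d c).IsSymmetric := by
  intro σ
  rw [msym, map_sum]
  refine Finset.sum_bij' (fun j _ => j ∘ σ.symm) (fun j _ => j ∘ σ) (fun j hj => ?_)
    (fun j hj => ?_) (fun j _ => ?_) (fun j _ => ?_) fun j _ => rename_expo σ j
  · rwa [mem_tuples, typ_comp, ← mem_tuples]
  · rwa [mem_tuples, typ_comp, ← mem_tuples]
  · funext i; simp
  · funext i; simp

theorem sq_isSymmetric {f : MvPolynomial (Fin d) (ZMod 2)} (hf : f.IsSymmetric) (k : ℕ) :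
    (sq d k f).IsSymmetric := by
  intro σ
  rw [← sq_rename, hf σ]

theorem coeff_of_isSymmetric {f : MvPolynomial (Fin d) (ZMod 2)} (hf : f.IsSymmetric)
    {s s' : Fin d →₀ ℕ} {j j' : Fin d → ℕ} (hs : ⇑s = fun i => 2 ^ j i)
    (hs' : ⇑s' = fun i => 2 ^ j' i) (h : typ j = typ j') : coeff s f = coeff s' f := by
  obtain ⟨σ, rfl⟩ := exists_perm_of_typ_eq h
  have hss : s = Finsupp.mapDomain σ s' := by
    ext i
    rw [← Equiv.apply_symm_apply σ i, Finsupp.mapDomain_apply σ.injective, hs, hs']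
    simp
  calc coeff s f = coeff s (rename σ f) := by rw [hf σ]
    _ = coeff s' f := by rw [hss, coeff_rename_mapDomain _ σ.injective]

/-- A symmetric polynomial whose exponents are powers of two is a sum of `msym`s. -/
theorem mem_span_msym {f : MvPolynomial (Fin d) (ZMod 2)} (hf : f.IsSymmetric)
    {Q : Multiset ℕ → Prop}
    (hQ : ∀ s ∈ f.support, ∃ j : Fin d → ℕ, (⇑s = fun i => 2 ^ j i) ∧ Q (typ j)) :
    f ∈ Submodule.span (ZMod 2) (msym d '' {c | Q c}) := by
  have key : f = ∑ c ∈ f.support.image fun s => typ fun i => Nat.log 2 (s i), msym d c := by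
    ext s
    rw [coeff_sum]
    by_cases h : ∃ j : Fin d → ℕ, ⇑s = fun i => 2 ^ j i
    · obtain ⟨j, hj⟩ := h
      simp only [coeff_msym hj]
      rw [Finset.sum_ite_eq]
      split_ifs with hm
      · obtain ⟨s', hs', hty⟩ := Finset.mem_image.1 hm
        obtain ⟨j', hj', -⟩ := hQ s' hs'
        simp only [hj', Nat.log_pow one_lt_two] at hty
        rw [← coeff_of_isSymmetric hf hj' hj hty]
        exact BrownGitler.eq_one_of_ne_zero (mem_support_iff.1 hs')
      · by_contra hne
        refine hm (Finset.mem_image.2 ⟨s, mem_support_iff.2 hne, ?_⟩)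
        simp only [hj, Nat.log_pow one_lt_two]
    · push Not at h
      rw [Finset.sum_eq_zero fun c _ => coeff_msym_eq_zero h c]
      by_contra hne
      obtain ⟨j, hj, -⟩ := hQ s (mem_support_iff.2 hne)
      exact h j hj
  rw [key]
  refine Submodule.sum_mem _ fun c hc => Submodule.subset_span ⟨c, ?_, rfl⟩
  obtain ⟨s, hs, rfl⟩ := Finset.mem_image.1 hc
  obtain ⟨j, hj, hq⟩ := hQ s hs
  simp only [hj, Nat.log_pow one_lt_two]
  exact hq

/-- The tuple with the entries in `S` increased by one. -/
def bump (j : Fin d → ℕ) (S : Finset (Fin d)) (i : Fin d) : ℕ := if i ∈ S then j i + 1 else j i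

theorem totalSq_X_pow (i : Fin d) (t : ℕ) : totalSq d (X i ^ 2 ^ t) =
    Polynomial.C (X i ^ 2 ^ (t + 1)) * Polynomial.X ^ 2 ^ t + Polynomial.C (X i ^ 2 ^ t) := by
  rw [map_pow, totalSq_X, add_pow_char_pow, mul_pow, ← Polynomial.C_pow, ← Polynomial.C_pow,
    ← pow_mul, ← pow_succ', add_comm]

theorem sq_expo (k : ℕ) (j : Fin d → ℕ) : sq d k (expo j) =
    ∑ S ∈ Finset.univ.filter fun S : Finset (Fin d) => ∑ i ∈ S, 2 ^ j i = k, expo (bump j S) := by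
  have h : ∀ S : Finset (Fin d), (∏ i ∈ S, (Polynomial.C (X i ^ 2 ^ (j i + 1)) *
      Polynomial.X ^ 2 ^ j i : Polynomial (MvPolynomial (Fin d) (ZMod 2)))) *
      ∏ i ∈ Finset.univ \ S, Polynomial.C (X i ^ 2 ^ j i) =
      Polynomial.C (expo (bump j S)) * Polynomial.X ^ ∑ i ∈ S, 2 ^ j i := by
    intro S
    have : expo (bump j S) = (∏ i ∈ S, X i ^ 2 ^ (j i + 1)) * ∏ i ∈ Finset.univ \ S,
        X i ^ 2 ^ j i := by
      rw [expo, ← Finset.prod_sdiff (Finset.subset_univ S), mul_comm]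
      congr 1
      · exact Finset.prod_congr rfl fun i hi => by rw [bump, if_pos hi]
      · exact Finset.prod_congr rfl fun i hi => by
          rw [bump, if_neg (Finset.mem_sdiff.1 hi).2]
    rw [this, Finset.prod_mul_distrib, Finset.prod_pow_eq_pow_sum, map_mul, map_prod, map_prod]
    ring
  rw [sq_eq_coeff, expo, map_prod]
  simp only [totalSq_X_pow]
  rw [Finset.prod_add, Finset.powerset_univ, Polynomial.finsetSum_coeff, Finset.sum_filter]
  refine Finset.sum_congr rfl fun S _ => ?_
  rw [h, Polynomial.coeff_C_mul, Polynomial.coeff_X_pow, mul_ite, mul_one, mul_zero]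
  simp only [eq_comm]

/-- The degree of `msym d c`. -/
def weight (c : Multiset ℕ) : ℕ := (c.map fun t => 2 ^ t).sum

theorem weight_typ (j : Fin d → ℕ) : weight (typ j) = ∑ i, 2 ^ j i := by
  rw [weight, typ, Multiset.map_map]
  rfl

theorem card_typ (j : Fin d → ℕ) : (typ j).card = d := by
  simp [typ]

theorem count_zero_typ (j : Fin d → ℕ) :
    (typ j).count 0 = (Finset.univ.filter fun i => j i = 0).card := by
  rw [typ, Multiset.count_map]
  simp only [eq_comm]
  rfl

theorem weight_bump (j : Fin d → ℕ) (S : Finset (Fin d)) :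
    ∑ i, 2 ^ bump j S i = ∑ i, 2 ^ j i + ∑ i ∈ S, 2 ^ j i := by
  have : ∀ i, 2 ^ bump j S i = 2 ^ j i + if i ∈ S then 2 ^ j i else 0 := by
    intro i
    rw [bump]
    split_ifs
    · rw [pow_succ, mul_two]
    · rw [add_zero]
  simp only [this, Finset.sum_add_distrib, Finset.sum_ite_mem, Finset.univ_inter]

/-- Half the sum of the exponents greater than one in `msym d c`: the degree of the square that
produces these exponents from their halves. -/
def halfWeight (c : Multiset ℕ) : ℕ := (c.map fun t => if t = 0 then 0 else 2 ^ (t - 1)).sum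

theorem halfWeight_typ (j : Fin d → ℕ) :
    halfWeight (typ j) = ∑ i, if j i = 0 then 0 else 2 ^ (j i - 1) := by
  rw [halfWeight, typ, Multiset.map_map]
  rfl

theorem weight_eq (j : Fin d → ℕ) : weight (typ j) = (typ j).count 0 + 2 * halfWeight (typ j) := by
  rw [weight_typ, count_zero_typ, halfWeight_typ, Finset.card_filter, Finset.mul_sum,
    ← Finset.sum_add_distrib]
  refine Finset.sum_congr rfl fun i _ => ?_
  rcases h : j i with _ | t
  · simp
  · simp [pow_succ']

theorem weight_pred (j : Fin d → ℕ) : weight (typ fun i => j i - 1) =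
    (typ j).count 0 + halfWeight (typ j) := by
  rw [weight_typ, count_zero_typ, halfWeight_typ, Finset.card_filter, ← Finset.sum_add_distrib]
  refine Finset.sum_congr rfl fun i _ => ?_
  rcases h : j i with _ | t <;> simp

theorem typ_pred (j : Fin d → ℕ) : typ (fun i => j i - 1) = (typ j).map (· - 1) := by
  rw [typ, typ, Multiset.map_map]
  rfl

theorem eq_of_map_pred_eq {c c' : Multiset ℕ} (h : c.map (· - 1) = c'.map (· - 1))
    (h0 : c.count 0 = c'.count 0) : c = c' := by
  have key : ∀ (c : Multiset ℕ) (t : ℕ), (c.map (· - 1)).count t =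
      c.count (t + 1) + if t = 0 then c.count 0 else 0 := by
    intro c t
    induction c using Multiset.induction_on with
    | empty => simp
    | cons a c ih =>
      rw [Multiset.map_cons, Multiset.count_cons, Multiset.count_cons, Multiset.count_cons, ih]
      rcases a with _ | _ | a <;> rcases t with _ | t <;> simp <;> omega
  ext t
  rcases t with _ | t
  · exact h0
  · have h1 := key c t
    have h2 := key c' t
    rw [h, h2, h0] at h1
    omega

/-- If some entries of `j` are raised and the weights are those of the halved multiset of `c` and of
its square of degree `halfWeight c`, the result has at most as many zeros as `c`. If it has as many,
then all its nonzero entries have been raised. -/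
theorem eq_of_bump {c : Multiset ℕ} {j : Fin d → ℕ} {S : Finset (Fin d)}
    (hj : ∑ i, 2 ^ j i = c.count 0 + halfWeight c) (hS : ∑ i ∈ S, 2 ^ j i = halfWeight c) :
    (typ (bump j S)).count 0 ≤ c.count 0 ∧ ((typ (bump j S)).count 0 = c.count 0 →
      (fun i => bump j S i - 1) = j ∧ S = Finset.univ.filter fun i => bump j S i ≠ 0) := by
  rw [count_zero_typ]
  have hsub : (Finset.univ.filter fun i => bump j S i = 0) ⊆ Finset.univ \ S := by
    intro i hi
    rw [Finset.mem_filter] at hi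
    rw [Finset.mem_sdiff]
    refine ⟨hi.1, fun hiS => ?_⟩
    have := hi.2
    rw [bump, if_pos hiS] at this
    omega
  have hsum : ∑ i ∈ Finset.univ \ S, 2 ^ j i = c.count 0 := by
    have := Finset.sum_sdiff (f := fun i => 2 ^ j i) (Finset.subset_univ S)
    omega
  have hle : (Finset.univ \ S).card ≤ c.count 0 := by
    rw [← hsum, Finset.card_eq_sum_ones]
    exact Finset.sum_le_sum fun i _ => Nat.one_le_two_pow
  refine ⟨(Finset.card_le_card hsub).trans hle, fun h => ?_⟩
  have heq := Finset.eq_of_subset_of_card_le hsub (by omega)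
  have hmem : ∀ i, i ∉ S ↔ bump j S i = 0 := by
    intro i
    have := Finset.ext_iff.1 heq i
    simpa using this.symm
  constructor
  · funext i
    by_cases hi : i ∈ S
    · rw [bump, if_pos hi, Nat.add_sub_cancel]
    · have := (hmem i).1 hi
      rw [this]
      rw [bump, if_neg hi] at this
      rw [this]
  · ext i
    rw [Finset.mem_filter, ← not_iff_not, hmem i]
    simp

/-- A Steenrod square leads from `msym` of the square roots to `msym d c`, up to terms with
fewer linear factors. -/
theorem sq_msym_sub_mem {c : Multiset ℕ} (hc : c.card = d) :
    sq d (halfWeight c) (msym d (c.map (· - 1))) - msym d c ∈ Submodule.span (ZMod 2)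
      (msym d '' {c' | c'.card = d ∧ weight c' = weight c ∧ c'.count 0 < c.count 0}) := by
  obtain ⟨j₀, rfl⟩ := exists_typ_eq hc
  set c := typ j₀ with hcdef
  have hw : ∀ j : Fin d → ℕ, typ j = c.map (· - 1) → ∑ i, 2 ^ j i = c.count 0 + halfWeight c := by
    intro j hj
    rw [← weight_typ, hj, ← typ_pred, weight_pred]
  refine mem_span_msym ((sq_isSymmetric (msym_isSymmetric _ _) _).sub (msym_isSymmetric _ _)) ?_
  let P : Finset (Σ _ : Fin d → ℕ, Finset (Fin d)) := (tuples d (c.map (· - 1))).sigma fun j =>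
    Finset.univ.filter fun S : Finset (Fin d) => ∑ i ∈ S, 2 ^ j i = halfWeight c
  have hP : ∀ p ∈ P, typ p.1 = c.map (· - 1) ∧ ∑ i ∈ p.2, 2 ^ p.1 i = halfWeight c := by
    intro p hp
    rw [Finset.mem_sigma, mem_tuples, Finset.mem_filter] at hp
    exact ⟨hp.1, hp.2.2⟩
  have hsum : sq d (halfWeight c) (msym d (c.map (· - 1))) = ∑ p ∈ P, expo (bump p.1 p.2) := by
    rw [msym, map_sum, Finset.sum_sigma]
    exact Finset.sum_congr rfl fun j _ => sq_expo _ _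
  have hgood : ∑ p ∈ P.filter fun p => (typ (bump p.1 p.2)).count 0 = c.count 0,
      expo (bump p.1 p.2) = msym d c := by
    refine Finset.sum_bij' (fun p _ => bump p.1 p.2)
      (fun j _ => ⟨fun i => j i - 1, Finset.univ.filter fun i => j i ≠ 0⟩) (fun p hp => ?_)
      (fun j hj => ?_) (fun p hp => ?_) (fun j hj => ?_) fun p _ => rfl
    · rw [Finset.mem_filter] at hp
      obtain ⟨h1, h2⟩ := hP p hp.1
      rw [mem_tuples]
      refine eq_of_map_pred_eq ?_ hp.2
      rw [← typ_pred, ((eq_of_bump (hw _ h1) h2).2 hp.2).1, h1]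
    · rw [mem_tuples] at hj
      have hb : bump (fun i => j i - 1) (Finset.univ.filter fun i => j i ≠ 0) = j := by
        funext i
        rw [bump]
        simp only [Finset.mem_filter, Finset.mem_univ, true_and]
        split_ifs <;> omega
      rw [Finset.mem_filter, Finset.mem_sigma, mem_tuples, Finset.mem_filter]
      refine ⟨⟨by rw [typ_pred, hj], Finset.mem_univ _, ?_⟩, by rw [hb, hj]⟩
      rw [← hj, halfWeight_typ, Finset.sum_filter]
      exact Finset.sum_congr rfl fun i _ => by split_ifs <;> simp_all
    · rw [Finset.mem_filter] at hp
      obtain ⟨h1, h2⟩ := hP p hp.1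
      obtain ⟨h3, h4⟩ := (eq_of_bump (hw _ h1) h2).2 hp.2
      exact Sigma.ext h3 (heq_of_eq h4.symm)
    · funext i
      rw [bump]
      simp only [Finset.mem_filter, Finset.mem_univ, true_and]
      split_ifs <;> omega
  rw [hsum, ← Finset.sum_filter_add_sum_filter_not P
    (fun p => (typ (bump p.1 p.2)).count 0 = c.count 0), hgood, add_sub_cancel_left]
  intro s hs
  obtain ⟨p, hp, hsp⟩ := Finset.mem_biUnion.1 (support_sum hs)
  rw [Finset.mem_filter] at hp
  obtain ⟨h1, h2⟩ := hP p hp.1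
  have hs' : ⇑s = fun i => 2 ^ bump p.1 p.2 i := by
    by_contra hne
    rw [mem_support_iff, coeff_expo, if_neg hne] at hsp
    exact hsp rfl
  refine ⟨_, hs', card_typ _, ?_, lt_of_le_of_ne (eq_of_bump (hw _ h1) h2).1 hp.2⟩
  rw [weight_typ, weight_bump, hw _ h1, h2, hcdef, weight_eq j₀]
  omega

/-- Every `msym d c` is obtained from `x_0 ⋯ x_{d-1}` by a Steenrod operation, by induction on the
degree and on the number of linear factors. -/
theorem exists_lift_eq_msym (c : Multiset ℕ) (hc : c.card = d) :
    ∃ θ : FreeAlgebra (ZMod 2) ℕ, FreeAlgebra.lift (ZMod 2)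
      (A := Module.End (ZMod 2) (MvPolynomial (Fin d) (ZMod 2))) (sq d) θ (∏ i, X i) =
        msym d c := by
  let R : Submodule (ZMod 2) (MvPolynomial (Fin d) (ZMod 2)) := LinearMap.range
    ((LinearMap.applyₗ (∏ i, X i : MvPolynomial (Fin d) (ZMod 2))) ∘ₗ (FreeAlgebra.lift (ZMod 2)
      (A := Module.End (ZMod 2) (MvPolynomial (Fin d) (ZMod 2))) (sq d)).toLinearMap)
  suffices h : ∀ w z (c : Multiset ℕ), c.card = d → weight c = w → c.count 0 = z →
      msym d c ∈ R by
    obtain ⟨θ, hθ⟩ := h _ _ c hc rfl rfl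
    exact ⟨θ, hθ⟩
  have hR : ∀ k, ∀ f ∈ R, sq d k f ∈ R := by
    rintro k _ ⟨θ, rfl⟩
    exact ⟨FreeAlgebra.ι (ZMod 2) k * θ, by simp⟩
  intro w
  induction w using Nat.strong_induction_on with
  | _ w ihw =>
    intro z
    induction z using Nat.strong_induction_on with
    | _ z ihz =>
      rintro c hc rfl rfl
      obtain ⟨j, hj⟩ := exists_typ_eq hc
      rcases Nat.eq_zero_or_pos (halfWeight c) with h0 | hpos
      · -- all exponents are one
        have hz : ∀ j' : Fin d → ℕ, typ j' = c → j' = fun _ => 0 := by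
          rintro j' rfl
          rw [halfWeight_typ, Finset.sum_eq_zero_iff] at h0
          funext i
          by_contra hne
          have := h0 i (Finset.mem_univ i)
          rw [if_neg hne] at this
          exact absurd this (by positivity)
        have ht : tuples d c = {fun _ => 0} := by
          ext j'
          rw [mem_tuples, Finset.mem_singleton]
          refine ⟨hz j', ?_⟩
          rintro rfl
          rw [← hj, hz j hj]
        refine ⟨1, ?_⟩
        rw [msym, ht, Finset.sum_singleton, expo]
        simp
      · have h1 : sq d (halfWeight c) (msym d (c.map (· - 1))) ∈ R := by
          refine hR _ _ (ihw _ ?_ _ _ (by rw [Multiset.card_map, hc]) rfl rfl)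
          rw [← hj, ← typ_pred, weight_pred, weight_eq]
          rw [← hj] at hpos
          omega
        have h2 : Submodule.span (ZMod 2) (msym d '' {c' | c'.card = d ∧ weight c' = weight c ∧
            c'.count 0 < c.count 0}) ≤ R := by
          rw [Submodule.span_le]
          rintro _ ⟨c', ⟨hc', hw', hz'⟩, rfl⟩
          exact ihz _ hz' c' hc' hw' rfl
        have := R.sub_mem h1 (h2 (sq_msym_sub_mem hc))
        rwa [sub_sub_cancel] at this

end TwoPower

/-! ### Admissible sequences -/

namespace SteenrodAlgebra

theorem Sq_mul_Sq {i j : ℕ} (hi : 0 < i) (hij : i < 2 * j) : Sq i * Sq j =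
    ∑ c ∈ Finset.range (i / 2 + 1),
      (((j - c - 1).choose (i - 2 * c) : ℕ) : ZMod 2) • (Sq (i + j - c) * Sq c) := by
  have := RingQuot.mkAlgHom_rel (ZMod 2) (AdemRel.adem i j hi hij)
  simp only [map_mul, map_sum, map_smul] at this
  exact this

/-- A sequence with positive entries is admissible if each entry is at least twice the next. -/
def Admissible (l : List ℕ) : Prop := (∀ x ∈ l, 0 < x) ∧ l.IsChain fun a b => 2 * b ≤ a

theorem admissible_or (l : List ℕ) : Admissible l ∨ (∃ l₁ l₂, l = l₁ ++ 0 :: l₂) ∨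
    ∃ l₁ l₂ i j, 0 < i ∧ i < 2 * j ∧ l = l₁ ++ i :: j :: l₂ := by
  induction l with
  | nil => exact Or.inl ⟨by simp, List.isChain_nil⟩
  | cons a l ih =>
    rcases Nat.eq_zero_or_pos a with rfl | ha
    · exact Or.inr (Or.inl ⟨[], l, rfl⟩)
    rcases ih with ⟨h1, h2⟩ | ⟨l₁, l₂, rfl⟩ | ⟨l₁, l₂, i, j, hi, hij, rfl⟩
    · rcases l with _ | ⟨b, l⟩
      · exact Or.inl ⟨by simpa using ha, List.isChain_singleton a⟩
      · rcases le_or_gt (2 * b) a with hab | hab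
        · refine Or.inl ⟨?_, List.isChain_cons_cons.2 ⟨hab, h2⟩⟩
          intro x hx
          rcases List.mem_cons.1 hx with rfl | hx
          · exact ha
          · exact h1 x hx
        · exact Or.inr (Or.inr ⟨[], l, a, b, ha, hab, rfl⟩)
    · exact Or.inr (Or.inl ⟨a :: l₁, l₂, rfl⟩)
    · exact Or.inr (Or.inr ⟨a :: l₁, l₂, i, j, hi, hij, rfl⟩)

/-- The length of a sequence plus its moment, the sum of the `s i_s`. It is decreased by dropping
zeros and by the Adem relations. -/
def moment : List ℕ → ℕ
  | [] => 0
  | a :: l => a + 1 + moment l + l.sum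

theorem moment_append (l₁ l₂ : List ℕ) :
    moment (l₁ ++ l₂) = moment l₁ + moment l₂ + l₁.length * l₂.sum := by
  induction l₁ with
  | nil => simp [moment]
  | cons a l ih =>
    simp only [List.cons_append, moment, ih, List.sum_append, List.length_cons]
    ring

/-- A linear form that vanishes on admissible products of Steenrod squares vanishes. -/
theorem eq_zero_of_admissible {φ : Module.Dual (ZMod 2) SteenrodAlgebra}
    (h : ∀ l, Admissible l → φ (l.map Sq).prod = 0) : φ = 0 := by
  refine BrownGitler.dual_ext fun l => ?_
  rw [LinearMap.zero_apply]
  induction hm : moment l using Nat.strong_induction_on generalizing l with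
  | _ m ih =>
    subst hm
    rcases admissible_or l with hl | ⟨l₁, l₂, rfl⟩ | ⟨l₁, l₂, i, j, hi, hij, rfl⟩
    · exact h l hl
    · have : moment (l₁ ++ l₂) < moment (l₁ ++ 0 :: l₂) := by
        rw [moment_append, moment_append, moment, List.sum_cons]
        simp only [zero_add]
        omega
      have h1 := ih _ this (l₁ ++ l₂) rfl
      simpa [BrownGitler.Sq_zero] using h1
    · have h1 : ((l₁ ++ i :: j :: l₂).map Sq).prod = ∑ c ∈ Finset.range (i / 2 + 1),
          (((j - c - 1).choose (i - 2 * c) : ℕ) : ZMod 2) •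
            ((l₁ ++ (i + j - c) :: c :: l₂).map Sq).prod := by
        simp only [List.map_append, List.map_cons, List.prod_append, List.prod_cons]
        rw [← mul_assoc (Sq i), Sq_mul_Sq hi hij, Finset.sum_mul, Finset.mul_sum]
        simp only [smul_mul_assoc, mul_smul_comm, mul_assoc]
      rw [h1, map_sum]
      refine Finset.sum_eq_zero fun c hc => ?_
      rw [Finset.mem_range] at hc
      rw [map_smul, ih _ ?_ _ rfl, smul_zero]
      simp only [moment_append, moment, List.sum_cons]
      rw [show i + j - c + (c + l₂.sum) = i + (j + l₂.sum) by omega]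
      omega

end SteenrodAlgebra

/-! ### Chains of integers -/

/-- The sequences `k_0 = 2^n - 1, k_1, k_2, …` with `2 k_{t+1} ≤ k_t` and
`k_1 + k_2 + ⋯ = 2^n - 1 - d`. They index bases of the part of degree `d` of `J(2^n - 1)`. -/
def halvingChains (n d : ℕ) : Set (ℕ → ℕ) :=
  {k | k 0 = 2 ^ n - 1 ∧ (∀ t, 2 * k (t + 1) ≤ k t) ∧
    d + ∑ t ∈ Finset.range n, k (t + 1) = 2 ^ n - 1}

namespace halvingChains

variable {n d : ℕ} {k : ℕ → ℕ}

theorem pow_mul_le (h : ∀ t, 2 * k (t + 1) ≤ k t) (t : ℕ) : 2 ^ t * k t ≤ k 0 := by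
  induction t with
  | zero => simp
  | succ t ih =>
    refine le_trans ?_ ih
    rw [pow_succ, mul_assoc]
    exact Nat.mul_le_mul_left _ (h t)

theorem eq_zero (h0 : k 0 = 2 ^ n - 1) (h : ∀ t, 2 * k (t + 1) ≤ k t) {t : ℕ} (ht : n ≤ t) :
    k t = 0 := by
  by_contra hne
  have h1 := pow_mul_le h t
  have h2 : 2 ^ n ≤ 2 ^ t := Nat.pow_le_pow_right two_pos ht
  have h3 : 0 < 2 ^ n := by positivity
  have h4 : 2 ^ t * 1 ≤ 2 ^ t * k t := Nat.mul_le_mul_left _ (Nat.pos_of_ne_zero hne)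
  omega

theorem lt_two_pow (hk : k ∈ halvingChains n d) (t : ℕ) : k t < 2 ^ n := by
  have h1 := pow_mul_le hk.2.1 t
  have h3 : 0 < 2 ^ n := by positivity
  have h4 : 1 * k t ≤ 2 ^ t * k t := Nat.mul_le_mul_right _ Nat.one_le_two_pow
  rw [hk.1] at h1
  omega

instance (n d : ℕ) : Finite (halvingChains n d) := by
  refine Finite.of_injective (fun k : halvingChains n d => fun t : Fin n =>
    (⟨k.1 t, lt_two_pow k.2 t⟩ : Fin (2 ^ n))) fun k k' h => Subtype.ext (funext fun t => ?_)
  rcases lt_or_ge t n with ht | ht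
  · exact congrArg Fin.val (congrFun h ⟨t, ht⟩)
  · rw [eq_zero k.2.1 k.2.2.1 ht, eq_zero k'.2.1 k'.2.2.1 ht]

/-- The product of the Steenrod squares with indices `k_1, k_2, …`. -/
noncomputable def sqProd (n : ℕ) (k : ℕ → ℕ) : SteenrodAlgebra :=
  ((List.range n).map fun t => SteenrodAlgebra.Sq (k (t + 1))).prod

/-- An admissible sequence satisfying the instability condition is a chain. -/
theorem exists_sqProd_eq {l : List ℕ} (hl : SteenrodAlgebra.Admissible l)
    (hsum : d + l.sum = 2 ^ n - 1) (hhead : ∀ i ∈ l.head?, 2 * i ≤ 2 ^ n - 1) :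
    ∃ k ∈ halvingChains n d, sqProd n k = (l.map SteenrodAlgebra.Sq).prod := by
  let k : ℕ → ℕ := fun t => ((2 ^ n - 1) :: l).getD t 0
  have h0 : k 0 = 2 ^ n - 1 := rfl
  have hchain : ((2 ^ n - 1) :: l).IsChain fun a b => 2 * b ≤ a := by
    rw [List.isChain_cons]
    exact ⟨hhead, hl.2⟩
  have hk : ∀ t, 2 * k (t + 1) ≤ k t := by
    intro t
    by_cases ht : t + 1 < ((2 ^ n - 1) :: l).length
    · have := List.isChain_iff_getElem.1 hchain t ht
      simp only [k]
      rwa [List.getD_eq_getElem _ _ ht, List.getD_eq_getElem _ _ (by omega)]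
    · simp only [k]
      rw [List.getD_eq_default _ _ (by omega)]
      omega
  have hlen : l.length ≤ n := by
    by_contra! hn
    have h1 := eq_zero h0 hk (t := n + 1) (by omega)
    simp only [k, List.getD_cons_succ] at h1
    rw [List.getD_eq_getElem _ _ hn] at h1
    have := hl.1 _ (List.getElem_mem hn)
    omega
  have hpad : (List.range n).map (fun t => k (t + 1)) = l ++ List.replicate (n - l.length) 0 := by
    refine List.ext_getElem (by simp; omega) fun t h1 h2 => ?_
    simp only [k, List.getElem_map, List.getElem_range, List.getD_cons_succ]
    rw [List.getElem_append]
    split_ifs with ht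
    · exact List.getD_eq_getElem _ _ ht
    · rw [List.getD_eq_default _ _ (by omega), List.getElem_replicate]
  refine ⟨k, ⟨h0, hk, ?_⟩, ?_⟩
  · rw [← hsum, Finset.sum_range, ← List.sum_ofFn]
    congr 1
    have : List.ofFn (fun i : Fin n => k (i.1 + 1)) = l ++ List.replicate (n - l.length) 0 := by
      rw [← hpad]
      refine List.ext_getElem (by simp) fun t h1 h2 => ?_
      simp
    rw [this]
    simp
  · have : (List.range n).map (fun t => SteenrodAlgebra.Sq (k (t + 1))) =
        ((List.range n).map fun t => k (t + 1)).map SteenrodAlgebra.Sq := by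
      rw [List.map_map]
      rfl
    rw [sqProd, this, hpad]
    simp [BrownGitler.Sq_zero]

/-- The evaluation of the linear forms in the part of degree `d` of `J(2^n - 1)` on the products
of Steenrod squares indexed by chains. -/
noncomputable def evalChains (n d : ℕ) :
    (brownGitler (2 ^ n - 1)).deg d →ₗ[ZMod 2] (halvingChains n d → ZMod 2) where
  toFun φ k := φ.1.1 (sqProd n k.1)
  map_add' _ _ := rfl
  map_smul' _ _ := rfl

/-- By the Adem relations and instability, the forms in `J(2^n - 1)` are determined by their values on
the products of squares indexed by chains. -/
theorem evalChains_injective (n d : ℕ) : Function.Injective (evalChains n d) := by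
  rw [injective_iff_map_eq_zero]
  intro φ hφ
  refine Subtype.ext (Subtype.ext (SteenrodAlgebra.eq_zero_of_admissible fun l hl => ?_))
  have hmem : φ.1.1 ∈ BrownGitler.deg (2 ^ n - 1) d := φ.2
  by_cases hsum : d + l.sum = 2 ^ n - 1
  · by_cases hhead : ∀ i ∈ l.head?, 2 * i ≤ 2 ^ n - 1
    · obtain ⟨k, hk, hkl⟩ := exists_sqProd_eq hl hsum hhead
      rw [← hkl]
      exact congrFun hφ ⟨k, hk⟩
    · push Not at hhead
      obtain ⟨i, hi, hlt⟩ := hhead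
      obtain ⟨l', rfl⟩ : ∃ l', l = i :: l' := by
        rcases l with _ | ⟨a, l⟩
        · simp at hi
        · exact ⟨l, by simpa using hi⟩
      have := hmem.2 i l'.sum 1 (l'.map SteenrodAlgebra.Sq).prod
        (SteenrodAlgebra.prod_mem_deg l') (by rw [List.sum_cons] at hsum; omega)
      rw [one_mul] at this
      rw [List.map_cons, List.prod_cons]
      exact this
  · exact hmem.1 _ hsum _ (SteenrodAlgebra.prod_mem_deg l)

instance (n d : ℕ) : Module.Finite (ZMod 2) ((brownGitler (2 ^ n - 1)).deg d) :=
  Module.Finite.of_injective (evalChains n d) (evalChains_injective n d)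

theorem finrank_deg_le (n d : ℕ) : Module.finrank (ZMod 2) ((brownGitler (2 ^ n - 1)).deg d) ≤
    Nat.card (halvingChains n d) := by
  have := Fintype.ofFinite (halvingChains n d)
  refine (LinearMap.finrank_le_finrank_of_injective (evalChains_injective n d)).trans ?_
  rw [Module.finrank_pi, Nat.card_eq_fintype_card]

/-- The multiset with `k_t - 2 k_{t+1}` entries `t`. -/
def toMultiset (n : ℕ) (k : ℕ → ℕ) : Multiset ℕ :=
  ∑ t ∈ Finset.range n, Multiset.replicate (k t - 2 * k (t + 1)) t

theorem count_toMultiset {t : ℕ} (ht : t < n) :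
    (toMultiset n k).count t = k t - 2 * k (t + 1) := by
  rw [toMultiset, Multiset.count_sum']
  simp only [Multiset.count_replicate]
  rw [Finset.sum_ite_eq' , if_pos (Finset.mem_range.2 ht)]

theorem toMultiset_injective {k k' : ℕ → ℕ} (hk : k ∈ halvingChains n d)
    (hk' : k' ∈ halvingChains n d) (h : toMultiset n k = toMultiset n k') : k = k' := by
  have key : ∀ r t, n ≤ t + r → k t = k' t := by
    intro r
    induction r with
    | zero =>
      intro t ht
      rw [eq_zero hk.1 hk.2.1 (by omega), eq_zero hk'.1 hk'.2.1 (by omega)]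
    | succ r ih =>
      intro t ht
      rcases lt_or_ge t n with htn | htn
      · have h1 := ih (t + 1) (by omega)
        have h2 := congrArg (Multiset.count t) h
        rw [count_toMultiset htn, count_toMultiset htn] at h2
        have := hk.2.1 t
        have := hk'.2.1 t
        omega
      · exact ih t (by omega)
  exact funext fun t => key n t (by omega)

theorem card_toMultiset (hk : k ∈ halvingChains n d) : (toMultiset n k).card = d := by
  have h1 : ∀ m, (∑ t ∈ Finset.range m, (k t - 2 * k (t + 1))) + ∑ t ∈ Finset.range m, k (t + 1) +
      k m = k 0 := by
    intro m
    induction m with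
    | zero => simp
    | succ m ih =>
      rw [Finset.sum_range_succ, Finset.sum_range_succ, ← ih]
      have := hk.2.1 m
      omega
  rw [toMultiset, Multiset.card_sum]
  simp only [Multiset.card_replicate]
  have h2 := h1 n
  rw [eq_zero hk.1 hk.2.1 le_rfl, hk.1] at h2
  have := hk.2.2
  omega

theorem weight_toMultiset (hk : k ∈ halvingChains n d) :
    TwoPower.weight (toMultiset n k) = 2 ^ n - 1 := by
  have h1 : ∀ m, (∑ t ∈ Finset.range m, (k t - 2 * k (t + 1)) * 2 ^ t) + 2 ^ m * k m = k 0 := by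
    intro m
    induction m with
    | zero => simp
    | succ m ih =>
      rw [Finset.sum_range_succ, ← ih, add_assoc]
      congr 1
      obtain ⟨r, hr⟩ := Nat.exists_eq_add_of_le (hk.2.1 m)
      rw [hr, Nat.add_sub_cancel_left]
      ring
  have h2 := h1 n
  rw [eq_zero hk.1 hk.2.1 le_rfl, hk.1, mul_zero, add_zero] at h2
  rw [← h2, toMultiset]
  refine (map_sum (Multiset.sumAddMonoidHom.comp (Multiset.mapAddMonoidHom fun t : ℕ => 2 ^ t))
    _ _).trans (Finset.sum_congr rfl fun t _ => ?_)
  simp [Multiset.map_replicate]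

end halvingChains

/-! ### The Steinberg module `L₂` -/

namespace Steinberg

open MvPolynomial

theorem act_X {n : ℕ} (σ : Matrix (Fin n) (Fin n) (ZMod 2)) (i : Fin n) :
    act σ (X i) = ∑ j, C (σ j i) * X j := by
  simp [act]

theorem borel_two : borel 2 = {1, !![1, 1; 0, 1]} := by
  ext b
  simp only [borel, Finset.mem_filter, Finset.mem_univ, true_and, Finset.mem_insert,
    Finset.mem_singleton]
  have h01 : ∀ c : ZMod 2, c = 0 ∨ c = 1 := by decide
  constructor
  · rintro ⟨hu, hb⟩
    have h10 : b 1 0 = 0 := hb 1 0 (by decide)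
    rw [Matrix.isUnit_iff_isUnit_det, Matrix.det_fin_two, h10, mul_zero, sub_zero,
      isUnit_iff_ne_zero] at hu
    have h00 := BrownGitler.eq_one_of_ne_zero (left_ne_zero_of_mul hu)
    have h11 := BrownGitler.eq_one_of_ne_zero (right_ne_zero_of_mul hu)
    rcases h01 (b 0 1) with h | h
    · left
      ext i j
      fin_cases i <;> fin_cases j <;> simp [h00, h11, h10, h]
    · right
      ext i j
      fin_cases i <;> fin_cases j <;> simp [h00, h11, h10, h]
  · rintro (rfl | rfl)
    · exact ⟨isUnit_one, fun i j h => Matrix.one_apply_ne h.ne'⟩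
    · refine ⟨?_, ?_⟩
      · rw [Matrix.isUnit_iff_isUnit_det, Matrix.det_fin_two]
        simp
      · intro i j h
        fin_cases i <;> fin_cases j <;> simp at h ⊢

/-- The Steinberg idempotent in two variables. -/
theorem idem_two (f : MvPolynomial (Fin 2) (ZMod 2)) : idem 2 f =
    f + aeval ![X 1, X 0] f + (aeval ![X 0, X 0 + X 1] f + aeval ![X 0 + X 1, X 0] f) := by
  have hs : (Finset.univ : Finset (Equiv.Perm (Fin 2))) = {1, Equiv.swap 0 1} := by decide
  have hne : (1 : Matrix (Fin 2) (Fin 2) (ZMod 2)) ≠ !![1, 1; 0, 1] := by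
    intro h
    have := congrFun (congrFun h 0) 1
    simp at this
  have h1 : act ((1 : Equiv.Perm (Fin 2)).permMatrix (ZMod 2)) = AlgHom.id _ _ := by
    rw [Matrix.permMatrix_one, act_one]
  have h2 : act ((Equiv.swap (0 : Fin 2) 1).permMatrix (ZMod 2)) = aeval ![X 1, X 0] := by
    refine MvPolynomial.algHom_ext fun i => ?_
    rw [act_X, aeval_X, Fin.sum_univ_two]
    fin_cases i <;> simp [Equiv.Perm.permMatrix, PEquiv.toMatrix_apply]
  have h3 : act (!![1, 1; 0, 1] : Matrix (Fin 2) (Fin 2) (ZMod 2)) = aeval ![X 0, X 0 + X 1] := by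
    refine MvPolynomial.algHom_ext fun i => ?_
    rw [act_X, aeval_X, Fin.sum_univ_two]
    fin_cases i <;> simp
  have h4 : (aeval ![X 0, X 0 + X 1] :
      MvPolynomial (Fin 2) (ZMod 2) →ₐ[ZMod 2] MvPolynomial (Fin 2) (ZMod 2)).comp
      (aeval ![X 1, X 0] :
        MvPolynomial (Fin 2) (ZMod 2) →ₐ[ZMod 2] MvPolynomial (Fin 2) (ZMod 2)) =
      aeval ![X 0 + X 1, X 0] := by
    refine MvPolynomial.algHom_ext fun i => ?_
    rw [AlgHom.comp_apply, aeval_X, aeval_X]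
    fin_cases i <;> simp
  rw [idem, borel_two, hs, Finset.sum_pair hne, Finset.sum_pair (by decide), act_one, h1, h2, h3]
  simp only [LinearMap.comp_apply, LinearMap.add_apply, AlgHom.toLinearMap_apply, AlgHom.id_apply,
    map_add]
  rw [← h4, AlgHom.comp_apply, add_add_add_comm]

theorem omega_two : omega 2 = X 0 * X 1 * (X 0 + X 1) := by
  have : (Finset.univ.erase (0 : Fin 2 → ZMod 2)) = {![1, 0], ![0, 1], ![1, 1]} := by decide
  rw [omega, this, Finset.prod_insert (by decide), Finset.prod_insert (by decide),
    Finset.prod_singleton]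
  simp [Fin.sum_univ_two, mul_assoc]

/-- The elements of `L₂` that express `x^(b+q) y^b` in terms of monomials with higher powers of
`y`, when `q > b`. -/
theorem mem_L_two (b q : ℕ) (hb : 0 < b) (hq : 0 < q) :
    (X 0 * X 1) ^ b * (X 0 + X 1) ^ q + (X 0 * (X 0 + X 1)) ^ b * X 1 ^ q ∈ L 2 := by
  obtain ⟨p, rfl⟩ := Nat.exists_eq_add_of_lt hb
  obtain ⟨r, rfl⟩ := Nat.exists_eq_add_of_lt hq
  -- dividing by `ω₂ = x y (x + y)` lowers `b` and `q` by one
  let E : MvPolynomial (Fin 2) (ZMod 2) :=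
    (X 0 * X 1) ^ p * (X 0 + X 1) ^ r + (X 0 * (X 0 + X 1)) ^ p * X 1 ^ r
  have h2 : (2 : MvPolynomial (Fin 2) (ZMod 2)) = 0 := CharTwo.two_eq_zero
  have hE : idem 2 E = E := by
    have h3 : (X 0 + (X 0 + X 1) : MvPolynomial (Fin 2) (ZMod 2)) = X 1 := by
      linear_combination (X 0) * h2
    have h4 : (X 0 + X 1 + X 0 : MvPolynomial (Fin 2) (ZMod 2)) = X 1 := by
      linear_combination (X 0) * h2
    have h5 : (X 1 + X 0 : MvPolynomial (Fin 2) (ZMod 2)) = X 0 + X 1 := add_comm _ _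
    rw [idem_two]
    simp only [E, map_add, map_mul, map_pow, aeval_X, Matrix.cons_val_zero, Matrix.cons_val_one,
      h3, h4, h5]
    linear_combination (((X 0 : MvPolynomial (Fin 2) (ZMod 2)) * X 1) ^ p * (X 0 + X 1) ^ r +
      (X 0 * (X 0 + X 1)) ^ p * X 1 ^ r +
      (X 1 * (X 0 + X 1)) ^ p * X 0 ^ r) * h2
  refine ⟨E, ⟨E, hE⟩, ?_⟩
  rw [LinearMap.mulLeft_apply, omega_two]
  ring

/-- The exponent vector `(A, B)`. -/
noncomputable def pair (A B : ℕ) : Fin 2 →₀ ℕ := Finsupp.equivFunOnFinite.symm ![A, B]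

theorem coeff_mul_add_pow (A B a b c : ℕ) :
    coeff (pair A B) (X 0 ^ a * X 1 ^ b * (X 0 + X 1) ^ c : MvPolynomial (Fin 2) (ZMod 2)) =
      if a + b + c = A + B ∧ b ≤ B then (c.choose (B - b) : ZMod 2) else 0 := by
  have h : (X 0 ^ a * X 1 ^ b * (X 0 + X 1) ^ c : MvPolynomial (Fin 2) (ZMod 2)) =
      ∑ k ∈ Finset.range (c + 1), C (c.choose k : ZMod 2) *
        ∏ i, X i ^ (![a + (c - k), b + k] i) := by
    rw [add_comm (X 0) (X 1), add_pow, Finset.mul_sum]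
    refine Finset.sum_congr rfl fun k _ => ?_
    rw [Fin.prod_univ_two, map_natCast]
    simp only [Matrix.cons_val_zero, Matrix.cons_val_one]
    ring
  have hp : ∀ a b : ℕ, (⇑(pair A B) = ![a, b]) ↔ A = a ∧ B = b := by
    intro a b
    rw [pair]
    change ![A, B] = ![a, b] ↔ _
    simp
  rw [h, coeff_sum]
  simp only [coeff_C_mul, L₁Pow.coeff_prod_X_pow, hp, mul_ite, mul_one, mul_zero]
  split_ifs with hc
  · rcases lt_or_ge c (B - b) with hlt | hle
    · rw [Nat.choose_eq_zero_of_lt hlt, Nat.cast_zero]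
      refine Finset.sum_eq_zero fun k hk => if_neg ?_
      rw [Finset.mem_range] at hk
      omega
    · rw [Finset.sum_eq_single (B - b)]
      · rw [if_pos (by omega)]
      · intro k hk hne
        rw [Finset.mem_range] at hk
        exact if_neg (by omega)
      · intro hn
        exact absurd (Finset.mem_range.2 (by omega)) hn
  · refine Finset.sum_eq_zero fun k hk => if_neg ?_
    rw [Finset.mem_range] at hk
    omega

/-- The case of Lucas' theorem for the binomial coefficients with lower entry `2^r - 1`. -/
theorem choose_two_pow_sub_one (r J : ℕ) : ((J.choose (2 ^ r - 1) : ℕ) : ZMod 2) =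
    if J % 2 ^ r = 2 ^ r - 1 then 1 else 0 := by
  have hpos : 0 < 2 ^ r := by positivity
  have hlt := Nat.mod_lt J hpos
  rw [← Polynomial.coeff_one_add_X_pow (ZMod 2) J (2 ^ r - 1)]
  conv_lhs => rw [← Nat.div_add_mod J (2 ^ r)]
  rw [pow_add, pow_mul, add_pow_char_pow, one_pow]
  have h : ∀ a : ℕ, ∃ g : Polynomial (ZMod 2),
      (1 + Polynomial.X ^ 2 ^ r) ^ a = 1 + Polynomial.X ^ 2 ^ r * g := by
    intro a
    induction a with
    | zero => exact ⟨0, by simp⟩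
    | succ a ih =>
      obtain ⟨g, hg⟩ := ih
      exact ⟨1 + g + Polynomial.X ^ 2 ^ r * g, by rw [pow_succ, hg]; ring⟩
  obtain ⟨g, hg⟩ := h (J / 2 ^ r)
  rw [hg, add_mul, one_mul, Polynomial.coeff_add, mul_assoc, Polynomial.coeff_X_pow_mul',
    if_neg (by omega), add_zero, Polynomial.coeff_one_add_X_pow]
  split_ifs with h1
  · rw [h1, Nat.choose_self, Nat.cast_one]
  · rw [Nat.choose_eq_zero_of_lt (by omega), Nat.cast_zero]

/-- The coefficient of `x^{2s} y^s`, `s = 2^r`, in `ω₂ e₂(x^{I-1} y^{J-1})` is even. -/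
theorem parity {r I J : ℕ} (hI : 0 < I) (hJ : 0 < J) (h : I + J + 1 = 3 * 2 ^ r) :
    (if J ≤ 2 ^ r then ((1 : ℕ).choose (2 ^ r - J) : ZMod 2) else 0) +
      (if I ≤ 2 ^ r then ((1 : ℕ).choose (2 ^ r - I) : ZMod 2) else 0) +
      ((J.choose (2 ^ r - 1) : ℕ) : ZMod 2) + ((I.choose (2 ^ r - 1) : ℕ) : ZMod 2) = 0 := by
  rw [choose_two_pow_sub_one, choose_two_pow_sub_one]
  have hpos : 0 < 2 ^ r := by positivity
  generalize 2 ^ r = s at *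
  have key : ∀ I J, 0 < I → 0 < J → I + J + 1 = 3 * s →
      (J % s = s - 1 ↔ J + 1 = s ∨ I = s) := by
    intro I J hI hJ h
    have h1 := Nat.div_add_mod J s
    have h2 := Nat.mod_lt J hpos
    have h3 : J / s < 3 := by
      rw [Nat.div_lt_iff_lt_mul hpos]
      omega
    generalize J / s = q at *
    generalize J % s = m at *
    interval_cases q <;> omega
  have hC : ∀ J, 0 < J → (if J ≤ s then ((1 : ℕ).choose (s - J) : ZMod 2) else 0) =
      if J = s ∨ J + 1 = s then 1 else 0 := by
    intro J hJ
    by_cases h1 : J = s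
    · simp [h1]
    · by_cases h2 : J + 1 = s
      · subst h2
        simp
      · rw [if_neg (show ¬(J = s ∨ J + 1 = s) by tauto)]
        split_ifs with h3
        · rw [Nat.choose_eq_zero_of_lt (by omega), Nat.cast_zero]
        · rfl
  rw [hC J hJ, hC I hI]
  simp only [key I J hI hJ h, key J I hJ hI (by omega)]
  have h11 : (1 + 1 : ZMod 2) = 0 := by decide
  split_ifs <;> first | omega | simp [h11]

/-- `L₂` does not involve the monomials `x^{2s} y^s`, `s` a power of two. -/
theorem coeff_of_mem_L_two {f : MvPolynomial (Fin 2) (ZMod 2)} (hf : f ∈ L 2) (r : ℕ) :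
    coeff (pair (2 * 2 ^ r) (2 ^ r)) f = 0 := by
  obtain ⟨_, ⟨g, rfl⟩, rfl⟩ := hf
  rw [LinearMap.mulLeft_apply]
  induction g using MvPolynomial.induction_on' with
  | add p q hp hq => rw [map_add, mul_add, coeff_add, hp, hq, add_zero]
  | monomial u c =>
    have hmon : monomial u c = C c * (X 0 ^ u 0 * X 1 ^ u 1) := by
      rw [monomial_eq, Finsupp.prod_fintype _ _ fun i => pow_zero _, Fin.prod_univ_two]
    have hw : omega 2 * idem 2 (monomial u c) = C c *
        (X 0 ^ (u 0 + 1) * X 1 ^ (u 1 + 1) * (X 0 + X 1) ^ 1 +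
          X 0 ^ (u 1 + 1) * X 1 ^ (u 0 + 1) * (X 0 + X 1) ^ 1 +
          X 0 ^ (u 0 + 1) * X 1 ^ 1 * (X 0 + X 1) ^ (u 1 + 1) +
          X 0 ^ (u 1 + 1) * X 1 ^ 1 * (X 0 + X 1) ^ (u 0 + 1)) := by
      have hC : ∀ v : Fin 2 → MvPolynomial (Fin 2) (ZMod 2), aeval v (C c) = C c := fun v =>
        (aeval v).commutes c
      rw [hmon, idem_two, omega_two]
      simp only [map_mul, map_pow, hC, aeval_X, Matrix.cons_val_zero, Matrix.cons_val_one]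
      ring
    rw [hw, coeff_C_mul]
    simp only [coeff_add, coeff_mul_add_pow]
    have hpos : 0 < 2 ^ r := by positivity
    by_cases h : u 0 + 1 + (u 1 + 1) + 1 = 3 * 2 ^ r
    · have := parity (Nat.succ_pos (u 0)) (Nat.succ_pos (u 1)) h
      simp only [show u 0 + 1 + (u 1 + 1) + 1 = 2 * 2 ^ r + 2 ^ r by omega,
        show u 1 + 1 + (u 0 + 1) + 1 = 2 * 2 ^ r + 2 ^ r by omega,
        show u 0 + 1 + 1 + (u 1 + 1) = 2 * 2 ^ r + 2 ^ r by omega,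
        show u 1 + 1 + 1 + (u 0 + 1) = 2 * 2 ^ r + 2 ^ r by omega, true_and,
        if_pos (show 1 ≤ 2 ^ r from hpos)]
      rw [this, mul_zero]
    · rw [if_neg (by omega), if_neg (by omega), if_neg (by omega), if_neg (by omega)]
      simp

end Steinberg

/-! ### The subspaces `MP(i)` lie in the kernel of `g` -/

namespace Steinberg

open MvPolynomial

variable {n : ℕ}

theorem sq_mem_supported {s : Set (Fin n)} (k : ℕ) {f : MvPolynomial (Fin n) (ZMod 2)}
    (hf : f ∈ supported (ZMod 2) s) : sq n k f ∈ supported (ZMod 2) s := by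
  induction hf using Algebra.adjoin_induction generalizing k with
  | mem f hf =>
    obtain ⟨i, hi, rfl⟩ := hf
    have hX : (X i : MvPolynomial (Fin n) (ZMod 2)) ∈ supported (ZMod 2) s :=
      X_mem_supported.2 hi
    rw [sq_eq_coeff, totalSq_X, Polynomial.coeff_add, Polynomial.coeff_C,
      Polynomial.coeff_C_mul, Polynomial.coeff_X]
    refine add_mem ?_ (mul_mem (pow_mem hX 2) ?_) <;> split_ifs <;>
      first | exact hX | exact zero_mem _ | exact one_mem _
  | algebraMap c =>
    rw [sq_eq_coeff, AlgHom.commutes]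
    change (Polynomial.C (C c)).coeff k ∈ _
    rw [Polynomial.coeff_C]
    split_ifs
    · exact Subalgebra.algebraMap_mem _ c
    · exact zero_mem _
  | add f g _ _ hf hg =>
    rw [map_add]
    exact add_mem (hf k) (hg k)
  | mul f g _ _ hf hg =>
    rw [sq_mul]
    exact sum_mem fun p _ => mul_mem (hf _) (hg _)

theorem coeff_eq_zero_of_mem_supported {s : Set (Fin n)} {f : MvPolynomial (Fin n) (ZMod 2)}
    (hf : f ∈ supported (ZMod 2) s) {v : Fin n →₀ ℕ} {l : Fin n} (hl : l ∉ s) (hv : v l ≠ 0) :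
    coeff v f = 0 := by
  by_contra h
  exact hl (mem_supported.1 hf ((mem_vars_iff_mem_support l).2
    ⟨v, mem_support_iff.2 h, Finsupp.mem_support_iff.2 hv⟩))

theorem rename_mem_supported {m : ℕ} {s : Set (Fin n)} (e : Fin m → Fin n) (he : ∀ i, e i ∈ s)
    (f : MvPolynomial (Fin m) (ZMod 2)) : rename e f ∈ supported (ZMod 2) s := by
  refine mem_supported.2 fun l hl => ?_
  obtain ⟨i, -, rfl⟩ := Finset.mem_image.1 (vars_rename e f hl)
  exact he i

theorem X_dvd_sq_X (i : Fin n) (k : ℕ) : X i ∣ sq n k (X i) := by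
  rw [sq_eq_coeff, totalSq_X, Polynomial.coeff_add, Polynomial.coeff_C,
    Polynomial.coeff_C_mul, Polynomial.coeff_X]
  split_ifs <;> simp

theorem X_sq_dvd_sq {i : Fin n} {f : MvPolynomial (Fin n) (ZMod 2)} (k : ℕ) (hf : X i ^ 2 ∣ f) :
    X i ^ 2 ∣ sq n k f := by
  obtain ⟨g, rfl⟩ := hf
  rw [pow_two, mul_assoc, sq_mul]
  refine Finset.dvd_sum fun p _ => mul_dvd_mul (X_dvd_sq_X i _) ?_
  rw [sq_mul]
  exact Finset.dvd_sum fun q _ => Dvd.dvd.mul_right (X_dvd_sq_X i _) _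

end Steinberg

namespace L₁Pow

open MvPolynomial Steinberg

variable {n : ℕ}

/-- The top coefficient vanishes on the orbit of a polynomial that omits one of the variables. -/
theorem topCoeff_lift_eq_zero {t : Fin n} {f : MvPolynomial (Fin n) (ZMod 2)}
    (hf : f ∈ supported (ZMod 2) {l | l ≠ t}) (θ : FreeAlgebra (ZMod 2) ℕ) :
    topCoeff n (FreeAlgebra.lift (ZMod 2) (A := Module.End (ZMod 2)
      (MvPolynomial (Fin n) (ZMod 2))) (sq n) θ f) = 0 := by
  refine coeff_eq_zero_of_mem_supported (l := t) (SqMod.lift_mem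
    (W := Subalgebra.toSubmodule (supported (ZMod 2) {l | l ≠ t}))
    (fun k f hf => sq_mem_supported k hf) θ hf) (by simp) ?_
  change 2 ^ _ ≠ 0
  positivity

/-- The factor without `x_i` and `x_{i+1}` leaves the exponents `2s, s` of these variables to the
factor from `L₂`. -/
theorem topCoeff_rename_mul {i i' : Fin n} (hi : i'.1 = i.1 + 1)
    {p : MvPolynomial (Fin 2) (ZMod 2)} (hp : p ∈ L 2) {q : MvPolynomial (Fin n) (ZMod 2)}
    (hq : q ∈ supported (ZMod 2) {l | l ≠ i ∧ l ≠ i'}) :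
    topCoeff n (rename ![i, i'] p * q) = 0 := by
  have hne : i ≠ i' := fun h => by rw [h] at hi; omega
  have hinj : Function.Injective ![i, i'] := by
    intro a b
    fin_cases a <;> fin_cases b <;> simp [hne, hne.symm]
  change coeff _ _ = 0
  rw [coeff_mul]
  refine Finset.sum_eq_zero fun uv huv => ?_
  rw [Finset.HasAntidiagonal.mem_antidiagonal] at huv
  by_contra h
  have hv : ∀ l, l = i ∨ l = i' → uv.2 l = 0 := by
    intro l hl
    by_contra hl'
    exact right_ne_zero_of_mul h (coeff_eq_zero_of_mem_supported hq (by
      rw [Set.mem_ofPred_eq]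
      tauto) hl')
  have hu : ∀ l, l = i ∨ l = i' → uv.1 l = 2 ^ (n - 1 - l.1) := by
    intro l hl
    have := DFunLike.congr_fun huv l
    rw [Finsupp.add_apply, hv l hl, add_zero] at this
    exact this
  obtain ⟨w, hw, hwp⟩ := coeff_rename_ne_zero _ _ _ (left_ne_zero_of_mul h)
  have hw' : ∀ j, w j = uv.1 (![i, i'] j) := fun j => by
    rw [← hw, Finsupp.mapDomain_apply hinj]
  refine hwp ?_
  convert coeff_of_mem_L_two hp (n - 1 - i'.1) using 2
  ext j
  have hlt := i'.2
  fin_cases j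
  · refine (hw' 0).trans ((hu i (Or.inl rfl)).trans ?_)
    change _ = 2 * 2 ^ (n - 1 - i'.1)
    rw [← pow_succ', show n - 1 - i.1 = n - 1 - i'.1 + 1 by omega]
  · exact (hw' 1).trans (hu i' (Or.inr rfl))

variable {π : ∀ s : ℕ, SqMod.Hom (steinbergL 1) (brownGitler (2 ^ s))}
  {μ : SqMod.Hom (SqMod.tensor fun i : Fin n => brownGitler (2 ^ (n - 1 - i.1)))
    (brownGitler (2 ^ n - 1))}

/-- The `MP(i)` lie in the kernel of `g`. They are contained in stable subspaces on which the top
coefficient vanishes: the products of `L₂` with the polynomials in the other variables, and the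
multiples of `x_{n-1}^2`. -/
theorem gMap_MP (hπ : ∀ s, (π s).Nontrivial) (hμ : μ.Nontrivial) (i : Fin n) :
    MP n i ≤ LinearMap.ker (gMap n π μ).toLin := by
  intro z hz
  rw [LinearMap.mem_ker]
  rw [MP] at hz
  split_ifs at hz with h
  · let i' : Fin n := ⟨i.1 + 1, h⟩
    let W : Submodule (ZMod 2) (MvPolynomial (Fin n) (ZMod 2)) := Submodule.span (ZMod 2)
      {f | ∃ p ∈ L 2, ∃ q ∈ supported (ZMod 2) {l | l ≠ i ∧ l ≠ i'}, f = rename ![i, i'] p * q}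
    refine gMap_eq_zero hπ hμ (W := W) (fun k => ?_) ?_ ?_
    · change W ≤ W.comap (sq n k)
      refine Submodule.span_le.2 ?_
      rintro _ ⟨p, hp, q, hq, rfl⟩
      change sq n k _ ∈ W
      rw [sq_mul]
      refine sum_mem fun r _ => Submodule.subset_span
        ⟨_, sq_mem_L 2 r.1 p hp, _, sq_mem_supported r.2 hq, ?_⟩
      rw [sq_rename]
    · change W ≤ LinearMap.ker (topCoeff n)
      refine Submodule.span_le.2 ?_
      rintro _ ⟨p, hp, q, hq, rfl⟩
      exact topCoeff_rename_mul rfl hp hq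
    · refine Submodule.span_le.2 ?_ (Submodule.mem_comap.1 hz)
      rintro _ ⟨p, hp, f, rfl⟩
      refine Submodule.subset_span ⟨p, hp, _, prod_mem fun l hl => ?_, rfl⟩
      exact rename_mem_supported _ (fun _ => (Finset.mem_filter.1 hl).2) _
  · refine gMap_eq_zero hπ hμ
      (W := (Ideal.span {X i ^ 2}).restrictScalars (ZMod 2)) (fun k f hf => ?_) (fun f hf => ?_) ?_
    · rw [Submodule.restrictScalars_mem, Ideal.mem_span_singleton] at hf ⊢
      exact X_sq_dvd_sq k hf
    · rw [Submodule.restrictScalars_mem, Ideal.mem_span_singleton] at hf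
      obtain ⟨g, rfl⟩ := hf
      change coeff _ _ = 0
      rw [X_pow_eq_monomial, coeff_monomial_mul', if_neg]
      rw [Finsupp.single_le_iff]
      have := i.2
      change ¬ 2 ≤ 2 ^ (n - 1 - i.1)
      rw [show n - 1 - i.1 = 0 by omega]
      norm_num
    · have hle : Submodule.span (ZMod 2) {t | ∃ f : Fin n → L 1, (f i).1 ∈ L' 1 ∧
          t = PiTensorProduct.tprod (ZMod 2) f} ≤
          ((Ideal.span {X i ^ 2}).restrictScalars (ZMod 2)).comap (toPoly n) := by
        refine Submodule.span_le.2 ?_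
        rintro _ ⟨f, hf, rfl⟩
        change toPoly n _ ∈ (Ideal.span {X i ^ 2}).restrictScalars (ZMod 2)
        rw [Submodule.restrictScalars_mem, Ideal.mem_span_singleton]
        refine Dvd.dvd.trans ?_ (dvd_of_eq (toPoly_tprod f).symm)
        refine Dvd.dvd.trans ?_ (Finset.dvd_prod_of_mem _ (Finset.mem_univ i))
        obtain ⟨g, ⟨g', -, rfl⟩, hg⟩ := hf
        rw [← hg, LinearMap.mulLeft_apply, LinearMap.mulLeft_apply, omega_one, map_mul, map_mul,
          rename_X, pow_two, ← mul_assoc]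
        exact dvd_mul_right _ _
      exact hle hz

end L₁Pow

/-! ### Rewriting modulo the subspaces `MP(i)` -/

namespace Steinberg

open MvPolynomial

/-- The leading term of the elements of `L₂` in `Steinberg.mem_L_two`. -/
theorem exists_mem_L_two {b q : ℕ} (hb : 0 < b) (hq : b < q) :
    ∃ E ∈ Submodule.span (ZMod 2) {f : MvPolynomial (Fin 2) (ZMod 2) |
      ∃ A B, 0 < A ∧ b < B ∧ A + B = b + q + b ∧ f = X 0 ^ A * X 1 ^ B},
      X 0 ^ (b + q) * X 1 ^ b + E ∈ L 2 := by
  refine ⟨∑ k ∈ Finset.range q, ((q.choose (k + 1) : ℕ) : ZMod 2) •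
      (X 0 ^ (b + (q - (k + 1))) * X 1 ^ (b + (k + 1))) +
    ∑ k ∈ Finset.range (b + 1), ((b.choose k : ℕ) : ZMod 2) •
      (X 0 ^ (b + (b - k)) * X 1 ^ (k + q)), ?_, ?_⟩
  · refine add_mem (sum_mem fun k hk => Submodule.smul_mem _ _ (Submodule.subset_span
      ⟨_, _, ?_, ?_, ?_, rfl⟩)) (sum_mem fun k hk => Submodule.smul_mem _ _
      (Submodule.subset_span ⟨_, _, ?_, ?_, ?_, rfl⟩))
    all_goals
      rw [Finset.mem_range] at hk
      omega
  · convert mem_L_two b q hb (hb.trans hq) using 1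
    rw [add_comm (X 0) (X 1), mul_pow (X 0) (X 1 + X 0) b, add_pow (X 1) (X 0) q,
      add_pow (X 1) (X 0) b, Finset.sum_range_succ' _ q, mul_add, Finset.mul_sum, Finset.mul_sum,
      Finset.sum_mul, ← add_assoc]
    congr 1
    · rw [add_comm]
      congr 1
      · refine Finset.sum_congr rfl fun k _ => ?_
        rw [Nat.cast_smul_eq_nsmul, nsmul_eq_mul]
        ring
      · simp only [pow_zero, Nat.choose_zero_right, Nat.sub_zero, Nat.cast_one]
        ring
    · refine Finset.sum_congr rfl fun k _ => ?_
      rw [Nat.cast_smul_eq_nsmul, nsmul_eq_mul]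
      ring

end Steinberg

namespace L₁Pow

open MvPolynomial Steinberg

variable {n : ℕ}

/-- The exponent sequences of the basis of `L_1^{⊗n}` modulo the `MP(i)`: positive, each entry
at most twice the next one, the last entry equal to one. -/
def IsCayley (a : Fin n → ℕ) : Prop :=
  (∀ i, 0 < a i) ∧ (∀ (i : Fin n) (h : i.1 + 1 < n), a i ≤ 2 * a ⟨i.1 + 1, h⟩) ∧
    ∀ i : Fin n, i.1 + 1 = n → a i = 1

theorem sum_mul_update (c a : Fin n → ℕ) {i i' : Fin n} (h : i ≠ i') (A B : ℕ) :
    ∑ j, c j * Function.update (Function.update a i A) i' B j + c i * a i + c i' * a i' =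
      ∑ j, c j * a j + c i * A + c i' * B := by
  have key : ∀ j, c j * Function.update (Function.update a i A) i' B j +
      (if i = j then c i * a i else 0) + (if i' = j then c i' * a i' else 0) =
      c j * a j + (if i = j then c i * A else 0) + (if i' = j then c i' * B else 0) := by
    intro j
    by_cases h1 : i' = j
    · subst h1
      simp [h]
      ring
    · by_cases h2 : i = j
      · subst h2
        simp [h, h1]
        ring
      · simp [h1, h2, Ne.symm h1, Ne.symm h2]
  have := Finset.sum_congr (s₁ := Finset.univ) rfl fun j _ => key j
  simpa only [Finset.sum_add_distrib, Finset.sum_ite_eq, Finset.mem_univ, if_true] using this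

theorem gen_mem_MP_of_last {a : Fin n → ℕ} {i : Fin n} (hi : i.1 + 1 = n) (h : 1 < a i) :
    gen a ∈ MP n i := by
  rw [MP, dif_neg (by omega)]
  refine Submodule.subset_span ⟨fun j => power (a j), ?_, rfl⟩
  rw [mem_L'_one]
  refine ⟨_, (power (a i - 1)).2, ?_⟩
  rw [coe_power (by omega), coe_power (by omega), ← pow_succ', show a i - 1 + 1 = a i by omega]

/-- If an exponent is more than twice the next one, the tensor is congruent modulo `MP(i)` to a
combination of tensors with exponents moved to the right, which lowers `∑ (n - 1 - j) a_j`. -/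
theorem gen_mem_of_two_mul_lt {a : Fin n → ℕ} (ha : ∀ i, 0 < a i) {i : Fin n} (h : i.1 + 1 < n)
    (hlt : 2 * a ⟨i.1 + 1, h⟩ < a i) :
    gen a ∈ Submodule.span (ZMod 2) {z | ∃ a' : Fin n → ℕ, (∀ j, 0 < a' j) ∧
      ∑ j, a' j = ∑ j, a j ∧ ∑ j : Fin n, (n - 1 - j.1) * a' j < ∑ j : Fin n, (n - 1 - j.1) * a j ∧
      z = gen a'} ⊔ MP n i := by
  set i' : Fin n := ⟨i.1 + 1, h⟩ with hi'
  have hne : i ≠ i' := by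
    intro h
    have := congrArg Fin.val h
    simp [hi'] at this
  set S : Submodule (ZMod 2) (L₁Pow n).carrier := Submodule.span (ZMod 2) {z | ∃ a' : Fin n → ℕ,
      (∀ j, 0 < a' j) ∧ ∑ j, a' j = ∑ j, a j ∧
      ∑ j : Fin n, (n - 1 - j.1) * a' j < ∑ j : Fin n, (n - 1 - j.1) * a j ∧ z = gen a'}
  let R : MvPolynomial (Fin n) (ZMod 2) :=
    ∏ l ∈ Finset.univ.filter (fun l : Fin n => l ≠ i ∧ l ≠ i'),
      rename (fun _ : Fin 1 => l) (power (a l)).1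
  -- `T` puts a polynomial in two variables in the positions `i, i + 1` of the tensor
  let T : MvPolynomial (Fin 2) (ZMod 2) →ₗ[ZMod 2] MvPolynomial (Fin n) (ZMod 2) :=
    LinearMap.mulRight (ZMod 2) R ∘ₗ (rename ![i, i']).toLinearMap
  have hT : ∀ A B, 0 < A → 0 < B → T (X 0 ^ A * X 1 ^ B) =
      toPoly n (gen (Function.update (Function.update a i A) i' B)) := by
    intro A B hA hB
    rw [toPoly_gen]
    · rw [← Finset.prod_filter_mul_prod_filter_not Finset.univ
        (fun l : Fin n => l ≠ i ∧ l ≠ i'), mul_comm (∏ l with _, _)]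
      have hnot : Finset.univ.filter (fun l : Fin n => ¬(l ≠ i ∧ l ≠ i')) = {i, i'} := by
        ext l
        simp only [Finset.mem_filter, Finset.mem_univ, true_and, Finset.mem_insert,
          Finset.mem_singleton]
        tauto
      rw [hnot, Finset.prod_pair hne]
      change rename ![i, i'] (X 0 ^ A * X 1 ^ B) * R = _
      congr 1
      · simp [hne]
      · refine Finset.prod_congr rfl fun l hl => ?_
        obtain ⟨-, h1, h2⟩ := Finset.mem_filter.1 hl
        rw [coe_power (ha l), map_pow, rename_X, Function.update_of_ne h2,
          Function.update_of_ne h1]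
    · intro j
      by_cases h1 : j = i'
      · subst h1
        simpa using hB
      · by_cases h2 : j = i
        · subst h2
          simpa [hne] using hA
        · simpa [h1, h2] using ha j
  obtain ⟨E, hE, hmem⟩ := exists_mem_L_two (b := a i') (q := a i - a i') (ha i') (by omega)
  rw [show a i' + (a i - a i') = a i by omega] at hE hmem
  obtain ⟨w, hw, hwE⟩ : T E ∈ S.map (toPoly n) := by
    refine (Submodule.span_le (p := (S.map (toPoly n)).comap T)).2 ?_ hE
    rintro _ ⟨A, B, hA, hB, hAB, rfl⟩
    refine ⟨_, Submodule.subset_span ⟨Function.update (Function.update a i A) i' B, ?_, ?_, ?_,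
      rfl⟩, (hT A B hA (by omega)).symm⟩
    · intro j
      by_cases h1 : j = i'
      · subst h1
        simp
        omega
      · by_cases h2 : j = i
        · subst h2
          simpa [hne] using hA
        · simpa [h1, h2] using ha j
    · have := sum_mul_update (fun _ => 1) a hne A B
      simp only [one_mul] at this
      omega
    · have := sum_mul_update (fun j : Fin n => n - 1 - j.1) a hne A B
      have hc : n - 1 - i.1 = n - 1 - i'.1 + 1 := by
        simp only [hi']
        omega
      simp only [hc] at this
      generalize n - 1 - i'.1 = c at this
      have h3 : c * A + c * B = c * a i + c * a i' := by
        rw [← mul_add, ← mul_add, hAB]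
      simp only [add_mul, one_mul] at this
      omega
  have hadd : gen a + w ∈ MP n i := by
    rw [MP, dif_pos h, Submodule.mem_comap]
    refine Submodule.subset_span ⟨_, hmem, fun l => power (a l), ?_⟩
    refine (map_add (toPoly n) _ _).trans ?_
    have := hT (a i) (a i') (ha i) (ha i')
    rw [Function.update_eq_self, Function.update_eq_self] at this
    rw [hwE, ← this, ← map_add]
    rfl
  have hsub : gen a = -w + (gen a + w) := by abel
  rw [hsub]
  exact Submodule.add_mem_sup (neg_mem hw) hadd

/-- Modulo the `MP(i)`, the tensors with Cayley exponents span. -/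
theorem gen_mem_span_isCayley_sup {a : Fin n → ℕ} (ha : ∀ i, 0 < a i) :
    gen a ∈ Submodule.span (ZMod 2) {z | ∃ a' : Fin n → ℕ, IsCayley a' ∧
      ∑ j, a' j = ∑ j, a j ∧ z = gen a'} ⊔ ⨆ i, MP n i := by
  induction hm : ∑ j : Fin n, (n - 1 - j.1) * a j using Nat.strong_induction_on generalizing a with
  | _ m ih =>
    subst hm
    by_cases h1 : ∃ (i : Fin n) (h : i.1 + 1 < n), 2 * a ⟨i.1 + 1, h⟩ < a i
    · obtain ⟨i, h, hlt⟩ := h1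
      have hle : ∀ {S T U : Submodule (ZMod 2) (L₁Pow n).carrier}, S ≤ U → T ≤ U →
        gen a ∈ S ⊔ T → gen a ∈ U := fun h1 h2 h => sup_le h1 h2 h
      refine hle (Submodule.span_le.2 ?_) ?_ (gen_mem_of_two_mul_lt ha h hlt)
      · rintro _ ⟨a', ha', hsum, hlt', rfl⟩
        have := ih _ hlt' ha' rfl
        rwa [hsum] at this
      · exact (le_iSup (MP n) i).trans le_sup_right
    · by_cases h2 : ∃ i : Fin n, i.1 + 1 = n ∧ 1 < a i
      · obtain ⟨i, hi, hlt⟩ := h2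
        exact Submodule.mem_sup_right ((le_iSup (MP n) i) (gen_mem_MP_of_last hi hlt))
      · push Not at h1 h2
        refine Submodule.mem_sup_left (Submodule.subset_span ⟨a, ⟨ha, h1, fun i hi => ?_⟩, rfl,
          rfl⟩)
        have := ha i
        have := h2 i hi
        omega

end L₁Pow

/-! ### Cayley sequences and chains -/

namespace L₁Pow

variable {n d : ℕ}

theorem IsCayley.le_two_pow {a : Fin n → ℕ} (ha : IsCayley a) (i : Fin n) :
    a i ≤ 2 ^ (n - 1 - i.1) := by
  induction hm : n - 1 - i.1 generalizing i with
  | zero =>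
    rw [ha.2.2 i (by omega), pow_zero]
  | succ m ih =>
    have h : i.1 + 1 < n := by omega
    have h1 := ha.2.1 i h
    have h2 := ih ⟨i.1 + 1, h⟩ (by simp only; omega)
    rw [pow_succ]
    omega

/-- The chain with `k_{t+1} = 2^{n-1-t} - a_t`. -/
def toChain (a : Fin n → ℕ) : ℕ → ℕ
  | 0 => 2 ^ n - 1
  | t + 1 => if h : t < n then 2 ^ (n - 1 - t) - a ⟨t, h⟩ else 0

theorem toChain_mem {a : Fin n → ℕ} (ha : IsCayley a) :
    toChain a ∈ halvingChains n (∑ i, a i) := by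
  refine ⟨rfl, fun t => ?_, ?_⟩
  · rcases t with _ | t
    · rw [toChain, toChain]
      split_ifs with h
      · have := ha.1 ⟨0, h⟩
        have h2 : 2 ^ n = 2 * 2 ^ (n - 1 - 0) := by
          rw [← pow_succ']
          congr 1
          omega
        omega
      · omega
    · rw [toChain, toChain]
      split_ifs with h1 h2 h3
      · have := ha.2.1 ⟨t, h2⟩ h1
        have h3 : 2 ^ (n - 1 - t) = 2 * 2 ^ (n - 1 - (t + 1)) := by
          rw [← pow_succ']
          congr 1
          omega
        simp only at this
        omega
      · omega
      · omega
      · omega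
  · rw [Finset.sum_range, ← sum_two_pow, ← Finset.sum_add_distrib]
    refine Finset.sum_congr rfl fun i _ => ?_
    have := ha.le_two_pow i
    rw [toChain, dif_pos i.2]
    simp only [Fin.eta]
    omega

/-- The Cayley sequences of sum `d`. -/
abbrev CayleySeq (n d : ℕ) : Type := {a : Fin n → ℕ // IsCayley a ∧ ∑ i, a i = d}

/-- Cayley sequences as chains. -/
def CayleySeq.toChain (a : CayleySeq n d) : halvingChains n d :=
  ⟨L₁Pow.toChain a.1, by
    have := toChain_mem a.2.1
    rwa [a.2.2] at this⟩

theorem CayleySeq.toChain_injective : Function.Injective (CayleySeq.toChain (n := n) (d := d)) := by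
  intro a a' h
  refine Subtype.ext (funext fun i => ?_)
  have h1 := congrFun (congrArg Subtype.val h) (i.1 + 1)
  have h2 := a.2.1.le_two_pow i
  have h3 := a'.2.1.le_two_pow i
  simp only [CayleySeq.toChain, L₁Pow.toChain, i.2, dif_pos, Fin.eta] at h1
  omega

instance (n d : ℕ) : Finite (CayleySeq n d) :=
  Finite.of_injective _ CayleySeq.toChain_injective

end L₁Pow

/-! ### The rank of `g` -/

namespace Detection

open MvPolynomial Steinberg

theorem sq_aeval_linForm {N n : ℕ} (V : Fin N → Fin n → ZMod 2) (k : ℕ)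
    (f : MvPolynomial (Fin N) (ZMod 2)) :
    aeval (fun i => linForm (V i)) (sq N k f) = sq n k (aeval (fun i => linForm (V i)) f) := by
  have h : (totalSq n).comp (aeval fun i => linForm (V i)) =
      (Polynomial.mapAlgHom (aeval fun i => linForm (V i))).comp (totalSq N) := by
    refine MvPolynomial.algHom_ext fun i => ?_
    rw [AlgHom.comp_apply, AlgHom.comp_apply, aeval_X, totalSq_X, linForm, totalSq_linear]
    simp only [map_add, map_mul, Polynomial.coe_mapAlgHom, Polynomial.map_C, Polynomial.map_X,
      RingHom.coe_coe, map_pow, aeval_X, linForm]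
    ring
  have h2 := congrArg (fun F => Polynomial.coeff F k) (DFunLike.congr_fun h f)
  simp only [AlgHom.comp_apply, Polynomial.coe_mapAlgHom, Polynomial.coeff_map,
    RingHom.coe_coe] at h2
  exact h2.symm

end Detection

namespace TwoPower

open MvPolynomial

theorem msym_isHomogeneous (d : ℕ) (c : Multiset ℕ) : (msym d c).IsHomogeneous (weight c) := by
  refine IsHomogeneous.sum _ _ _ fun j hj => ?_
  rw [← mem_tuples.1 hj, weight_typ]
  exact IsHomogeneous.prod _ _ _ fun i _ => isHomogeneous_X_pow i _

end TwoPower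

namespace L₁Pow

open MvPolynomial Steinberg

variable {n : ℕ} (d : ℕ) {π : ∀ s : ℕ, SqMod.Hom (steinbergL 1) (brownGitler (2 ^ s))}
  {μ : SqMod.Hom (SqMod.tensor fun i : Fin n => brownGitler (2 ^ (n - 1 - i.1)))
    (brownGitler (2 ^ n - 1))}

/-- The operation that takes `x_0 ⋯ x_{d-1}` to the symmetric polynomial of a chain. -/
noncomputable def chainOp (k : halvingChains n d) : FreeAlgebra (ZMod 2) ℕ :=
  (TwoPower.exists_lift_eq_msym _ (halvingChains.card_toMultiset k.2)).choose

theorem lift_chainOp (k : halvingChains n d) : FreeAlgebra.lift (ZMod 2)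
    (A := Module.End (ZMod 2) (MvPolynomial (Fin d) (ZMod 2))) (sq d) (chainOp d k) (∏ i, X i) =
      TwoPower.msym d (halvingChains.toMultiset n k.1) :=
  (TwoPower.exists_lift_eq_msym _ (halvingChains.card_toMultiset k.2)).choose_spec

/-- The values of a linear form on the operations of the chains. -/
noncomputable def evalOps (n : ℕ) : (brownGitler (2 ^ n - 1)).carrier →ₗ[ZMod 2]
    (halvingChains n d → ZMod 2) where
  toFun φ k := φ.1 (RingQuot.mkAlgHom (ZMod 2) AdemRel (chainOp d k))
  map_add' _ _ := rfl
  map_smul' _ _ := rfl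

variable {d}

theorem gMap_gen_mem_span (hπ : ∀ s, (π s).Nontrivial) (hμ : μ.Nontrivial) {a : Fin n → ℕ}
    (ha : ∀ i, 0 < a i) (hd : ∑ i, a i = d) : (gMap n π μ).toLin (gen a) ∈
      Submodule.span (ZMod 2) (Set.range fun a : CayleySeq n d => (gMap n π μ).toLin (gen a.1)) := by
  have hle : Submodule.span (ZMod 2) {z | ∃ a' : Fin n → ℕ, IsCayley a' ∧
      ∑ j, a' j = ∑ j, a j ∧ z = gen a'} ⊔ ⨆ i, MP n i ≤ (Submodule.span (ZMod 2)
        (Set.range fun a : CayleySeq n d => (gMap n π μ).toLin (gen a.1))).comap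
          (gMap n π μ).toLin := by
    refine sup_le (Submodule.span_le.2 ?_) (iSup_le fun i z hz => ?_)
    · rintro _ ⟨a', ha', hsum, rfl⟩
      exact Submodule.subset_span ⟨⟨a', ha', hsum.trans hd⟩, rfl⟩
    · rw [Submodule.mem_comap, LinearMap.mem_ker.1 (gMap_MP hπ hμ i hz)]
      exact zero_mem _
  exact hle (gen_mem_span_isCayley_sup ha)

/-- The operations of the chains are linearly independent on the image of `g`: a combination `θ` that
vanishes there takes `x_0 ⋯ x_{d-1}` to a polynomial that is not detected by linear substitutions,
and so to zero, but the symmetric polynomials of the chains are linearly independent. -/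
theorem span_evalOps (hπ : ∀ s, (π s).Nontrivial) (hμ : μ.Nontrivial) :
    Submodule.span (ZMod 2) (Set.range fun a : CayleySeq n d =>
      evalOps d n ((gMap n π μ).toLin (gen a.1))) = ⊤ := by
  classical
  have := Fintype.ofFinite (halvingChains n d)
  by_contra hne
  -- a nonzero form `α` that vanishes on the span gives the combination `θ`
  obtain ⟨α, hα0, hα⟩ := Submodule.exists_le_ker_of_lt_top _ (lt_top_iff_ne_top.2 hne)
  have hαv : ∀ v : halvingChains n d → ZMod 2, α v = ∑ k, α (Pi.single k 1) * v k := by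
    intro v
    conv_lhs => rw [pi_eq_sum_univ' v, map_sum]
    refine Finset.sum_congr rfl fun k _ => ?_
    rw [map_smul, smul_eq_mul, mul_comm]
  let θ : FreeAlgebra (ZMod 2) ℕ := ∑ k, α (Pi.single k 1) • chainOp d k
  let h : MvPolynomial (Fin d) (ZMod 2) :=
    ∑ k, α (Pi.single k 1) • TwoPower.msym d (halvingChains.toMultiset n k.1)
  have hθ : FreeAlgebra.lift (ZMod 2) (A := Module.End (ZMod 2)
      (MvPolynomial (Fin d) (ZMod 2))) (sq d) θ (∏ i, X i) = h := by
    simp only [θ, h, map_sum, map_smul, LinearMap.sum_apply, LinearMap.smul_apply, lift_chainOp]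
  have hhom : h.IsHomogeneous (2 ^ n - 1) := by
    refine (homogeneousSubmodule _ _ _).sum_mem fun k _ => Submodule.smul_mem _ _ ?_
    have := TwoPower.msym_isHomogeneous d (halvingChains.toMultiset n k.1)
    rwa [halvingChains.weight_toMultiset k.2] at this
  have h0 : h ≠ 0 := by
    intro h0
    refine hα0 (LinearMap.ext fun v => ?_)
    rw [hαv]
    refine Finset.sum_eq_zero fun k _ => ?_
    obtain ⟨j, hj⟩ := TwoPower.exists_typ_eq (halvingChains.card_toMultiset k.2)
    have hc := TwoPower.coeff_msym
      (show ⇑(Finsupp.equivFunOnFinite.symm fun i => 2 ^ j i) = fun i => 2 ^ j i from rfl)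
    have h1 := congrArg (coeff (Finsupp.equivFunOnFinite.symm fun i => 2 ^ j i)) h0
    simp only [h, coeff_sum, coeff_smul, hc, hj, coeff_zero] at h1
    rw [Finset.sum_eq_single k, if_pos rfl, smul_eq_mul, mul_one] at h1
    · rw [h1, zero_mul]
    · intro k' _ hk'
      rw [if_neg, smul_zero]
      exact fun h => hk' (Subtype.ext (halvingChains.toMultiset_injective k'.2 k.2 h.symm))
    · intro hk
      exact absurd (Finset.mem_univ k) hk
  obtain ⟨V, hV⟩ := Detection.exists_topCoeff_ne_zero n hhom h0
  rw [← hθ] at hV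
  have hcomm := SqMod.map_lift (S := sq d) (T := sq n)
    (aeval fun i => Detection.linForm (V i)).toLinearMap
    (fun k f => Detection.sq_aeval_linForm V k f) θ (∏ i, X i)
  have hX : aeval (fun i => Detection.linForm (V i)) (∏ i, X i : MvPolynomial (Fin d) (ZMod 2)) =
      ∏ i, Detection.linForm (V i) := by
    simp only [map_prod, aeval_X]
  rw [AlgHom.toLinearMap_apply, AlgHom.toLinearMap_apply, hX] at hcomm
  rw [hcomm] at hV
  have hP : (∏ i, Detection.linForm (V i)).IsHomogeneous d := by
    have := IsHomogeneous.prod Finset.univ (fun i => Detection.linForm (V i)) (fun _ => 1)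
      fun i _ => Detection.linForm_isHomogeneous (V i)
    simpa using this
  -- the monomials of `∏ linForm (V i)` that omit a variable contribute nothing, and the others are
  -- images of tensors
  refine hV ?_
  generalize ∏ i, Detection.linForm (V i) = P at hP
  rw [P.as_sum, map_sum, map_sum]
  refine Finset.sum_eq_zero fun s hs => ?_
  by_cases hpos : ∀ i, 0 < s i
  · have hsd : ∑ i, s i = d := by
      rw [← Finsupp.degree_eq_sum, ← hP (mem_support_iff.1 hs), Finsupp.degree_eq_weight_one]
      rfl
    have hmon : monomial s (coeff s P) = coeff s P • toPoly n (gen s) := by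
      rw [toPoly_gen hpos, smul_eq_C_mul, monomial_eq, Finsupp.prod_fintype _ _ fun i => pow_zero _]
    rw [hmon, map_smul, map_smul, ← gMap_apply hπ hμ]
    have hker : evalOps d n ((gMap n π μ).toLin (gen s)) ∈ LinearMap.ker α := by
      refine hα ?_
      have := Submodule.mem_map_of_mem (f := evalOps d n) (gMap_gen_mem_span hπ hμ hpos hsd)
      rwa [Submodule.map_span, ← Set.range_comp] at this
    rw [LinearMap.mem_ker, hαv] at hker
    have : ((gMap n π μ).toLin (gen s)).1 (RingQuot.mkAlgHom (ZMod 2) AdemRel θ) = 0 := by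
      rw [← hker]
      simp only [θ, map_sum, map_smul, smul_eq_mul]
      rfl
    rw [this, smul_zero]
  · push Not at hpos
    obtain ⟨t, ht⟩ := hpos
    refine topCoeff_lift_eq_zero (t := t) ?_ θ
    refine mem_supported.2 fun l hl => ?_
    rw [SetLike.mem_coe, mem_vars_iff_mem_support] at hl
    obtain ⟨u, hu, hul⟩ := hl
    have := support_monomial_subset hu
    rw [Finset.mem_singleton] at this
    subst this
    rintro rfl
    rw [Finsupp.mem_support_iff] at hul
    omega

/-- There are no more Cayley sequences than chains, and they span a space of the dimension of the
number of chains. -/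
theorem linearIndependent_evalOps (hπ : ∀ s, (π s).Nontrivial) (hμ : μ.Nontrivial) :
    LinearIndependent (ZMod 2) (fun a : CayleySeq n d =>
      evalOps d n ((gMap n π μ).toLin (gen a.1))) ∧
      Nat.card (CayleySeq n d) = Nat.card (halvingChains n d) := by
  have := Fintype.ofFinite (halvingChains n d)
  have := Fintype.ofFinite (CayleySeq n d)
  have hspan := span_evalOps (d := d) hπ hμ
  have h1 : Nat.card (CayleySeq n d) ≤ Nat.card (halvingChains n d) :=
    Nat.card_le_card_of_injective _ CayleySeq.toChain_injective
  have h2 := finrank_range_le_card (R := ZMod 2) fun a : CayleySeq n d =>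
      evalOps d n ((gMap n π μ).toLin (gen a.1))
  rw [Set.finrank, hspan, finrank_top, Module.finrank_pi] at h2
  simp only [Nat.card_eq_fintype_card] at h1 ⊢
  have h3 := le_antisymm h1 h2
  exact ⟨linearIndependent_of_top_le_span_of_card_eq_finrank hspan.ge
    (by rw [h3, Module.finrank_pi]), h3⟩

theorem linearIndependent_gMap_gen (hπ : ∀ s, (π s).Nontrivial) (hμ : μ.Nontrivial) (d : ℕ) :
    LinearIndependent (ZMod 2) fun a : CayleySeq n d => (gMap n π μ).toLin (gen a.1) :=
  LinearIndependent.of_comp (evalOps d n) (linearIndependent_evalOps hπ hμ).1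

/-- The images of the tensors with Cayley exponents of sum `d` span the part of degree `d` of
`J(2^n - 1)`, because they are independent and as numerous as the chains. -/
theorem span_gMap_gen (hπ : ∀ s, (π s).Nontrivial) (hμ : μ.Nontrivial) (d : ℕ) :
    Submodule.span (ZMod 2) (Set.range fun a : CayleySeq n d => (gMap n π μ).toLin (gen a.1)) =
      (brownGitler (2 ^ n - 1)).deg d := by
  have := Fintype.ofFinite (CayleySeq n d)
  have hle : Submodule.span (ZMod 2) (Set.range fun a : CayleySeq n d =>
      (gMap n π μ).toLin (gen a.1)) ≤ (brownGitler (2 ^ n - 1)).deg d := by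
    refine Submodule.span_le.2 ?_
    rintro _ ⟨a, rfl⟩
    refine (gMap n π μ).map_deg d _ ?_
    have := gen_mem a.1
    rwa [a.2.2] at this
  refine Submodule.eq_of_le_of_finrank_le hle ?_
  rw [finrank_span_eq_card (linearIndependent_gMap_gen hπ hμ d), ← Nat.card_eq_fintype_card,
    (linearIndependent_evalOps hπ hμ).2]
  exact halvingChains.finrank_deg_le n d

/-! ### The kernel and the image of `g` -/

theorem map_deg_gMap (hπ : ∀ s, (π s).Nontrivial) (hμ : μ.Nontrivial) (d : ℕ) :
    (brownGitler (2 ^ n - 1)).deg d ≤ ((L₁Pow n).deg d).map (gMap n π μ).toLin := by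
  rw [← span_gMap_gen hπ hμ d, Submodule.span_le]
  rintro _ ⟨a, rfl⟩
  refine ⟨gen a.1, ?_, rfl⟩
  have := gen_mem a.1
  rwa [a.2.2] at this

theorem gMap_surjective (hπ : ∀ s, (π s).Nontrivial) (hμ : μ.Nontrivial) :
    Function.Surjective (gMap n π μ).toLin := by
  rw [← LinearMap.range_eq_top, eq_top_iff,
    ← (BrownGitler.isUnstable (2 ^ n - 1)).isInternal.submodule_iSup_eq_top]
  exact iSup_le fun d => (map_deg_gMap hπ hμ d).trans LinearMap.map_le_range

theorem top_le_span_gen_sup (n : ℕ) : ⊤ ≤ (⨆ d, Submodule.span (ZMod 2)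
    (Set.range fun a : CayleySeq n d => gen a.1)) ⊔ ⨆ i, MP n i := by
  rw [← span_gen, Submodule.span_le]
  rintro _ ⟨a, rfl⟩
  have hle : ∀ {S T U : Submodule (ZMod 2) (L₁Pow n).carrier} {x}, S ≤ T → x ∈ S ⊔ U →
    x ∈ T ⊔ U := fun h hx => sup_le_sup_right h _ hx
  refine hle (Submodule.span_le.2 ?_) (gen_mem_span_isCayley_sup fun i => (a i).2)
  rintro _ ⟨a', ha', -, rfl⟩
  exact (le_iSup (fun d => Submodule.span (ZMod 2)
    (Set.range fun a : CayleySeq n d => gen a.1)) _)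
    (Submodule.subset_span ⟨⟨a', ha', rfl⟩, rfl⟩)

/-- The tensors with Cayley exponents span `L_1^{⊗n}` modulo the `MP(i)`, and their images under `g`
are linearly independent in each degree. -/
theorem ker_gMap (hπ : ∀ s, (π s).Nontrivial) (hμ : μ.Nontrivial) :
    LinearMap.ker (gMap n π μ).toLin = ⨆ i, MP n i := by
  refine le_antisymm (fun z hz => ?_) (iSup_le fun i => gMap_MP hπ hμ i)
  obtain ⟨y, hy, m, hm, rfl⟩ := Submodule.mem_sup.1
    (top_le_span_gen_sup n (Submodule.mem_top (x := z)))
  have hgm : (gMap n π μ).toLin m = 0 := (iSup_le fun i => gMap_MP hπ hμ i :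
    ⨆ i, MP n i ≤ LinearMap.ker (gMap n π μ).toLin) hm
  have hgy : (gMap n π μ).toLin y = 0 := by
    have : (gMap n π μ).toLin (y + m) = 0 := hz
    rwa [map_add, hgm, add_zero] at this
  obtain ⟨f, hf, rfl⟩ := (Submodule.mem_iSup_iff_exists_finsupp _ _).1 hy
  have hJ := BrownGitler.isUnstable (2 ^ n - 1)
  have hfd : ∀ d, (gMap n π μ).toLin (f d) ∈ (brownGitler (2 ^ n - 1)).deg d := by
    intro d
    rw [← span_gMap_gen hπ hμ d]
    have := Submodule.mem_map_of_mem (f := (gMap n π μ).toLin) (hf d)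
    rwa [Submodule.map_span, ← Set.range_comp] at this
  have hf0 : ∀ d, f d = 0 := by
    intro d
    have h1 := congrArg (BrownGitler.proj hJ d) hgy
    rw [Finsupp.sum, map_sum, map_sum, map_zero, Finset.sum_eq_single d] at h1
    · have h2 := BrownGitler.proj_self hJ d ⟨_, hfd d⟩
      rw [h1] at h2
      have h3 : (gMap n π μ).toLin (f d) = 0 := (congrArg Subtype.val h2).symm
      exact Submodule.disjoint_def.1 (Submodule.range_ker_disjoint
        (linearIndependent_gMap_gen hπ hμ d)) _ (hf d) h3
    · intro e _ he
      exact BrownGitler.proj_of_mem hJ d e (hfd e) he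
    · intro hd
      rw [Finsupp.notMem_support_iff.1 hd, map_zero, map_zero]
  rw [Finsupp.sum, Finset.sum_eq_zero fun d _ => hf0 d, zero_add]
  exact hm

end L₁Pow

/-! ### The quotient -/

namespace SqMod

/-- A module isomorphic to an unstable module is unstable. -/
theorem Iso.isUnstable {M : SqMod.{u}} {N : SqMod.{v}} (e : Iso M N) (hN : N.IsUnstable) :
    M.IsUnstable where
  isInternal := by
    refine isInternal_of_proj (fun d => e.inv.toLin ∘ₗ (N.deg d).subtype ∘ₗ
      BrownGitler.proj hN d ∘ₗ e.hom.toLin) (fun d x hx => ?_) (fun d d' h x hx => ?_) ?_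
    · change e.inv.toLin (BrownGitler.proj hN d (e.hom.toLin x)).1 = x
      rw [BrownGitler.proj_self hN d ⟨_, e.hom.map_deg d x hx⟩, e.hom_inv]
    · change e.inv.toLin (BrownGitler.proj hN d (e.hom.toLin x)).1 = 0
      rw [BrownGitler.proj_of_mem hN d d' (e.hom.map_deg d' x hx) h]
      exact map_zero _
    · refine eq_top_iff.2 fun x _ => ?_
      rw [← e.hom_inv x]
      have hle : (⨆ d, N.deg d) ≤ (⨆ d, M.deg d).comap e.inv.toLin :=
        iSup_le fun d y hy => (le_iSup M.deg d) (e.inv.map_deg d y hy)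
      refine hle ?_
      rw [hN.isInternal.submodule_iSup_eq_top]
      trivial
  sq_mem i d x hx := by
    rw [← e.hom_inv (M.sq i x), e.hom.map_sq]
    exact e.inv.map_deg _ _ (hN.sq_mem i d _ (e.hom.map_deg d x hx))
  rel a b hab := by
    refine LinearMap.ext fun x => ?_
    have hinj : Function.Injective e.hom.toLin := Function.LeftInverse.injective e.hom_inv
    refine hinj ?_
    rw [map_lift (S := M.sq) (T := N.sq) e.hom.toLin e.hom.map_sq,
      map_lift (S := M.sq) (T := N.sq) e.hom.toLin e.hom.map_sq]
    exact LinearMap.congr_fun (hN.rel a b hab) _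
  unstable i d x hx hi := by
    rw [← e.hom_inv (M.sq i x), e.hom.map_sq, hN.unstable i d _ (e.hom.map_deg d x hx) hi,
      map_zero]

variable {M : SqMod.{u}} {N : SqMod.{v}}

theorem Hom.stable_of_ker_eq (f : Hom M N) {S : Submodule (ZMod 2) M.carrier}
    (h : LinearMap.ker f.toLin = S) : M.Stable S := by
  subst h
  intro i x hx
  rw [Submodule.mem_comap, LinearMap.mem_ker, f.map_sq, LinearMap.mem_ker.1 hx, map_zero]

/-- The isomorphism induced on the quotient by the kernel by a morphism that is surjective in
every degree. -/
theorem Hom.exists_iso (f : Hom M N) {S : Submodule (ZMod 2) M.carrier}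
    (h : LinearMap.ker f.toLin = S) (hf : Function.Surjective f.toLin)
    (hdeg : ∀ d, N.deg d ≤ (M.deg d).map f.toLin) (hS : M.Stable S) :
    ∃ e : Iso (M.quot S hS) N, ∀ x, e.hom.toLin (Submodule.Quotient.mk x) = f.toLin x := by
  subst h
  let φ : (M.carrier ⧸ LinearMap.ker f.toLin) ≃ₗ[ZMod 2] N.carrier :=
    f.toLin.quotKerEquivOfSurjective hf
  have hφ : ∀ x, φ (Submodule.Quotient.mk x) = f.toLin x := fun x => rfl
  have hsq : ∀ i x, φ ((M.quot _ hS).sq i x) = N.sq i (φ x) := by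
    intro i x
    obtain ⟨x, rfl⟩ := Submodule.Quotient.mk_surjective _ x
    exact (hφ _).trans ((f.map_sq i x).trans (congrArg _ (hφ x).symm))
  refine ⟨⟨⟨φ.toLinearMap, ?_, hsq⟩, ⟨φ.symm.toLinearMap, ?_, ?_⟩, φ.symm_apply_apply,
    φ.apply_symm_apply⟩, hφ⟩
  · rintro d _ ⟨x, hx, rfl⟩
    exact f.map_deg d x hx
  · intro d y hy
    obtain ⟨x, hx, rfl⟩ := hdeg d hy
    exact ⟨x, hx, (φ.symm_apply_apply (Submodule.Quotient.mk x)).symm⟩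
  · intro i y
    refine φ.symm_apply_eq.2 ?_
    refine Eq.trans ?_ (hsq i (φ.symm y)).symm
    rw [φ.apply_symm_apply]

end SqMod

theorem mainTheorem4 (n : ℕ) (hn : 1 ≤ n) :
    (∀ s : ℕ, ∃! p : SqMod.Hom (steinbergL 1) (brownGitler (2 ^ s)), p.Nontrivial) ∧
    (∃! m : SqMod.Hom (SqMod.tensor fun i : Fin n => brownGitler (2 ^ (n - 1 - i.1)))
      (brownGitler (2 ^ n - 1)), m.Nontrivial) ∧
    (L₁Pow n).IsUnstable ∧
    ∀ (π : ∀ s : ℕ, SqMod.Hom (steinbergL 1) (brownGitler (2 ^ s)))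
      (μ : SqMod.Hom (SqMod.tensor fun i : Fin n => brownGitler (2 ^ (n - 1 - i.1)))
        (brownGitler (2 ^ n - 1))),
      (∀ s, (π s).Nontrivial) → μ.Nontrivial →
        Function.Surjective (gMap n π μ).toLin ∧
        ∃ hMP : (L₁Pow n).Stable (⨆ i : Fin n, L₁Pow.MP n i),
          ((L₁Pow n).quot (⨆ i : Fin n, L₁Pow.MP n i) hMP).IsUnstable ∧
          ∃ e : SqMod.Iso ((L₁Pow n).quot (⨆ i : Fin n, L₁Pow.MP n i) hMP)
              (brownGitler (2 ^ n - 1)),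
            ∀ x : (L₁Pow n).carrier,
              e.hom.toLin (Submodule.Quotient.mk x) = (gMap n π μ).toLin x := by
  refine ⟨fun s => BrownGitler.existsUnique_nontrivial Steinberg.isUnstable_L_one
    (Steinberg.power_mem (2 ^ s)) (Steinberg.power_ne_zero (by positivity))
    (Steinberg.deg_le_span_power _), ?_, L₁Pow.isUnstable n, fun π μ hπ hμ => ?_⟩
  · have h : ∀ s : ℕ, ∃ p : SqMod.Hom (steinbergL 1) (brownGitler (2 ^ s)), p.Nontrivial :=
      fun s => (BrownGitler.existsUnique_nontrivial Steinberg.isUnstable_L_one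
        (Steinberg.power_mem (2 ^ s)) (Steinberg.power_ne_zero (by positivity))
        (Steinberg.deg_le_span_power _)).exists
    choose π hπ using h
    exact BrownGitler.existsUnique_nontrivial (L₁Pow.isUnstable_tensor_brownGitler n)
      (L₁Pow.topTensor_mem π n) (L₁Pow.topTensor_ne_zero π hπ n)
      (L₁Pow.deg_le_span_topTensor π hπ n)
  · have hker := L₁Pow.ker_gMap hπ hμ
    have hsurj := L₁Pow.gMap_surjective hπ hμ
    have hMP := (gMap n π μ).stable_of_ker_eq hker
    obtain ⟨e, he⟩ := (gMap n π μ).exists_iso hker hsurj (L₁Pow.map_deg_gMap hπ hμ) hMP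
    exact ⟨hsurj, hMP, e.isUnstable (BrownGitler.isUnstable _), e, he⟩
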